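/- **Theorem 10 (Asymptotics of ETEL under misspecification).** Let $x_1,x_2,\dots$ be i.i.d. random elements of a standard Borel space $\mathcal X$ (for instance a Borel subset of $\mathbb R^{N_x}$), let $E$ denote expectation under their common law and $x$ a random element with this law. Let $\Theta\subset\mathbb R^{N_\theta}$ be compact and let $g:\mathcal X\times\mathbb R^{N_\theta}\to\mathbb R^{N_g}$ be jointly measurable with $E\|g(x,\theta)\|<\infty$ for all $\theta\in\Theta$. Write $G(x,\theta)=\partial g(x,\theta)/\partial\theta'$ and $S_{jl}(x,\theta)=\partial^2 g(x,\theta)/\partial\theta_j\partial\theta_l$. *Estimator.* For a sample of size $n$ and $\theta\in\Theta$, let $\hat w(\theta)$ be the minimizer of $n^{-1}\sum_i nw_i\ln(nw_i)$ over weights $w_i\ge 0$ with $\sum_i w_i g(x_i,\theta)=0$ and $\sum_i w_i=1$. An ETEL estimate $\hat\theta$ is a minimizer over $\theta\in\Theta$ of $n^{-1}\sum_i-\ln(n\hat w_i(\theta))$, which is read as $+\infty$ where $\hat w(\theta)$ does not exist or has a zero entry (and the minimum has to be finite). With $g_i=g(x_i,\hat\theta)$, an augmented ETEL estimate is $\hat\beta=(\hat\tau,\hat\kappa,\hat\lambda,\hat\theta)$,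 where $\hat\theta$ is an ETEL estimate, $\hat\lambda\in\arg\max_{\lambda\in\mathbb R^{N_g}} n^{-1}\sum_i-\exp(\lambda'g_i)$, $\hat\tau=n^{-1}\sum_i\hat\tau_i$ with $\hat\tau_i=\exp(\hat\lambda'g_i)$, and $\hat\kappa$ solves $(n^{-1}\sum_i\hat\tau_ig_ig_i')\hat\kappa+\hat\tau\,n^{-1}\sum_ig_i=0$. Let $\hat\beta_n$ be random vectors such that $\hat\beta_n$ is an augmented ETEL estimate for $x_1,\dots,x_n$ with probability tending to $1$. *Regularity conditions.* 1. For every $\theta\in\Theta$ the equation $E[\exp(\lambda'g(x,\theta))g(x,\theta)]=0$ has a unique solution $\lambda=\lambda^*(\theta)$. 2. $\ln L(\theta)=-\ln E[\exp(\lambda^*(\theta)'(g(x,\theta)-E[g(x,\theta)]))]$ is maximized over $\Theta$ at a unique point $\theta^*$, and $\theta^*\in\operatorname{int}(\Theta)$. 3. For each $\theta\in\Theta$, with probability one $g(x,\cdot)$, restricted to $\Theta$, is continuous at $\theta$. 4. There are compact sets $\Lambda(\theta)\subset\mathbb R^{N_g}$, $\theta\in\Theta$, with $\bigcup_{\theta\in\Theta}\Lambda(\theta)$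 bounded and, for some $r>0$ and all $\theta\in\Theta$, containing the closed ball of radius $r$ about $\lambda^*(\theta)$, such that $E[\sup_{\theta\in\Theta}\sup_{\lambda\in\Lambda(\theta)}\exp(\lambda'g(x,\theta))]<\infty$. 5. There is an open neighbourhood $\mathcal N\subset\Theta$ of $\theta^*$ such that, with probability one, $g(x,\cdot)$ is twice continuously differentiable on $\mathcal N$. 6. There is a measurable $b$ such that, with probability one, $\|g(x,\theta)\|$, $\|G(x,\theta)\|$ and $\|S_{jl}(x,\theta)\|$ are at most $b(x)$ for all $\theta\in\mathcal N$ and $j,l=1,\dots,N_\theta$, and $E[\sup_{\theta\in\mathcal N}\sup_{\lambda\in\Lambda(\theta)}\exp(k_1\lambda'g(x,\theta))\,b(x)^{k_2}]<\infty$ for $k_1=0,1,2$ and $k_2=0,1,2,3,4$. *Conclusion.* For $\beta=(\tau,\kappa,\lambda,\theta)$ let, with $\tau_x=\exp(\lambda'g)$, $g=g(x,\theta)$, $G=G(x,\theta)$, $$\phi(x,\beta)=\begin{bmatrix}\tau_x-\tau\\ \tau_xg\\ (\tau-\tau_x)g+\tau_xgg'\kappa\\ \tau_xG'\kappa+\tau_xG'\lambda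 g'\kappa-\tau_xG'\lambda+\tau G'\lambda\end{bmatrix},$$ and let $\beta^*=(\tau^*,\kappa^*,\lambda^*,\theta^*)$ with $\lambda^*=\lambda^*(\theta^*)$, $\tau^*=E[\exp(\lambda^{*\prime}g(x,\theta^*))]$ and $\kappa^*=-\big(E[\exp(\lambda^{*\prime}g(x,\theta^*))g(x,\theta^*)g(x,\theta^*)']\big)^{-1}\tau^*E[g(x,\theta^*)]$. Put $\Gamma=E[\partial\phi(x,\beta)/\partial\beta'|_{\beta=\beta^*}]$ and $\Phi=E[\phi(x,\beta^*)\phi(x,\beta^*)']$. If $\Gamma$ is nonsingular, then $$n^{1/2}(\hat\beta_n-\beta^*)\xrightarrow{d}N\big(0,\Gamma^{-1}\Phi(\Gamma')^{-1}\big).$$ -/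

import Mathlib

open MeasureTheory ProbabilityTheory Filter Topology
open scoped ENNReal

namespace ETEL

noncomputable section

/-- Euclidean space of dimension `n`. -/
abbrev E (n : ℕ) := EuclideanSpace ℝ (Fin n)

/-- Index set of the augmented parameter `β = (τ, κ, λ, θ)`, in this order. -/
abbrev Idx (Ng Nt : ℕ) := Unit ⊕ Fin Ng ⊕ Fin Ng ⊕ Fin Nt

/-- The space of augmented parameters `β = (τ, κ, λ, θ)`. -/
abbrev B (Ng Nt : ℕ) := EuclideanSpace ℝ (Idx Ng Nt)

section Coordinates

variable {Ng Nt : ℕ}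

/-- The augmented parameter with the given blocks. -/
def mkB (t : ℝ) (k l : E Ng) (θ : E Nt) : B Ng Nt :=
  WithLp.toLp 2 (Sum.elim (fun _ => t) (Sum.elim (fun i => k i)
    (Sum.elim (fun i => l i) (fun j => θ j))))

/-- The block `τ` of `β`. -/
def tauOf (β : B Ng Nt) : ℝ := β (Sum.inl ())

/-- The block `κ` of `β`. -/
def kapOf (β : B Ng Nt) : E Ng := WithLp.toLp 2 fun i => β (Sum.inr (Sum.inl i))

/-- The block `λ` of `β`. -/
def lamOf (β : B Ng Nt) : E Ng := WithLp.toLp 2 fun i => β (Sum.inr (Sum.inr (Sum.inl i)))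

/-- The block `θ` of `β`. -/
def thOf (β : B Ng Nt) : E Nt := WithLp.toLp 2 fun j => β (Sum.inr (Sum.inr (Sum.inr j)))

end Coordinates

variable {𝒳 : Type*} {Ng Nt : ℕ}

/-- The tilting factor `exp(λ' g(x, θ))`. -/
def tilt (g : 𝒳 → E Nt → E Ng) (x : 𝒳) (θ : E Nt) (l : E Ng) : ℝ :=
  Real.exp (inner ℝ l (g x θ))

/-! ### The estimator -/

/-- `w` solves the exponential tilting problem at `θ` for the sample `x₁, …, xₙ`: it minimizes
`n⁻¹ ∑ (n wᵢ) ln (n wᵢ)` (with `0 ln 0 = 0`) among the nonnegative weights with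
`∑ wᵢ g(xᵢ, θ) = 0` and `∑ wᵢ = 1`. -/
def IsETWeights (g : 𝒳 → E Nt → E Ng) {n : ℕ} (x : Fin n → 𝒳) (θ : E Nt) (w : Fin n → ℝ) : Prop :=
  let feasible : Set (Fin n → ℝ) :=
    {v | (∀ i, 0 ≤ v i) ∧ ∑ i, v i • g (x i) θ = 0 ∧ ∑ i, v i = 1}
  w ∈ feasible ∧
    IsMinOn (fun v : Fin n → ℝ => (n : ℝ)⁻¹ * ∑ i, (n * v i) * Real.log (n * v i)) feasible w

/-- The empirical likelihood discrepancy `n⁻¹ ∑ -ln (n wᵢ)` (meaningful for positive weights). -/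
def elDiscrepancy {n : ℕ} (w : Fin n → ℝ) : ℝ :=
  (n : ℝ)⁻¹ * ∑ i, -Real.log (n * w i)

/-- `θ` is an exponentially tilted empirical likelihood estimate for the sample `x₁, …, xₙ`:
it minimizes over `Θ` the discrepancy `n⁻¹ ∑ -ln (n ŵᵢ(θ))` of the exponential tilting
weights. The discrepancy is `+∞` at the parameters where the weights do not exist or where one
of them is zero, so `θ` is compared with the other parameters only. -/
def IsETEL (g : 𝒳 → E Nt → E Ng) (Θ : Set (E Nt)) {n : ℕ} (x : Fin n → 𝒳) (θ : E Nt) : Prop :=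
  θ ∈ Θ ∧ ∃ w : Fin n → ℝ, IsETWeights g x θ w ∧ (∀ i, 0 < w i) ∧
    ∀ θ' ∈ Θ, ∀ w' : Fin n → ℝ, IsETWeights g x θ' w' → (∀ i, 0 < w' i) →
      elDiscrepancy w ≤ elDiscrepancy w'

/-- `β = (τ, κ, λ, θ)` is an augmented ETEL estimate for the sample `x₁, …, xₙ`: `θ` is an ETEL
estimate, `λ` maximizes `n⁻¹ ∑ -exp(λ' gᵢ)` over the whole space, `τ = n⁻¹ ∑ τᵢ` with
`τᵢ = exp(λ' gᵢ)`, and `(n⁻¹ ∑ τᵢ gᵢ gᵢ') κ + τ n⁻¹ ∑ gᵢ = 0`, where `gᵢ = g(xᵢ, θ)`. -/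
structure IsAugmentedETEL (g : 𝒳 → E Nt → E Ng) (Θ : Set (E Nt)) {n : ℕ} (x : Fin n → 𝒳)
    (β : B Ng Nt) : Prop where
  theta : IsETEL g Θ x (thOf β)
  lam : IsMaxOn (fun l : E Ng => (n : ℝ)⁻¹ * ∑ i, -tilt g (x i) (thOf β) l) Set.univ (lamOf β)
  tau : tauOf β = (n : ℝ)⁻¹ * ∑ i, tilt g (x i) (thOf β) (lamOf β)
  kap : (n : ℝ)⁻¹ • ∑ i, (tilt g (x i) (thOf β) (lamOf β) *
        inner ℝ (g (x i) (thOf β)) (kapOf β)) • g (x i) (thOf β)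
      + tauOf β • ((n : ℝ)⁻¹ • ∑ i, g (x i) (thOf β)) = 0

/-! ### The moment function of the augmented parameter -/

/-- The `j`-th column `∂g(x, θ)/∂θⱼ` of the Jacobian `G(x, θ) = ∂g(x, θ)/∂θ'`. -/
def Gcol (g : 𝒳 → E Nt → E Ng) (x : 𝒳) (θ : E Nt) (j : Fin Nt) : E Ng :=
  fderiv ℝ (g x) θ (EuclideanSpace.single j 1)

/-- The second partial derivative `∂²g(x, θ)/∂θⱼ∂θₗ`. -/
def Spart (g : 𝒳 → E Nt → E Ng) (x : 𝒳) (θ : E Nt) (j l : Fin Nt) : E Ng :=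
  fderiv ℝ (fun θ' => Gcol g x θ' l) θ (EuclideanSpace.single j 1)

/-- The moment function of the augmented parameter, with `τₓ = exp(λ' g)`:
`φ(x, β) = (τₓ - τ, τₓ g, (τ - τₓ) g + τₓ g g' κ,
  τₓ G'κ + τₓ G'λ g'κ - τₓ G'λ + τ G'λ)`. -/
def phi (g : 𝒳 → E Nt → E Ng) (x : 𝒳) (β : B Ng Nt) : B Ng Nt :=
  let θ := thOf β
  let l := lamOf β
  let k := kapOf β
  let t := tauOf β
  let tx := tilt g x θ l
  mkB (tx - t)
    (tx • g x θ)
    ((t - tx) • g x θ + (tx * inner ℝ (g x θ) k) • g x θ)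
    (WithLp.toLp 2 fun j =>
      tx * inner ℝ (Gcol g x θ j) k
        + tx * inner ℝ (Gcol g x θ j) l * inner ℝ (g x θ) k
        - tx * inner ℝ (Gcol g x θ j) l
        + t * inner ℝ (Gcol g x θ j) l)

variable [MeasurableSpace 𝒳]

/-! ### Population quantities, for the law `μ` of one observation -/

/-- `λ` solves the population equation `E[exp(λ' g(x, θ)) g(x, θ)] = 0`. -/
def IsTiltSolution (μ : Measure 𝒳) (g : 𝒳 → E Nt → E Ng) (θ : E Nt) (l : E Ng) : Prop :=
  Integrable (fun x => tilt g x θ l • g x θ) μ ∧ ∫ x, tilt g x θ l • g x θ ∂μ = 0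

/-- `ln L(θ) = -ln E[exp(λ*(θ)' (g(x, θ) - E[g(x, θ)]))]`. -/
def logL (μ : Measure 𝒳) (g : 𝒳 → E Nt → E Ng) (lamS : E Nt → E Ng) (θ : E Nt) : ℝ :=
  -Real.log (∫ x, Real.exp (inner ℝ (lamS θ) (g x θ - ∫ y, g y θ ∂μ)) ∂μ)

/-- The regularity conditions under misspecification. Here `μ` is the law of one observation,
`lamS θ` is the solution `λ*(θ)`, `θs` the pseudo-true value, `Λ θ` the compact sets, `N` the
neighbourhood of `θs` and `b` the bounding function of the conditions. -/
structure Regularity (μ : Measure 𝒳) (g : 𝒳 → E Nt → E Ng) (Θ : Set (E Nt))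
    (lamS : E Nt → E Ng) (θs : E Nt) (Λ : E Nt → Set (E Ng)) (N : Set (E Nt)) (b : 𝒳 → ℝ) :
    Prop where
  measurable_g : Measurable (Function.uncurry g)
  measurable_b : Measurable b
  integrable_g : ∀ θ ∈ Θ, Integrable (fun x => g x θ) μ
  lamS_solution : ∀ θ ∈ Θ, IsTiltSolution μ g θ (lamS θ)
  lamS_unique : ∀ θ ∈ Θ, ∀ l, IsTiltSolution μ g θ l → l = lamS θ
  compact : IsCompact Θ
  interior : θs ∈ interior Θ
  maximizer : ∀ θ ∈ Θ, θ ≠ θs → logL μ g lamS θ < logL μ g lamS θs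
  continuous_g : ∀ θ ∈ Θ, ∀ᵐ x ∂μ, ContinuousWithinAt (g x) Θ θ
  compact_lam : ∀ θ ∈ Θ, IsCompact (Λ θ)
  bounded_lam : Bornology.IsBounded (⋃ θ ∈ Θ, Λ θ)
  interior_lam : ∃ r : ℝ, 0 < r ∧ ∀ θ ∈ Θ, Metric.closedBall (lamS θ) r ⊆ Λ θ
  exp_moment : ∫⁻ x, ⨆ θ ∈ Θ, ⨆ l ∈ Λ θ, ENNReal.ofReal (tilt g x θ l) ∂μ < ∞
  isOpen_N : IsOpen N
  mem_N : θs ∈ N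
  N_subset : N ⊆ Θ
  contDiff_g : ∀ᵐ x ∂μ, ContDiffOn ℝ 2 (g x) N
  bound_g : ∀ᵐ x ∂μ, ∀ θ ∈ N, ‖g x θ‖ ≤ b x
  bound_G : ∀ᵐ x ∂μ, ∀ θ ∈ N, ‖fderiv ℝ (g x) θ‖ ≤ b x
  bound_S : ∀ᵐ x ∂μ, ∀ θ ∈ N, ∀ j l : Fin Nt, ‖Spart g x θ j l‖ ≤ b x
  bound_moment : ∀ k₁ ≤ 2, ∀ k₂ ≤ 4,
    ∫⁻ x, ⨆ θ ∈ N, ⨆ l ∈ Λ θ,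
      ENNReal.ofReal (Real.exp ((k₁ : ℕ) * inner ℝ l (g x θ)) * b x ^ (k₂ : ℕ)) ∂μ < ∞

/-- `τ* = E[exp(λ*' g(x, θ*))]` with `λ* = λ*(θ*)`. -/
def tauStar (μ : Measure 𝒳) (g : 𝒳 → E Nt → E Ng) (lamS : E Nt → E Ng) (θs : E Nt) : ℝ :=
  ∫ x, tilt g x θs (lamS θs) ∂μ

/-- The tilted second moment matrix `E[exp(λ*' g) g g']` at `θ*`. -/
def omegaStar (μ : Measure 𝒳) (g : 𝒳 → E Nt → E Ng) (lamS : E Nt → E Ng) (θs : E Nt) :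
    Matrix (Fin Ng) (Fin Ng) ℝ :=
  Matrix.of fun i j => ∫ x, tilt g x θs (lamS θs) * g x θs i * g x θs j ∂μ

/-- `κ* = -(E[exp(λ*' g) g g'])⁻¹ (τ* E[g])` at `θ*`. -/
def kapStar (μ : Measure 𝒳) (g : 𝒳 → E Nt → E Ng) (lamS : E Nt → E Ng) (θs : E Nt) : E Ng :=
  WithLp.toLp 2 (-((omegaStar μ g lamS θs)⁻¹.mulVec
    fun i => tauStar μ g lamS θs * (∫ x, g x θs ∂μ) i))

/-- The pseudo-true augmented parameter `β* = (τ*, κ*, λ*, θ*)`. -/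
def betaStar (μ : Measure 𝒳) (g : 𝒳 → E Nt → E Ng) (lamS : E Nt → E Ng) (θs : E Nt) : B Ng Nt :=
  mkB (tauStar μ g lamS θs) (kapStar μ g lamS θs) (lamS θs) θs

/-- `Γ = E[∂φ(x, β)/∂β']` at `β`. -/
def Gam (μ : Measure 𝒳) (g : 𝒳 → E Nt → E Ng) (β : B Ng Nt) :
    Matrix (Idx Ng Nt) (Idx Ng Nt) ℝ :=
  Matrix.of fun i j =>
    ∫ x, (fderiv ℝ (fun β' => phi g x β') β (EuclideanSpace.single j 1)) i ∂μ

/-- `Φ = E[φ(x, β) φ(x, β)']`. -/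
def Phi (μ : Measure 𝒳) (g : 𝒳 → E Nt → E Ng) (β : B Ng Nt) :
    Matrix (Idx Ng Nt) (Idx Ng Nt) ℝ :=
  Matrix.of fun i j => ∫ x, phi g x β i * phi g x β j ∂μ

end

end ETEL

/-!
For fixed `θ` the constrained entropy minimizer is an exponential tilt, `n wᵢ ∝ exp(λ' gᵢ)` with
`n⁻¹ ∑ exp(λ' gᵢ) gᵢ = 0`, so the ETEL objective becomes
`ln (n⁻¹ ∑ exp(λ' gᵢ)) - λ' n⁻¹ ∑ gᵢ`, the sample version of `-ln L(θ)`. Convexity in `λ`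
localizes the sample tilt near `λ*(θ)`; a uniform law of large numbers then gives
`λ̂ → λ*(θ*)` and `θ̂ → θ*` in probability, and `τ̂` and `κ̂` follow by continuity.

Near `β*` the minimizer is interior, and the Lagrange condition for minimizing over `(λ, θ)` subject
to the tilting equation, whose multiplier is a multiple of `κ̂`, says exactly that
`n⁻¹ ∑ φ(xᵢ, β̂) = 0`. Linearizing at `β*`, where `E[φ(x, β*)] = 0`, gives
`0 = n⁻¹ ∑ φ(xᵢ, β*) + Γ (β̂ - β*) + o(‖β̂ - β*‖)` in probability, and the central limit theorem
finishes the proof.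

"With probability tending to one" is a filter on `ℕ × Ω`, so that convergence in probability is
ordinary convergence along it.
-/

namespace ETEL

/-! ### Measurability of suprema over parameters -/

section Analytic

open Set

section Capacity

variable {α : Type*} [MeasurableSpace α] {μ : Measure α} {f : (ℕ → ℕ) → α} {c : ℝ≥0∞}

lemma exists_lt_measure_image_inter_setOf_le {S : Set (ℕ → ℕ)} (hS : c < μ (f '' S)) (k : ℕ) :
    ∃ m : ℕ, c < μ (f '' (S ∩ {s | s k ≤ m})) := by
  have hmono : Monotone fun m : ℕ => f '' (S ∩ {s | s k ≤ m}) := fun _ _ hab =>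
    image_mono (inter_subset_inter_right _ fun _ hs => le_trans hs hab)
  have hunion : ⋃ m : ℕ, f '' (S ∩ {s | s k ≤ m}) = f '' S := by
    rw [← image_iUnion, ← inter_iUnion, inter_eq_left.2]
    exact fun s _ => mem_iUnion.2 ⟨s k, le_refl (s k)⟩
  rwa [← hunion, hmono.measure_iUnion, lt_iSup_iff] at hS

lemma exists_forall_lt_measure_image_setOf_forall_lt (hc : c < μ (range f)) :
    ∃ a : ℕ → ℕ, ∀ k, c < μ (f '' {s | ∀ i < k, s i ≤ a i}) := by
  choose m hm using fun S : {S : Set (ℕ → ℕ) // c < μ (f '' S)} =>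
    exists_lt_measure_image_inter_setOf_le S.2
  let S : ℕ → {S : Set (ℕ → ℕ) // c < μ (f '' S)} := fun k =>
    Nat.rec ⟨univ, by rwa [image_univ]⟩ (fun k S => ⟨S.1 ∩ {s | s k ≤ m S k}, hm S k⟩) k
  have hS (k : ℕ) : (S k).1 = {s | ∀ i < k, s i ≤ m (S i) i} := by
    induction k with
    | zero => simp [S]
    | succ k ih =>
      ext s
      change s ∈ (S k).1 ∧ s k ≤ m (S k) k ↔ ∀ i < k + 1, s i ≤ m (S i) i
      rw [ih, Nat.forall_lt_succ_right]
      rfl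
  exact ⟨fun k => m (S k) k, fun k => hS k ▸ (S k).2⟩

lemma exists_setOf_forall_lt_subset {a : ℕ → ℕ} {U : Set (ℕ → ℕ)} (hU : IsOpen U)
    (haU : pi univ (fun i => Iic (a i)) ⊆ U) : ∃ k, {s : ℕ → ℕ | ∀ i < k, s i ≤ a i} ⊆ U := by
  by_contra! hcon
  choose s hs hsU using fun k => not_subset.1 (hcon k)
  have hcompact : IsCompact (pi univ fun i => Iic (a i)) :=
    isCompact_univ_pi fun i => (finite_Iic (a i)).isCompact
  obtain ⟨t, ht, φ, hφ, hlim⟩ := hcompact.tendsto_subseq (x := fun k => s k ⊓ a)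
    fun k i _ => inf_le_right (a := s k) (b := a) i
  have hlim' : Tendsto (s ∘ φ) atTop (𝓝 t) := by
    rw [tendsto_pi_nhds] at hlim ⊢
    refine fun i => (hlim i).congr' ?_
    filter_upwards [eventually_gt_atTop i] with k hk
    exact min_eq_left (hs (φ k) i (hk.trans_le (hφ.id_le k)))
  exact hU.isClosed_compl.mem_of_tendsto hlim' (Eventually.of_forall fun k => hsU (φ k)) (haU ht)

theorem exists_isCompact_subset_range_le_measure [TopologicalSpace α] [μ.OuterRegular]
    (hf : Continuous f) (hc : c < μ (range f)) : ∃ K ⊆ range f, IsCompact K ∧ c ≤ μ K := by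
  obtain ⟨a, ha⟩ := exists_forall_lt_measure_image_setOf_forall_lt hc
  refine ⟨f '' pi univ fun i => Iic (a i), image_subset_range _ _,
    (isCompact_univ_pi fun i => (finite_Iic (a i)).isCompact).image hf, ?_⟩
  rw [Set.measure_eq_iInf_isOpen]
  refine le_iInf₂ fun U hU => le_iInf fun hUo => ?_
  obtain ⟨k, hk⟩ := exists_setOf_forall_lt_subset (hUo.preimage hf) (image_subset_iff.1 hU)
  exact (ha k).le.trans (measure_mono (image_subset_iff.2 hk))

end Capacity

lemma nullMeasurableSet_of_forall_lt_exists_isCompact {α : Type*} [TopologicalSpace α] [T2Space α]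
    [MeasurableSpace α] [OpensMeasurableSpace α] {μ : Measure α} [IsFiniteMeasure μ] {s : Set α}
    (hs : ∀ c < μ s, ∃ K ⊆ s, IsCompact K ∧ c ≤ μ K) : NullMeasurableSet s μ := by
  rcases eq_or_ne (μ s) 0 with h0 | h0
  · exact NullMeasurableSet.of_null h0
  obtain ⟨u, -, hu, hlim⟩ := exists_seq_strictMono_tendsto' (pos_iff_ne_zero.2 h0)
  choose K hKs hKc hK using fun n => hs (u n) (hu n).2
  have hB : MeasurableSet (⋃ n, K n) := MeasurableSet.iUnion fun n => (hKc n).measurableSet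
  have hle : μ s ≤ μ (⋃ n, K n) :=
    le_of_tendsto' hlim fun n => (hK n).trans (measure_mono (subset_iUnion K n))
  exact hB.nullMeasurableSet.congr (ae_eq_of_subset_of_measure_ge (iUnion_subset hKs) hle
    hB.nullMeasurableSet (measure_ne_top _ _))

theorem nullMeasurableSet_of_analyticSet {α : Type*} [TopologicalSpace α] [PolishSpace α]
    [MeasurableSpace α] [BorelSpace α] (μ : Measure α) [IsFiniteMeasure μ] {s : Set α}
    (hs : AnalyticSet s) : NullMeasurableSet s μ := by
  let := TopologicalSpace.upgradeIsCompletelyMetrizable α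
  rw [AnalyticSet] at hs
  rcases hs with rfl | ⟨f, hf, rfl⟩
  · exact nullMeasurableSet_empty
  · exact nullMeasurableSet_of_forall_lt_exists_isCompact fun _ hc =>
      exists_isCompact_subset_range_le_measure hf hc

variable {X Y : Type*} [MeasurableSpace X] [StandardBorelSpace X] [MeasurableSpace Y]
  [StandardBorelSpace Y] (μ : Measure X) [IsFiniteMeasure μ]

theorem nullMeasurableSet_image_fst {s : Set (X × Y)} (hs : MeasurableSet s) :
    NullMeasurableSet (Prod.fst '' s) μ := by
  let := upgradeStandardBorel X
  exact nullMeasurableSet_of_analyticSet μ (hs.analyticSet_image measurable_fst)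

variable {β : Type*} [CompleteLinearOrder β] [TopologicalSpace β] [OrderTopology β]
  [SecondCountableTopology β] [MeasurableSpace β] [BorelSpace β] {h : X → Y → β} {S : Set Y}

theorem aemeasurable_biSup_of_measurable_uncurry (hh : Measurable (Function.uncurry h))
    (hS : MeasurableSet S) : AEMeasurable (fun x => ⨆ y ∈ S, h x y) μ := by
  suffices hm : @Measurable (NullMeasurableSpace X μ) _ _ _ fun x => ⨆ y ∈ S, h x y from
    NullMeasurable.aemeasurable fun s hs => hm hs
  refine measurable_of_Ioi fun a => ?_
  have heq : Prod.fst '' (Prod.snd ⁻¹' S ∩ Function.uncurry h ⁻¹' Ioi a) =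
      {x : X | a < ⨆ y ∈ S, h x y} := by
    ext x
    simp [lt_iSup_iff]
  have hnull := nullMeasurableSet_image_fst μ ((measurable_snd hS).inter
    (hh (measurableSet_Ioi (a := a))))
  rwa [heq] at hnull

theorem aemeasurable_biInf_of_measurable_uncurry (hh : Measurable (Function.uncurry h))
    (hS : MeasurableSet S) : AEMeasurable (fun x => ⨅ y ∈ S, h x y) μ :=
  aemeasurable_biSup_of_measurable_uncurry (β := βᵒᵈ) μ hh hS

end Analytic

/-! ### Sample averages and laws of large numbers -/

noncomputable section Sample

section Avg

/-- The sample average `n⁻¹ ∑ f(xᵢ)` of the observations `x₁, …, xₙ`; it is `0` for the empty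
sample. -/
def avg {𝒳 F : Type*} [AddCommGroup F] [Module ℝ F] {n : ℕ} (x : Fin n → 𝒳) (f : 𝒳 → F) : F :=
  (n : ℝ)⁻¹ • ∑ i, f (x i)

variable {𝒳 F G : Type*} [NormedAddCommGroup F] [NormedSpace ℝ F] [NormedAddCommGroup G]
  [NormedSpace ℝ G] {n : ℕ} (x : Fin n → 𝒳)

lemma avg_congr {f f' : 𝒳 → F} (h : ∀ i, f (x i) = f' (x i)) : avg x f = avg x f' := by
  simp [avg, h]

lemma avg_add (f f' : 𝒳 → F) : avg x (fun a => f a + f' a) = avg x f + avg x f' := by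
  simp [avg, Finset.sum_add_distrib]

lemma avg_sub (f f' : 𝒳 → F) : avg x (fun a => f a - f' a) = avg x f - avg x f' := by
  simp [avg, Finset.sum_sub_distrib, smul_sub]

lemma avg_neg (f : 𝒳 → F) : avg x (fun a => -f a) = -avg x f := by
  simp [avg]

lemma avg_smul (c : ℝ) (f : 𝒳 → F) : avg x (fun a => c • f a) = c • avg x f := by
  simp [avg, ← Finset.smul_sum, smul_comm c]

lemma avg_mul (c : ℝ) (f : 𝒳 → ℝ) : avg x (fun a => c * f a) = c * avg x f :=
  avg_smul x c f

lemma avg_const (hn : 0 < n) (c : F) : avg x (fun _ => c) = c := by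
  have : (n : ℝ) ≠ 0 := by positivity
  simp [avg, ← Nat.cast_smul_eq_nsmul ℝ, smul_smul, this]

lemma avg_clm (L : F →L[ℝ] G) (f : 𝒳 → F) : avg x (fun a => L (f a)) = L (avg x f) := by
  simp [avg]

lemma avg_clm_apply (T : 𝒳 → F →L[ℝ] G) (v : F) : avg x T v = avg x fun a => T a v := by
  simp [avg]

lemma avg_inner {H : Type*} [NormedAddCommGroup H] [InnerProductSpace ℝ H] (v : H)
    (f : 𝒳 → H) : avg x (fun a => inner ℝ v (f a)) = inner ℝ v (avg x f) :=
  avg_clm x (innerSL ℝ v) f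

lemma avg_mono {f f' : 𝒳 → ℝ} (h : ∀ i, f (x i) ≤ f' (x i)) : avg x f ≤ avg x f' := by
  unfold avg
  gcongr with i
  exact h i

lemma avg_lt_avg {f f' : 𝒳 → ℝ} (h : ∀ i, f (x i) ≤ f' (x i)) (i : Fin n)
    (hi : f (x i) < f' (x i)) : avg x f < avg x f' := by
  have hn : (0 : ℝ) < n := by exact_mod_cast i.pos
  have hsum : ∑ i, f (x i) < ∑ i, f' (x i) :=
    Finset.sum_lt_sum (fun i _ => h i) ⟨i, Finset.mem_univ i, hi⟩
  simp only [avg, smul_eq_mul]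
  gcongr

lemma norm_avg_le (f : 𝒳 → F) : ‖avg x f‖ ≤ avg x (fun a => ‖f a‖) := by
  unfold avg
  rw [norm_smul, smul_eq_mul, norm_inv, Real.norm_natCast]
  gcongr
  exact norm_sum_le _ _

end Avg

section InProbability

variable {Ω : Type*} [MeasurableSpace Ω] {P : Measure Ω}

/-- The filter of those sets of pairs `(n, ω)` whose sections are events of probability tending
to one. Convergence along it is convergence in probability, so that asymptotic arguments can be
carried out as if the sample were deterministic. -/
def inProbability (P : Measure Ω) : Filter (ℕ × Ω) where
  sets := {S | Tendsto (fun n => P {ω | (n, ω) ∉ S}) atTop (𝓝 0)}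
  univ_sets := by simp
  sets_of_superset := by
    intro S T hS hST
    exact tendsto_of_tendsto_of_tendsto_of_le_of_le tendsto_const_nhds hS (fun _ => zero_le)
      fun n => measure_mono fun ω hω h => hω (hST h)
  inter_sets := by
    intro S T hS hT
    have h := Tendsto.add hS hT
    rw [add_zero] at h
    refine tendsto_of_tendsto_of_tendsto_of_le_of_le tendsto_const_nhds h (fun _ => zero_le)
      fun n => (measure_mono fun ω hω => ?_).trans (measure_union_le _ _)
    exact not_and_or.1 hω

lemma eventually_inProbability {Q : ℕ × Ω → Prop} :
    (∀ᶠ p in inProbability P, Q p) ↔ Tendsto (fun n => P {ω | ¬ Q (n, ω)}) atTop (𝓝 0) :=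
  Iff.rfl

instance [IsProbabilityMeasure P] : (inProbability P).NeBot := by
  refine ⟨fun hbot => ?_⟩
  have h := eventually_inProbability (P := P) (Q := fun _ => False).1 (by simp [hbot])
  simp at h

lemma tendsto_inProbability_of_tendstoInMeasure {F : Type*} [PseudoMetricSpace F]
    {f : ℕ → Ω → F} {c : F} (h : TendstoInMeasure P f atTop fun _ => c) :
    Tendsto (fun p : ℕ × Ω => f p.1 p.2) (inProbability P) (𝓝 c) := by
  refine Metric.tendsto_nhds.2 fun ε hε => eventually_inProbability.2 ?_
  simpa using tendstoInMeasure_iff_dist.1 h ε hε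

end InProbability

lemma eventually_forall_of_isCompact {I Y : Type*} [TopologicalSpace Y] {ℓ : Filter I} {K : Set Y}
    (hK : IsCompact K) {Q : I → Y → Prop} (h : ∀ y ∈ K, ∀ᶠ q in ℓ ×ˢ 𝓝[K] y, Q q.1 q.2) :
    ∀ᶠ p in ℓ, ∀ y ∈ K, Q p y := by
  refine hK.induction_on (p := fun s => ∀ᶠ p in ℓ, ∀ y ∈ s, Q p y) (by simp)
    (fun s t hst ht => ht.mono fun p hp y hy => hp y (hst hy)) (fun s t hs ht => ?_)
    fun y hy => ?_
  · filter_upwards [hs, ht] with p hps hpt y hy using hy.elim (hps y) (hpt y)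
  · obtain ⟨pa, hpa, pb, hpb, hQ⟩ := eventually_prod_iff.1 (h y hy)
    exact ⟨_, hpb, hpa.mono fun p hp y hy => hQ hp hy⟩

variable {𝒳 : Type*} [MeasurableSpace 𝒳] {μ : Measure 𝒳}

theorem tendstoInMeasure_avg {Ω F : Type*} [MeasurableSpace Ω] {P : Measure Ω} [IsFiniteMeasure P]
    [NormedAddCommGroup F] [NormedSpace ℝ F] [CompleteSpace F] [MeasurableSpace F] [BorelSpace F]
    {X : ℕ → Ω → 𝒳} (hlaw : ∀ i, HasLaw (X i) μ P) (hindep : Pairwise fun i j => X i ⟂ᵢ[P] X j)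
    {f : 𝒳 → F} (hf : Integrable f μ) :
    TendstoInMeasure P (fun n ω => avg (fun i : Fin n => X i ω) f) atTop
      fun _ => ∫ a, f a ∂μ := by
  have hX (i : ℕ) : AEMeasurable (X i) P := (hlaw i).aemeasurable
  have hfm (i : ℕ) : AEMeasurable f (P.map (X i)) := (hlaw i).map_eq ▸ hf.1.aemeasurable
  have hfX (i : ℕ) : Integrable (f ∘ X i) P := by
    rw [← (hlaw i).map_eq] at hf
    exact hf.comp_aemeasurable (hX i)
  have hident (i : ℕ) : IdentDistrib (f ∘ X i) (f ∘ X 0) P P :=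
    IdentDistrib.comp_of_aemeasurable
      ⟨hX i, hX 0, (hlaw i).map_eq.trans (hlaw 0).map_eq.symm⟩ (hfm i)
  have hsll := strong_law_ae (μ := P) (fun i => f ∘ X i) (hfX 0)
    (fun i j hij => (hindep hij).comp₀ (hX i) (hX j) (hfm i) (hfm j)) hident
  have havg (n : ℕ) (ω : Ω) :
      avg (fun i : Fin n => X i ω) f = (n : ℝ)⁻¹ • ∑ i ∈ Finset.range n, (f ∘ X i) ω := by
    rw [avg, Fin.sum_univ_eq_sum_range (fun i => f (X i ω))]
    rfl
  simp only [havg, ← (hlaw 0).integral_comp hf.1]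
  refine tendstoInMeasure_of_tendsto_ae (fun n => ?_) hsll
  exact (Finset.aestronglyMeasurable_fun_sum _ fun i _ => (hfX i).1).const_smul _

/-- The law of large numbers along a filter: eventually along `ℓ`, the samples `x p`, of size
`n p`, are not empty and avoid a given null set of `μ`, and their averages of integrable functions
converge to the integrals. -/
structure SampleLLN (μ : Measure 𝒳) {I : Type*} (ℓ : Filter I) {n : I → ℕ}
    (x : ∀ p, Fin (n p) → 𝒳) : Prop where
  size_pos : ∀ᶠ p in ℓ, 0 < n p
  ae : ∀ Q : 𝒳 → Prop, (∀ᵐ a ∂μ, Q a) → ∀ᶠ p in ℓ, ∀ i, Q (x p i)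
  lln : ∀ f : 𝒳 → ℝ, Integrable f μ → Tendsto (fun p => avg (x p) f) ℓ (𝓝 (∫ a, f a ∂μ))

theorem sampleLLN_inProbability {Ω : Type*} [MeasurableSpace Ω] {P : Measure Ω} [IsFiniteMeasure P]
    {X : ℕ → Ω → 𝒳} (hlaw : ∀ i, HasLaw (X i) μ P) (hindep : Pairwise fun i j => X i ⟂ᵢ[P] X j) :
    SampleLLN μ (inProbability P) (fun p : ℕ × Ω => fun i : Fin p.1 => X i p.2) where
  size_pos := by
    refine eventually_inProbability.2 (tendsto_const_nhds.congr' ?_)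
    filter_upwards [eventually_gt_atTop 0] with n hn
    simp [hn.ne']
  ae Q hQ := by
    have hall : ∀ᵐ ω ∂P, ∀ i, Q (X i ω) := ae_all_iff.2 fun i =>
      ae_of_ae_map (hlaw i).aemeasurable ((hlaw i).map_eq ▸ hQ)
    rw [eventually_inProbability]
    refine tendsto_const_nhds.congr fun n => (measure_mono_null ?_ (ae_iff.1 hall)).symm
    exact fun ω hω hQω => hω fun i => hQω i
  lln f hf :=
    tendsto_inProbability_of_tendstoInMeasure
      (f := fun n ω => avg (fun i : Fin n => X i ω) f) (tendstoInMeasure_avg hlaw hindep hf)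

section Envelope

variable {Y : Type*}

lemma isGLB_toReal_biInf_coe {h : Y → ℝ} {S : Set Y} (hS : S.Nonempty) (hb : BddBelow (h '' S)) :
    IsGLB (h '' S) (⨅ y ∈ S, (h y : EReal)).toReal := by
  obtain ⟨y₀, hy₀⟩ := hS
  obtain ⟨d, hd⟩ := hb
  have hle (y) (hy : y ∈ S) : ⨅ y ∈ S, (h y : EReal) ≤ h y := iInf₂_le y hy
  have hge : (d : EReal) ≤ ⨅ y ∈ S, (h y : EReal) :=
    le_iInf₂ fun y hy => EReal.coe_le_coe (hd (Set.mem_image_of_mem h hy))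
  have hcoe : ((⨅ y ∈ S, (h y : EReal)).toReal : EReal) = ⨅ y ∈ S, (h y : EReal) :=
    EReal.coe_toReal (ne_top_of_le_ne_top (EReal.coe_ne_top _) (hle y₀ hy₀))
      (ne_bot_of_le_ne_bot (EReal.coe_ne_bot d) hge)
  refine ⟨Set.forall_mem_image.2 fun y hy => ?_, fun c hc => ?_⟩
  · exact EReal.coe_le_coe_iff.1 (hcoe.trans_le (hle y hy))
  · rw [← EReal.coe_le_coe_iff, hcoe]
    exact le_iInf₂ fun y hy => EReal.coe_le_coe (hc (Set.mem_image_of_mem h hy))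

variable [PseudoMetricSpace Y]

lemma tendsto_of_isGLB_image_ball {h : Y → ℝ} {A : Set Y} {y₀ : Y} (hy₀ : y₀ ∈ A)
    (hcont : ContinuousWithinAt h A y₀) {F : ℕ → ℝ}
    (hF : ∀ m : ℕ, IsGLB (h '' (A ∩ Metric.ball y₀ (1 / ((m : ℝ) + 1)))) (F m)) :
    Tendsto F atTop (𝓝 (h y₀)) := by
  rw [Metric.tendsto_atTop]
  intro ε hε
  obtain ⟨δ, hδ, hball⟩ := Metric.continuousWithinAt_iff.1 hcont (ε / 2) (by positivity)
  obtain ⟨m₀, hm₀⟩ := exists_nat_one_div_lt hδ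
  refine ⟨m₀, fun m hm => ?_⟩
  have hle : F m ≤ h y₀ :=
    (hF m).1 (Set.mem_image_of_mem h ⟨hy₀, Metric.mem_ball_self (by positivity)⟩)
  have hge : h y₀ - ε / 2 ≤ F m := by
    refine (hF m).2 (Set.forall_mem_image.2 fun y hy => ?_)
    have hd : dist y y₀ < δ := (Metric.mem_ball.1 hy.2).trans (lt_of_le_of_lt (by gcongr) hm₀)
    linarith [(abs_lt.1 (hball hy.1 hd)).1]
  rw [Real.dist_eq, abs_lt]
  constructor <;> linarith

variable [MeasurableSpace Y] [OpensMeasurableSpace Y] [StandardBorelSpace Y]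
  [StandardBorelSpace 𝒳] [IsFiniteMeasure μ] {h : 𝒳 → Y → ℝ} {A : Set Y} {D : 𝒳 → ℝ} {c : ℝ}

-- The minorant is the infimum of `h a` over a small ball around `y₀`, by dominated convergence.
theorem exists_integrable_minorant_lt_integral (hh : Measurable (Function.uncurry h))
    (hA : MeasurableSet A) (hD : Integrable D μ) (hlow : ∀ᵐ a ∂μ, ∀ y ∈ A, D a ≤ h a y)
    {y₀ : Y} (hy₀ : y₀ ∈ A) (hcont : ∀ᵐ a ∂μ, ContinuousWithinAt (h a) A y₀)
    (hint : Integrable (fun a => h a y₀) μ) (hc : c < ∫ a, h a y₀ ∂μ) :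
    ∃ V ∈ 𝓝[A] y₀, ∃ F : 𝒳 → ℝ, Integrable F μ ∧ (∀ᵐ a ∂μ, ∀ y ∈ V, F a ≤ h a y) ∧
      c < ∫ a, F a ∂μ := by
  let S : ℕ → Set Y := fun m => A ∩ Metric.ball y₀ (1 / ((m : ℝ) + 1))
  let F : ℕ → 𝒳 → ℝ := fun m a => (⨅ y ∈ S m, (h a y : EReal)).toReal
  have hy₀S (m : ℕ) : y₀ ∈ S m := ⟨hy₀, Metric.mem_ball_self (by positivity)⟩
  have hFm (m : ℕ) : AEStronglyMeasurable (F m) μ :=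
    (aemeasurable_biInf_of_measurable_uncurry μ (h := fun a y => (h a y : EReal)) hh.coe_real_ereal
      (hA.inter measurableSet_ball)).ereal_toReal.aestronglyMeasurable
  have hglb : ∀ᵐ a ∂μ, ∀ m, IsGLB (h a '' S m) (F m a) := by
    filter_upwards [hlow] with a ha m
    exact isGLB_toReal_biInf_coe ⟨y₀, hy₀S m⟩
      ⟨D a, Set.forall_mem_image.2 fun y hy => ha y hy.1⟩
  have hbound (m : ℕ) : ∀ᵐ a ∂μ, ‖F m a‖ ≤ ‖D a‖ + ‖h a y₀‖ := by
    filter_upwards [hlow, hglb] with a ha hg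
    have hle := (hg m).1 (Set.mem_image_of_mem _ (hy₀S m))
    have hge : D a ≤ F m a := (hg m).2 (Set.forall_mem_image.2 fun y hy => ha y hy.1)
    rw [Real.norm_eq_abs, Real.norm_eq_abs, Real.norm_eq_abs, abs_le]
    constructor <;> linarith [neg_abs_le (D a), le_abs_self (h a y₀), abs_nonneg (D a),
      abs_nonneg (h a y₀)]
  have hdom : Integrable (fun a => ‖D a‖ + ‖h a y₀‖) μ := hD.norm.add hint.norm
  have hlim : Tendsto (fun m => ∫ a, F m a ∂μ) atTop (𝓝 (∫ a, h a y₀ ∂μ)) := by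
    refine tendsto_integral_of_dominated_convergence _ hFm hdom hbound ?_
    filter_upwards [hglb, hcont] with a hg hca using tendsto_of_isGLB_image_ball hy₀ hca hg
  obtain ⟨m, hm⟩ := (hlim.eventually (lt_mem_nhds hc)).exists
  refine ⟨S m, inter_mem self_mem_nhdsWithin (mem_nhdsWithin_of_mem_nhds
    (Metric.ball_mem_nhds _ (by positivity))), F m, hdom.mono' (hFm m) (hbound m), ?_, hm⟩
  filter_upwards [hglb] with a hg y hy using (hg m).1 (Set.mem_image_of_mem _ hy)

end Envelope

namespace SampleLLN

variable {I : Type*} {ℓ : Filter I} {n : I → ℕ} {x : ∀ p, Fin (n p) → 𝒳}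

theorem lln_finiteDimensional {F : Type*} [NormedAddCommGroup F] [NormedSpace ℝ F]
    [FiniteDimensional ℝ F] (hs : SampleLLN μ ℓ x) {f : 𝒳 → F} (hf : Integrable f μ) :
    Tendsto (fun p => avg (x p) f) ℓ (𝓝 (∫ a, f a ∂μ)) := by
  have : CompleteSpace F := FiniteDimensional.complete ℝ F
  let e := (Module.finBasis ℝ F).equivFunL
  have hcoord : Tendsto (fun p => e (avg (x p) f)) ℓ (𝓝 (e (∫ a, f a ∂μ))) := by
    refine tendsto_pi_nhds.2 fun i => ?_
    let L : F →L[ℝ] ℝ := (ContinuousLinearMap.proj (R := ℝ) (φ := fun _ => ℝ) i).comp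
      e.toContinuousLinearMap
    have hL := hs.lln _ (L.integrable_comp hf)
    rw [L.integral_comp_comm hf] at hL
    exact hL.congr fun p => avg_clm _ L f
  have hsymm := (e.symm.continuous.tendsto _).comp hcoord
  rw [e.symm_apply_apply] at hsymm
  exact hsymm.congr fun p => e.symm_apply_apply _

variable [StandardBorelSpace 𝒳] [IsFiniteMeasure μ] {Y : Type*} [MetricSpace Y]
  [MeasurableSpace Y] [OpensMeasurableSpace Y] [StandardBorelSpace Y] {h : 𝒳 → Y → ℝ}
  {D : 𝒳 → ℝ} {c : ℝ}

theorem eventually_lt_avg (hs : SampleLLN μ ℓ x) (hh : Measurable (Function.uncurry h)) {A : Set Y}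
    (hA : MeasurableSet A) (hD : Integrable D μ) (hlow : ∀ᵐ a ∂μ, ∀ y ∈ A, D a ≤ h a y)
    {y₀ : Y} (hy₀ : y₀ ∈ A) (hcont : ∀ᵐ a ∂μ, ContinuousWithinAt (h a) A y₀)
    (hint : Integrable (fun a => h a y₀) μ) (hc : c < ∫ a, h a y₀ ∂μ) :
    ∀ᶠ q in ℓ ×ˢ 𝓝[A] y₀, c < avg (x q.1) fun a => h a q.2 := by
  obtain ⟨V, hV, F, hF, hFle, hcF⟩ :=
    exists_integrable_minorant_lt_integral hh hA hD hlow hy₀ hcont hint hc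
  have hlln := (hs.lln F hF).eventually (lt_mem_nhds hcF)
  filter_upwards [(hlln.and (hs.ae _ hFle)).prod_mk hV] with q hq
  exact hq.1.1.trans_le (avg_mono _ fun i => hq.1.2 i q.2 hq.2)

theorem eventually_forall_lt_avg (hs : SampleLLN μ ℓ x) (hh : Measurable (Function.uncurry h))
    {K : Set Y} (hK : IsCompact K) (hD : Integrable D μ) (hlow : ∀ᵐ a ∂μ, ∀ y ∈ K, D a ≤ h a y)
    (hcont : ∀ y ∈ K, ∀ᵐ a ∂μ, ContinuousWithinAt (h a) K y)
    (hint : ∀ y ∈ K, Integrable (fun a => h a y) μ) (hc : ∀ y ∈ K, c < ∫ a, h a y ∂μ) :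
    ∀ᶠ p in ℓ, ∀ y ∈ K, c < avg (x p) fun a => h a y :=
  eventually_forall_of_isCompact hK fun y hy =>
    hs.eventually_lt_avg hh hK.measurableSet hD hlow hy (hcont y hy) (hint y hy) (hc y hy)

end SampleLLN

end Sample

/-! ### Exponentially tilted weights -/

section Entropy

lemma sum_mul_log_le_sum_mul_log {ι : Type*} [Fintype ι] {p v : ι → ℝ} (hp : ∀ i, 0 < p i)
    (hv : ∀ i, 0 ≤ v i) (hsum : ∑ i, p i = ∑ i, v i) :
    ∑ i, v i * Real.log (p i) ≤ ∑ i, v i * Real.log (v i) := by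
  have hterm (i : ι) : v i * Real.log (p i) + (v i - p i) ≤ v i * Real.log (v i) := by
    rcases (hv i).eq_or_lt with h0 | h0
    · simp [← h0, (hp i).le]
    · have h := Real.log_le_sub_one_of_pos (div_pos (hp i) h0)
      rw [Real.log_div (hp i).ne' h0.ne'] at h
      have hdiv : v i * (p i / v i) = p i := mul_div_cancel₀ _ h0.ne'
      nlinarith
  have h := Finset.sum_le_sum fun i (_ : i ∈ Finset.univ) => hterm i
  rw [Finset.sum_add_distrib, Finset.sum_sub_distrib, hsum] at h
  linarith

lemma hasDerivAt_sum_mul_log_line {ι : Type*} [Fintype ι] {w : ι → ℝ} (hw : ∀ i, w i ≠ 0)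
    (d : ι → ℝ) : HasDerivAt (fun t : ℝ => ∑ i, (w i + t * d i) * Real.log (w i + t * d i))
      (∑ i, d i * Real.log (w i) + ∑ i, d i) 0 := by
  rw [← Finset.sum_add_distrib]
  refine HasDerivAt.fun_sum fun i _ => ?_
  have hline : HasDerivAt (fun t : ℝ => w i + t * d i) (d i) 0 := by
    simpa using ((hasDerivAt_id (0 : ℝ)).mul_const (d i)).const_add (w i)
  have hlog : HasDerivAt (fun y => y * Real.log y) (Real.log (w i) + 1) (w i + 0 * d i) := by
    simpa using Real.hasDerivAt_mul_log (hw i)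
  have hcomp := hlog.comp (0 : ℝ) hline
  rwa [add_mul, one_mul, mul_comm] at hcomp

lemma exists_eq_add_inner_of_forall_sum_eq_zero {ι H : Type*} [Fintype ι]
    [NormedAddCommGroup H] [InnerProductSpace ℝ H] [FiniteDimensional ℝ H] {v : ι → H} {u : ι → ℝ}
    (h : ∀ d : ι → ℝ, ∑ i, d i = 0 → ∑ i, d i • v i = 0 → ∑ i, d i * u i = 0) :
    ∃ (c : ℝ) (l : H), ∀ i, u i = c + inner ℝ l (v i) := by
  classical
  have : CompleteSpace H := FiniteDimensional.complete ℝ H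
  let T : (ι → ℝ) →ₗ[ℝ] ℝ × H :=
    (∑ i, LinearMap.proj i).prod (∑ i, (LinearMap.proj i).smulRight (v i))
  have hT (d : ι → ℝ) : T d = (∑ i, d i, ∑ i, d i • v i) := by simp [T]
  let U : Module.Dual ℝ (ι → ℝ) := ∑ i, u i • LinearMap.proj i
  have hU (d : ι → ℝ) : U d = ∑ i, d i * u i := by simp [U, mul_comm]
  have hker : U ∈ T.ker.dualAnnihilator := by
    refine (Submodule.mem_dualAnnihilator U).2 fun d hd => ?_
    rw [LinearMap.mem_ker, hT, Prod.mk_eq_zero] at hd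
    exact (hU d).trans (h d hd.1 hd.2)
  rw [← LinearMap.range_dualMap_eq_dualAnnihilator_ker] at hker
  obtain ⟨ψ, hψ⟩ := hker
  let l : H := (InnerProductSpace.toDual ℝ H).symm
    (LinearMap.toContinuousLinearMap (ψ ∘ₗ LinearMap.inr ℝ ℝ H))
  have hl (a : H) : inner ℝ l a = ψ (0, a) := by
    rw [InnerProductSpace.toDual_symm_apply]
    rfl
  refine ⟨ψ (1, 0), l, fun i => ?_⟩
  have hi : U (Pi.single i 1) = ψ (T (Pi.single i 1)) := by rw [← hψ]; rfl
  rw [hU, hT] at hi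
  simp only [Pi.single_apply, ite_mul, one_mul, zero_mul, Finset.sum_ite_eq', Finset.mem_univ,
    if_true, ite_smul, one_smul, zero_smul] at hi
  rw [hi, hl, ← map_add, Prod.mk_add_mk, add_zero, zero_add]

end Entropy

section Tilting

variable {𝒳 : Type*} {Ng Nt : ℕ} {g : 𝒳 → E Nt → E Ng}

lemma tilt_pos (a : 𝒳) (θ : E Nt) (l : E Ng) : 0 < tilt g a θ l := Real.exp_pos _

lemma tilt_eq_tilt_mul_exp (a : 𝒳) (θ : E Nt) (l l' : E Ng) :
    tilt g a θ l' = tilt g a θ l * Real.exp (inner ℝ (l' - l) (g a θ)) := by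
  rw [tilt, tilt, ← Real.exp_add, inner_sub_left, add_sub_cancel]

lemma tilt_add_inner_le_tilt (a : 𝒳) (θ : E Nt) (l l' : E Ng) :
    tilt g a θ l + inner ℝ (l' - l) (tilt g a θ l • g a θ) ≤ tilt g a θ l' := by
  rw [tilt_eq_tilt_mul_exp a θ l l', inner_smul_right]
  nlinarith [tilt_pos (g := g) a θ l, Real.add_one_le_exp (inner ℝ (l' - l) (g a θ))]

lemma tilt_add_inner_lt_tilt {a : 𝒳} {θ : E Nt} {l l' : E Ng}
    (hne : inner ℝ (l' - l) (g a θ) ≠ 0) :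
    tilt g a θ l + inner ℝ (l' - l) (tilt g a θ l • g a θ) < tilt g a θ l' := by
  rw [tilt_eq_tilt_mul_exp a θ l l', inner_smul_right]
  nlinarith [tilt_pos (g := g) a θ l, Real.add_one_lt_exp hne]

lemma hasDerivAt_tilt_line (a : 𝒳) (θ : E Nt) (l v : E Ng) :
    HasDerivAt (fun s : ℝ => tilt g a θ (l + s • v)) (tilt g a θ l * inner ℝ v (g a θ)) 0 := by
  have h : HasDerivAt (fun s : ℝ => inner ℝ (l + s • v) (g a θ)) (inner ℝ v (g a θ)) 0 := by
    simp only [inner_add_left, inner_smul_left]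
    simpa using ((hasDerivAt_id 0).mul_const (inner ℝ v (g a θ))).const_add (inner ℝ l (g a θ))
  simpa [tilt] using h.exp

variable (g) in
/-- The sample version `n⁻¹ ∑ exp(λ' gᵢ)` of the moment generating function of `g(x, θ)`, the
convex criterion that the tilting parameter minimizes. -/
noncomputable def sampleMgf {n : ℕ} (x : Fin n → 𝒳) (θ : E Nt) (l : E Ng) : ℝ :=
  avg x fun a => tilt g a θ l

variable (g) in
/-- `λ` solves the sample version `n⁻¹ ∑ exp(λ' gᵢ) gᵢ = 0` of `IsTiltSolution`. -/
def IsSampleTiltSolution {n : ℕ} (x : Fin n → 𝒳) (θ : E Nt) (l : E Ng) : Prop :=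
  avg x (fun a => tilt g a θ l • g a θ) = 0

variable (g) in
/-- The empirical likelihood discrepancy of the weights proportional to `exp(λ' gᵢ)`, in closed
form; see `elDiscrepancy_tiltWeights`. -/
noncomputable def tiltDiscrepancy {n : ℕ} (x : Fin n → 𝒳) (θ : E Nt) (l : E Ng) : ℝ :=
  Real.log (sampleMgf g x θ l) - inner ℝ l (avg x fun a => g a θ)

variable (g) in
/-- The probability weights proportional to `exp(λ' gᵢ)`. -/
noncomputable def tiltWeights {n : ℕ} (x : Fin n → 𝒳) (θ : E Nt) (l : E Ng) (i : Fin n) : ℝ :=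
  (n : ℝ)⁻¹ * (tilt g (x i) θ l / sampleMgf g x θ l)

variable {n : ℕ} {x : Fin n → 𝒳} {θ : E Nt} {l l' : E Ng}

lemma sampleMgf_pos (hn : 0 < n) : 0 < sampleMgf g x θ l := by
  have h := avg_lt_avg x (f := fun _ => 0) (f' := fun a => tilt g a θ l)
    (fun i => (tilt_pos _ _ _).le) ⟨0, hn⟩ (tilt_pos _ _ _)
  rwa [avg_const x hn] at h

lemma continuous_sampleMgf : Continuous (sampleMgf g x θ) := by
  unfold sampleMgf avg tilt
  fun_prop

lemma convexOn_sampleMgf : ConvexOn ℝ Set.univ (sampleMgf g x θ) := by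
  refine ⟨convex_univ, fun l _ l' _ s t hs ht hst => ?_⟩
  simp only [sampleMgf, smul_eq_mul]
  rw [← avg_mul, ← avg_mul, ← avg_add]
  refine avg_mono x fun i => ?_
  simpa only [tilt, inner_add_left, real_inner_smul_left, smul_eq_mul] using
    convexOn_exp.2 (Set.mem_univ (inner ℝ l (g (x i) θ))) (Set.mem_univ (inner ℝ l' (g (x i) θ)))
      hs ht hst

namespace IsSampleTiltSolution

lemma sampleMgf_le (h : IsSampleTiltSolution g x θ l) (l' : E Ng) :
    sampleMgf g x θ l ≤ sampleMgf g x θ l' := by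
  have hle := avg_mono x (f := fun a => tilt g a θ l + inner ℝ (l' - l) (tilt g a θ l • g a θ))
    (f' := fun a => tilt g a θ l') fun i => tilt_add_inner_le_tilt _ _ _ _
  rwa [avg_add, avg_inner, h, inner_zero_right, add_zero] at hle

lemma inner_eq (h : IsSampleTiltSolution g x θ l) (h' : IsSampleTiltSolution g x θ l')
    (i : Fin n) : inner ℝ l' (g (x i) θ) = inner ℝ l (g (x i) θ) := by
  by_contra hne
  rw [← sub_eq_zero, ← inner_sub_left] at hne
  have hlt := avg_lt_avg x
    (f := fun a => tilt g a θ l + inner ℝ (l' - l) (tilt g a θ l • g a θ))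
    (f' := fun a => tilt g a θ l') (fun i => tilt_add_inner_le_tilt _ _ _ _) i
    (tilt_add_inner_lt_tilt hne)
  rw [avg_add, avg_inner, h, inner_zero_right, add_zero] at hlt
  exact (h'.sampleMgf_le l).not_gt hlt

lemma tiltDiscrepancy_eq (h : IsSampleTiltSolution g x θ l) (h' : IsSampleTiltSolution g x θ l') :
    tiltDiscrepancy g x θ l' = tiltDiscrepancy g x θ l := by
  have hmgf : sampleMgf g x θ l' = sampleMgf g x θ l :=
    avg_congr x fun i => congrArg Real.exp (h.inner_eq h' i)
  rw [tiltDiscrepancy, tiltDiscrepancy, hmgf, ← avg_inner, ← avg_inner,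
    avg_congr x (f := fun a => inner ℝ l' (g a θ))
      (f' := fun a => inner ℝ l (g a θ)) (h.inner_eq h')]

lemma exists_norm_sub_eq_sampleMgf_le (h : IsSampleTiltSolution g x θ l) {l₀ : E Ng} {ε : ℝ}
    (hε : 0 < ε) (hl : ε ≤ ‖l - l₀‖) :
    ∃ l', ‖l' - l₀‖ = ε ∧ sampleMgf g x θ l' ≤ sampleMgf g x θ l₀ := by
  have hpos : 0 < ‖l - l₀‖ := hε.trans_le hl
  refine ⟨AffineMap.lineMap l₀ l (ε / ‖l - l₀‖), ?_, ?_⟩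
  · rw [AffineMap.lineMap_apply, vsub_eq_sub, vadd_eq_add, add_sub_cancel_right, norm_smul,
      Real.norm_of_nonneg (by positivity), div_mul_cancel₀ _ hpos.ne']
  · have hmem : AffineMap.lineMap l₀ l (ε / ‖l - l₀‖) ∈ segment ℝ l₀ l :=
      lineMap_mem_segment ℝ l₀ l ⟨by positivity, (div_le_one hpos).2 hl⟩
    refine (convexOn_sampleMgf.le_on_segment (Set.mem_univ _) (Set.mem_univ _) hmem).trans ?_
    exact max_le le_rfl (h.sampleMgf_le l₀)

end IsSampleTiltSolution

lemma isSampleTiltSolution_of_isLocalMin (h : IsLocalMin (sampleMgf g x θ) l) :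
    IsSampleTiltSolution g x θ l := by
  refine ext_inner_left ℝ fun v => ?_
  rw [inner_zero_right, ← avg_inner]
  have hderiv : HasDerivAt (fun s : ℝ => sampleMgf g x θ (l + s • v))
      (avg x fun a => tilt g a θ l * inner ℝ v (g a θ)) 0 :=
    (HasDerivAt.fun_sum fun i _ => hasDerivAt_tilt_line (x i) θ l v).fun_const_smul _
  have hmin : IsLocalMin (fun s : ℝ => sampleMgf g x θ (l + s • v)) 0 := by
    have hline : Continuous fun s : ℝ => l + s • v := by fun_prop
    exact IsLocalMin.comp_continuous (g := fun s : ℝ => l + s • v) (b := 0) (by simpa using h)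
      hline.continuousAt
  simpa only [inner_smul_right] using hmin.hasDerivAt_eq_zero hderiv

lemma exists_isSampleTiltSolution_of_sphere {l₀ : E Ng} {ε : ℝ} (hε : 0 < ε)
    (h : ∀ l, ‖l - l₀‖ = ε → sampleMgf g x θ l₀ < sampleMgf g x θ l) :
    ∃ l, ‖l - l₀‖ < ε ∧ IsSampleTiltSolution g x θ l := by
  obtain ⟨l, hl, hmin⟩ := (isCompact_closedBall l₀ ε).exists_isMinOn
    ⟨l₀, Metric.mem_closedBall_self hε.le⟩
    (continuous_sampleMgf (g := g) (x := x) (θ := θ)).continuousOn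
  rw [mem_closedBall_iff_norm] at hl
  have hlt : ‖l - l₀‖ < ε := hl.lt_of_ne fun heq =>
    (h l heq).not_ge (hmin (Metric.mem_closedBall_self hε.le))
  exact ⟨l, hlt, isSampleTiltSolution_of_isLocalMin
    (hmin.isLocalMin (Metric.closedBall_mem_nhds_of_mem (mem_ball_iff_norm.2 hlt)))⟩

lemma tiltWeights_pos (i : Fin n) : 0 < tiltWeights g x θ l i := by
  have hn : (0 : ℝ) < n := by exact_mod_cast i.pos
  have htilt := tilt_pos (g := g) (x i) θ l
  have hmgf := sampleMgf_pos (g := g) (x := x) (θ := θ) (l := l) i.pos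
  unfold tiltWeights
  positivity

lemma sum_tiltWeights (hn : 0 < n) : ∑ i, tiltWeights g x θ l i = 1 := by
  simp only [tiltWeights]
  rw [← Finset.mul_sum, ← Finset.sum_div, ← mul_div_assoc]
  exact div_self (sampleMgf_pos hn).ne'

lemma sum_tiltWeights_smul :
    ∑ i, tiltWeights g x θ l i • g (x i) θ =
      (sampleMgf g x θ l)⁻¹ • avg x (fun a => tilt g a θ l • g a θ) := by
  simp only [avg, Finset.smul_sum, smul_smul, tiltWeights]
  exact Finset.sum_congr rfl fun i _ => by ring_nf

lemma log_mul_tiltWeights (i : Fin n) : Real.log (n * tiltWeights g x θ l i) =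
    inner ℝ l (g (x i) θ) - Real.log (sampleMgf g x θ l) := by
  have hn : (n : ℝ) ≠ 0 := by exact_mod_cast i.pos.ne'
  rw [tiltWeights, mul_inv_cancel_left₀ hn, Real.log_div (tilt_pos _ _ _).ne'
    (sampleMgf_pos i.pos).ne', tilt, Real.log_exp]

lemma elDiscrepancy_tiltWeights (hn : 0 < n) :
    elDiscrepancy (tiltWeights g x θ l) = tiltDiscrepancy g x θ l := by
  calc elDiscrepancy (tiltWeights g x θ l)
    _ = avg x (fun a => Real.log (sampleMgf g x θ l) - inner ℝ l (g a θ)) := by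
      simp [elDiscrepancy, avg, log_mul_tiltWeights]
    _ = tiltDiscrepancy g x θ l := by rw [avg_sub, avg_const x hn, avg_inner, tiltDiscrepancy]

lemma sum_mul_log_tiltWeights {v : Fin n → ℝ} (hv : ∑ i, v i • g (x i) θ = 0)
    (hv1 : ∑ i, v i = 1) :
    ∑ i, v i * Real.log (n * tiltWeights g x θ l i) = -Real.log (sampleMgf g x θ l) := by
  have hinner : ∑ i, v i * inner ℝ l (g (x i) θ) = 0 := by
    rw [← inner_zero_right (𝕜 := ℝ) l, ← hv, inner_sum]
    simp only [real_inner_smul_right]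
  simp only [log_mul_tiltWeights, mul_sub, Finset.sum_sub_distrib, ← Finset.sum_mul, hinner, hv1,
    one_mul, zero_sub]

theorem IsSampleTiltSolution.isETWeights (hn : 0 < n) (h : IsSampleTiltSolution g x θ l) :
    IsETWeights g x θ (tiltWeights g x θ l) := by
  have hn' : (0 : ℝ) < n := by exact_mod_cast hn
  have hmoment : ∑ i, tiltWeights g x θ l i • g (x i) θ = 0 := by
    rw [sum_tiltWeights_smul, h, smul_zero]
  refine ⟨⟨fun i => (tiltWeights_pos i).le, hmoment, sum_tiltWeights hn⟩, isMinOn_iff.2 ?_⟩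
  rintro v ⟨hv0, hv, hv1⟩
  refine mul_le_mul_of_nonneg_left ?_ (by positivity)
  calc ∑ i, (n * tiltWeights g x θ l i) * Real.log (n * tiltWeights g x θ l i)
    _ = ∑ i, (n * v i) * Real.log (n * tiltWeights g x θ l i) := by
      simp only [mul_assoc, ← Finset.mul_sum]
      rw [sum_mul_log_tiltWeights hmoment (sum_tiltWeights hn), sum_mul_log_tiltWeights hv hv1]
    _ ≤ ∑ i, (n * v i) * Real.log (n * v i) := by
      refine sum_mul_log_le_sum_mul_log (fun i => mul_pos hn' (tiltWeights_pos i))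
        (fun i => mul_nonneg hn'.le (hv0 i)) ?_
      rw [← Finset.mul_sum, ← Finset.mul_sum, sum_tiltWeights hn, hv1]

lemma IsETWeights.sum_mul_log_eq_zero {w d : Fin n → ℝ} (hw : IsETWeights g x θ w)
    (hpos : ∀ i, 0 < w i) (hd : ∑ i, d i = 0) (hdg : ∑ i, d i • g (x i) θ = 0) :
    ∑ i, d i * Real.log (n * w i) = 0 := by
  obtain ⟨⟨-, hwg, hw1⟩, hmin⟩ := hw
  rcases Nat.eq_zero_or_pos n with rfl | hn
  · exact Fin.sum_univ_zero _
  have hn' : (0 : ℝ) < n := by exact_mod_cast hn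
  have hlocal : IsLocalMin (fun t : ℝ => (n : ℝ)⁻¹ * ∑ i, (n * (w i + t * d i)) *
      Real.log (n * (w i + t * d i))) 0 := by
    have hev : ∀ᶠ t : ℝ in 𝓝 0, ∀ i, 0 < w i + t * d i := by
      refine eventually_all.2 fun i => ?_
      have hline : Continuous fun t : ℝ => w i + t * d i := by fun_prop
      exact (hline.tendsto 0).eventually (lt_mem_nhds (by simpa using hpos i))
    filter_upwards [hev] with t ht
    have hfeasible : ∑ i, (w i + t * d i) • g (x i) θ = 0 ∧ ∑ i, (w i + t * d i) = 1 := by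
      simp only [add_smul, mul_smul, Finset.sum_add_distrib, ← Finset.smul_sum, ← Finset.mul_sum,
        hd, hdg, hwg, hw1, smul_zero, mul_zero, add_zero, and_self]
    simpa using hmin (a := fun i => w i + t * d i) ⟨fun i => (ht i).le, hfeasible⟩
  have hderiv := (hasDerivAt_sum_mul_log_line (fun i => (mul_pos hn' (hpos i)).ne')
    fun i => n * d i).const_mul (n : ℝ)⁻¹
  rw [← Finset.mul_sum, hd, mul_zero, add_zero] at hderiv
  have hzero := hlocal.hasDerivAt_eq_zero (hderiv.congr_of_eventuallyEq
    (.of_forall fun t => by simp only [mul_add, mul_left_comm t]))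
  simpa [mul_assoc, ← Finset.mul_sum, hn'.ne'] using hzero

lemma isSampleTiltSolution_of_mul_eq {w : Fin n → ℝ} {e : ℝ} (hn : 0 < n)
    (hw : ∀ i, n * w i = e * tilt g (x i) θ l) (hwg : ∑ i, w i • g (x i) θ = 0)
    (hw1 : ∑ i, w i = 1) : IsSampleTiltSolution g x θ l ∧ w = tiltWeights g x θ l := by
  have hn' : (n : ℝ) ≠ 0 := by exact_mod_cast hn.ne'
  have hw' (i : Fin n) : w i = (n : ℝ)⁻¹ * (e * tilt g (x i) θ l) := by
    rw [← hw, inv_mul_cancel_left₀ hn']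
  have hmgf : e * sampleMgf g x θ l = 1 := by
    rw [← hw1]
    simp only [hw', sampleMgf, avg, smul_eq_mul, ← Finset.mul_sum]
    ring
  have hmoment : e • avg x (fun a => tilt g a θ l • g a θ) = 0 := by
    rw [← hwg]
    simp only [hw', avg, Finset.smul_sum, smul_smul]
    exact Finset.sum_congr rfl fun i _ => by ring_nf
  refine ⟨(smul_eq_zero.1 hmoment).resolve_left (left_ne_zero_of_mul_eq_one hmgf), ?_⟩
  ext i
  rw [hw', tiltWeights, div_eq_inv_mul, eq_inv_of_mul_eq_one_left hmgf]

theorem IsETWeights.exists_eq_tiltWeights (hn : 0 < n) {w : Fin n → ℝ} (hw : IsETWeights g x θ w)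
    (hpos : ∀ i, 0 < w i) : ∃ l, IsSampleTiltSolution g x θ l ∧ w = tiltWeights g x θ l := by
  have hn' : (0 : ℝ) < n := by exact_mod_cast hn
  obtain ⟨c, l, hlog⟩ := exists_eq_add_inner_of_forall_sum_eq_zero
    fun d hd hdg => hw.sum_mul_log_eq_zero hpos hd hdg
  refine ⟨l, isSampleTiltSolution_of_mul_eq hn (e := Real.exp c) (fun i => ?_) hw.1.2.1 hw.1.2.2⟩
  rw [tilt, ← Real.exp_add, ← hlog, Real.exp_log (mul_pos hn' (hpos i))]

lemma IsETEL.exists_isSampleTiltSolution (hn : 0 < n) {Θ : Set (E Nt)} (h : IsETEL g Θ x θ) :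
    ∃ l, IsSampleTiltSolution g x θ l := by
  obtain ⟨-, w, hw, hpos, -⟩ := h
  obtain ⟨l, hl, -⟩ := hw.exists_eq_tiltWeights hn hpos
  exact ⟨l, hl⟩

lemma IsETEL.tiltDiscrepancy_le (hn : 0 < n) {Θ : Set (E Nt)} (h : IsETEL g Θ x θ)
    (hl : IsSampleTiltSolution g x θ l) {θ' : E Nt} (hθ' : θ' ∈ Θ)
    (hl' : IsSampleTiltSolution g x θ' l') :
    tiltDiscrepancy g x θ l ≤ tiltDiscrepancy g x θ' l' := by
  obtain ⟨-, w, hw, hpos, hmin⟩ := h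
  obtain ⟨l₁, hl₁, rfl⟩ := hw.exists_eq_tiltWeights hn hpos
  have hle := hmin θ' hθ' _ (hl'.isETWeights hn) tiltWeights_pos
  rwa [elDiscrepancy_tiltWeights hn, elDiscrepancy_tiltWeights hn, ← hl₁.tiltDiscrepancy_eq hl]
    at hle

lemma IsAugmentedETEL.isSampleTiltSolution {Θ : Set (E Nt)} {β : B Ng Nt}
    (h : IsAugmentedETEL g Θ x β) : IsSampleTiltSolution g x (thOf β) (lamOf β) := by
  refine isSampleTiltSolution_of_isLocalMin (IsMinOn.isLocalMin (s := Set.univ) (fun l hl => ?_)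
    univ_mem)
  simpa [sampleMgf, avg] using h.lam hl

end Tilting

/-! ### Consistency of `λ` and `θ` -/

section Consistency

variable {𝒳 : Type*} {Ng Nt : ℕ} {g : 𝒳 → E Nt → E Ng}

lemma exists_mul_norm_tilt_smul_le_tilt (a : 𝒳) (θ : E Nt) (l : E Ng) {r : ℝ} (hr : 0 ≤ r) :
    ∃ l' ∈ Metric.closedBall l r, r * ‖tilt g a θ l • g a θ‖ ≤ tilt g a θ l' := by
  refine ⟨l + (r / ‖g a θ‖) • g a θ, ?_, ?_⟩
  · rw [mem_closedBall_iff_norm, add_sub_cancel_left, norm_smul,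
      Real.norm_of_nonneg (by positivity)]
    rcases eq_or_ne ‖g a θ‖ 0 with h | h
    · simpa [h] using hr
    · rw [div_mul_cancel₀ _ h]
  · have hinner : inner ℝ ((r / ‖g a θ‖) • g a θ) (g a θ) = r * ‖g a θ‖ := by
      rw [real_inner_smul_left, real_inner_self_eq_norm_sq]
      rcases eq_or_ne ‖g a θ‖ 0 with h | h
      · simp [h]
      · field_simp
    rw [tilt_eq_tilt_mul_exp a θ l (l + _), add_sub_cancel_left, hinner, norm_smul,
      Real.norm_of_nonneg (tilt_pos _ _ _).le, mul_left_comm]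
    exact mul_le_mul_of_nonneg_left (by linarith [Real.add_one_le_exp (r * ‖g a θ‖)])
      (tilt_pos _ _ _).le

/-- The closed tube of radius `r` around the graph of `lamS` over `Θ`, on which the tilting factors
have an integrable envelope. -/
def tube (Θ : Set (E Nt)) (lamS : E Nt → E Ng) (r : ℝ) : Set (E Nt × E Ng) :=
  {y | y.1 ∈ Θ ∧ ‖y.2 - lamS y.1‖ ≤ r}

variable [MeasurableSpace 𝒳] {μ : Measure 𝒳} {Θ : Set (E Nt)} {lamS : E Nt → E Ng} {θs : E Nt}
  {Λ : E Nt → Set (E Ng)} {N : Set (E Nt)} {b : 𝒳 → ℝ}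

lemma mem_tube_lamS {θ : E Nt} (hθ : θ ∈ Θ) {r : ℝ} (hr : 0 ≤ r) :
    (θ, lamS θ) ∈ tube Θ lamS r :=
  ⟨hθ, by simpa using hr⟩

lemma neg_logL_eq {θ : E Nt} (hpos : 0 < ∫ a, tilt g a θ (lamS θ) ∂μ) :
    -logL μ g lamS θ = Real.log (∫ a, tilt g a θ (lamS θ) ∂μ) -
      inner ℝ (lamS θ) (∫ a, g a θ ∂μ) := by
  have h (a : 𝒳) : Real.exp (inner ℝ (lamS θ) (g a θ - ∫ y, g y θ ∂μ)) =
      Real.exp (-inner ℝ (lamS θ) (∫ y, g y θ ∂μ)) * tilt g a θ (lamS θ) := by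
    rw [tilt, ← Real.exp_add, inner_sub_right, neg_add_eq_sub]
  rw [logL, neg_neg]
  simp only [h]
  rw [integral_const_mul, Real.log_mul (Real.exp_pos _).ne' hpos.ne', Real.log_exp,
    neg_add_eq_sub]

namespace Regularity

variable (hreg : Regularity μ g Θ lamS θs Λ N b)
include hreg

lemma measurable_g_left (θ : E Nt) : Measurable fun a => g a θ :=
  hreg.measurable_g.of_uncurry_right

lemma measurable_g_fst : Measurable fun p : 𝒳 × E Nt × E Ng => g p.1 p.2.1 :=
  hreg.measurable_g.comp (measurable_fst.prodMk measurable_snd.fst)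

lemma measurable_tilt : Measurable fun p : 𝒳 × E Nt × E Ng => tilt g p.1 p.2.1 p.2.2 :=
  (measurable_snd.snd.inner hreg.measurable_g_fst).exp

lemma measurable_tilt_left (θ : E Nt) (l : E Ng) : Measurable fun a => tilt g a θ l :=
  (measurable_const.inner (hreg.measurable_g_left θ)).exp

lemma measurable_tilt_smul_left (θ : E Nt) (l : E Ng) :
    Measurable fun a => tilt g a θ l • g a θ :=
  (hreg.measurable_tilt_left θ l).smul (hreg.measurable_g_left θ)

lemma theta_mem : θs ∈ Θ := interior_subset hreg.interior

lemma lamS_mem {θ : E Nt} (hθ : θ ∈ Θ) : lamS θ ∈ Λ θ := by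
  obtain ⟨r, hr, hball⟩ := hreg.interior_lam
  exact hball θ hθ (Metric.mem_closedBall_self hr.le)

lemma integrable_tilt {θ : E Nt} (hθ : θ ∈ Θ) {l : E Ng} (hl : l ∈ Λ θ) :
    Integrable (fun a => tilt g a θ l) μ := by
  refine ⟨(hreg.measurable_tilt_left θ l).aestronglyMeasurable, ?_⟩
  rw [hasFiniteIntegral_iff_ofReal (ae_of_all _ fun a => (tilt_pos a θ l).le)]
  refine (lintegral_mono fun a => ?_).trans_lt hreg.exp_moment
  exact le_iSup₂_of_le θ hθ (le_iSup₂_of_le l hl le_rfl)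

lemma integral_tilt_pos [NeZero μ] {θ : E Nt} (hθ : θ ∈ Θ) :
    0 < ∫ a, tilt g a θ (lamS θ) ∂μ :=
  integral_exp_pos (hreg.integrable_tilt hθ (hreg.lamS_mem hθ))

lemma exists_integrable_bound_tilt_smul {u : ℕ → E Nt} (hu : ∀ k, u k ∈ Θ) :
    ∃ D : 𝒳 → ℝ, Integrable D μ ∧
      ∀ k, ∀ᵐ a ∂μ, ‖tilt g a (u k) (lamS (u k)) • g a (u k)‖ ≤ D a := by
  obtain ⟨r, hr, hball⟩ := hreg.interior_lam
  let q : ℕ → 𝒳 → ℝ := fun k a => r * ‖tilt g a (u k) (lamS (u k)) • g a (u k)‖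
  let d : 𝒳 → ℝ≥0∞ := fun a => ⨆ k, ENNReal.ofReal (q k a)
  have hdm : Measurable d := Measurable.iSup fun k =>
    ((hreg.measurable_tilt_smul_left _ _).norm.const_mul r).ennreal_ofReal
  have hdint : ∫⁻ a, d a ∂μ ≠ ∞ := by
    refine ((lintegral_mono fun a => iSup_le fun k => ?_).trans_lt hreg.exp_moment).ne
    obtain ⟨l, hl, hle⟩ :=
      exists_mul_norm_tilt_smul_le_tilt (g := g) a (u k) (lamS (u k)) hr.le
    exact le_iSup₂_of_le (u k) (hu k)
      (le_iSup₂_of_le l (hball _ (hu k) hl) (ENNReal.ofReal_le_ofReal hle))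
  refine ⟨fun a => (d a).toReal / r,
    (integrable_toReal_of_lintegral_ne_top hdm.aemeasurable hdint).div_const r, fun k => ?_⟩
  filter_upwards [ae_lt_top hdm hdint] with a ha
  rw [le_div_iff₀' hr, ← ENNReal.ofReal_le_iff_le_toReal ha.ne]
  exact le_iSup (fun k => ENNReal.ofReal (q k a)) k

lemma isTiltSolution_of_tendsto {θ : E Nt} (hθ : θ ∈ Θ) {u : ℕ → E Nt}
    (hu : Tendsto u atTop (𝓝[Θ] θ)) (huΘ : ∀ k, u k ∈ Θ) {l : E Ng}
    (hl : Tendsto (fun k => lamS (u k)) atTop (𝓝 l)) : IsTiltSolution μ g θ l := by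
  obtain ⟨D, hD, hbound⟩ := hreg.exists_integrable_bound_tilt_smul huΘ
  have hm (θ : E Nt) (l : E Ng) : AEStronglyMeasurable (fun a => tilt g a θ l • g a θ) μ :=
    (hreg.measurable_tilt_smul_left θ l).aestronglyMeasurable
  have hlim : ∀ᵐ a ∂μ, Tendsto (fun k => tilt g a (u k) (lamS (u k)) • g a (u k)) atTop
      (𝓝 (tilt g a θ l • g a θ)) := by
    filter_upwards [hreg.continuous_g θ hθ] with a ha
    have hg : Tendsto (fun k => g a (u k)) atTop (𝓝 (g a θ)) := Tendsto.comp ha hu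
    exact (hl.inner hg).rexp.smul hg
  constructor
  · refine hD.mono' (hm θ l) ?_
    filter_upwards [ae_all_iff.2 hbound, hlim] with a hba hla
    exact le_of_tendsto hla.norm (.of_forall hba)
  · have h := tendsto_integral_of_dominated_convergence _ (fun k => hm _ _) hD hbound hlim
    simp only [(hreg.lamS_solution _ (huΘ _)).2] at h
    exact tendsto_nhds_unique h tendsto_const_nhds

theorem continuousOn_lamS : ContinuousOn lamS Θ := by
  intro θ hθ
  refine tendsto_of_subseq_tendsto fun u hu => ?_
  obtain ⟨k₀, hk₀⟩ := eventually_atTop.1 (hu.eventually self_mem_nhdsWithin)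
  have huΘ (k : ℕ) : u (k + k₀) ∈ Θ := hk₀ _ (Nat.le_add_left _ _)
  obtain ⟨l, -, φ, hφ, hlim⟩ := tendsto_subseq_of_bounded hreg.bounded_lam
    fun k => Set.mem_biUnion (huΘ k) (hreg.lamS_mem (huΘ k))
  have huφ : Tendsto (fun k => u (φ k + k₀)) atTop (𝓝[Θ] θ) :=
    hu.comp (tendsto_atTop_mono (fun k => Nat.le_add_right _ _) hφ.tendsto_atTop)
  have hsol := hreg.isTiltSolution_of_tendsto hθ huφ (fun k => huΘ _) hlim
  exact ⟨fun k => φ k + k₀, hreg.lamS_unique θ hθ l hsol ▸ hlim⟩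

lemma isCompact_tube (r : ℝ) : IsCompact (tube Θ lamS r) := by
  have h : IsCompact ((fun y : E Nt × E Ng => (y.1, lamS y.1 + y.2)) ''
      (Θ ×ˢ Metric.closedBall 0 r)) :=
    (hreg.compact.prod (isCompact_closedBall 0 r)).image_of_continuousOn
      (continuousOn_fst.prodMk
        ((hreg.continuousOn_lamS.comp continuousOn_fst fun y hy => hy.1).add continuousOn_snd))
  convert h
  ext ⟨θ, l⟩
  simp only [tube, Set.mem_ofPred_eq, Set.mem_image, Set.mem_prod, mem_closedBall_zero_iff,
    Prod.mk.injEq, Prod.exists]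
  constructor
  · rintro ⟨hθ, hl⟩
    exact ⟨θ, l - lamS θ, ⟨hθ, hl⟩, rfl, add_sub_cancel _ _⟩
  · rintro ⟨θ', v, ⟨hθ, hv⟩, rfl, rfl⟩
    exact ⟨hθ, by simpa using hv⟩

lemma isCompact_sphereBundle (ε : ℝ) :
    IsCompact {y : E Nt × E Ng × E Ng |
      y.1 ∈ Θ ∧ ‖y.2.1 - lamS y.1‖ = ε ∧ y.2.2 = lamS y.1} := by
  have hlamS : ContinuousOn (fun y : E Nt × E Ng => lamS y.1) (Θ ×ˢ Metric.sphere 0 ε) :=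
    hreg.continuousOn_lamS.comp continuousOn_fst fun y hy => hy.1
  have h : IsCompact ((fun y : E Nt × E Ng => (y.1, lamS y.1 + y.2, lamS y.1)) ''
      (Θ ×ˢ Metric.sphere 0 ε)) :=
    (hreg.compact.prod (isCompact_sphere 0 ε)).image_of_continuousOn
      (continuousOn_fst.prodMk ((hlamS.add continuousOn_snd).prodMk hlamS))
  convert h
  ext ⟨θ, l, l₀⟩
  simp only [Set.mem_ofPred_eq, Set.mem_image, Set.mem_prod, mem_sphere_zero_iff_norm,
    Prod.mk.injEq, Prod.exists]
  constructor
  · rintro ⟨hθ, hl, hl₀⟩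
    exact ⟨θ, l - lamS θ, ⟨hθ, hl⟩, rfl, add_sub_cancel _ _, hl₀.symm⟩
  · rintro ⟨θ', v, ⟨hθ, hv⟩, rfl, rfl, rfl⟩
    exact ⟨hθ, by simpa using hv, rfl⟩

lemma continuousWithinAt_g_fst {θ : E Nt} (hθ : θ ∈ Θ) {r : ℝ} :
    ∀ᵐ a ∂μ, ContinuousWithinAt (fun y : E Nt × E Ng => g a y.1) (tube Θ lamS r)
      (θ, lamS θ) := by
  filter_upwards [hreg.continuous_g θ hθ] with a ha
  exact ha.comp continuousWithinAt_fst fun y hy => hy.1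

lemma exists_tube_envelope [StandardBorelSpace 𝒳] [IsFiniteMeasure μ] :
    ∃ r > 0, (∀ θ ∈ Θ, Metric.closedBall (lamS θ) r ⊆ Λ θ) ∧ ∃ D : 𝒳 → ℝ, Integrable D μ ∧
      ∀ᵐ a ∂μ, ∀ y ∈ tube Θ lamS r, tilt g a y.1 y.2 ≤ D a := by
  obtain ⟨r, hr, hball⟩ := hreg.interior_lam
  let d : 𝒳 → ℝ≥0∞ := fun a => ⨆ y ∈ tube Θ lamS r, ENNReal.ofReal (tilt g a y.1 y.2)
  have hdm : AEMeasurable d μ := aemeasurable_biSup_of_measurable_uncurry μ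
    (h := fun a (y : E Nt × E Ng) => ENNReal.ofReal (tilt g a y.1 y.2))
    hreg.measurable_tilt.ennreal_ofReal (hreg.isCompact_tube r).measurableSet
  have hdint : ∫⁻ a, d a ∂μ ≠ ∞ := by
    refine ((lintegral_mono fun a => iSup₂_le fun y hy => ?_).trans_lt hreg.exp_moment).ne
    exact le_iSup₂_of_le y.1 hy.1
      (le_iSup₂_of_le y.2 (hball _ hy.1 (mem_closedBall_iff_norm.2 hy.2)) le_rfl)
  refine ⟨r, hr, hball, fun a => (d a).toReal, integrable_toReal_of_lintegral_ne_top hdm hdint, ?_⟩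
  filter_upwards [ae_lt_top' hdm hdint] with a ha y hy
  rw [← ENNReal.ofReal_le_iff_le_toReal ha.ne]
  exact le_iSup₂ (f := fun y (_ : y ∈ tube Θ lamS r) => ENNReal.ofReal (tilt g a y.1 y.2)) y hy

lemma integral_tilt_lamS_lt {θ : E Nt} (hθ : θ ∈ Θ) {l : E Ng} (hl : l ∈ Λ θ)
    (hne : l ≠ lamS θ) : ∫ a, tilt g a θ (lamS θ) ∂μ < ∫ a, tilt g a θ l ∂μ := by
  obtain ⟨hint, hzero⟩ := hreg.lamS_solution θ hθ
  have htilt := hreg.integrable_tilt hθ hl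
  have htiltS := hreg.integrable_tilt hθ (hreg.lamS_mem hθ)
  have hinner := hint.const_inner (𝕜 := ℝ) (l - lamS θ)
  let tangent : 𝒳 → ℝ := fun a =>
    tilt g a θ (lamS θ) + inner ℝ (l - lamS θ) (tilt g a θ (lamS θ) • g a θ)
  have hle : tangent ≤ fun a => tilt g a θ l := fun a => tilt_add_inner_le_tilt _ _ _ _
  have htangent : ∫ a, tangent a ∂μ = ∫ a, tilt g a θ (lamS θ) ∂μ := by
    rw [integral_add htiltS hinner, integral_inner hint, hzero, inner_zero_right, add_zero]
  rw [← htangent]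
  refine (integral_mono (htiltS.add hinner) htilt hle).lt_of_ne fun heq => hne ?_
  have hae : ∀ᵐ a ∂μ, tilt g a θ (lamS θ) • g a θ = tilt g a θ l • g a θ := by
    filter_upwards [(integral_eq_iff_of_ae_le (htiltS.add hinner) htilt
      (ae_of_all _ hle)).1 heq] with a ha
    have hperp : inner ℝ (l - lamS θ) (g a θ) = 0 := by
      by_contra hinner
      exact (tilt_add_inner_lt_tilt hinner).ne ha
    rw [tilt_eq_tilt_mul_exp a θ (lamS θ) l, hperp, Real.exp_zero, mul_one]
  exact hreg.lamS_unique θ hθ l ⟨hint.congr hae, by rw [← integral_congr_ae hae, hzero]⟩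

variable [StandardBorelSpace 𝒳] [IsFiniteMeasure μ]
  {I : Type*} {ℓ : Filter I} {n : I → ℕ} {x : ∀ p, Fin (n p) → 𝒳} (hs : SampleLLN μ ℓ x)
include hs

lemma eventually_sampleMgf_lt {r : ℝ} (hball : ∀ θ ∈ Θ, Metric.closedBall (lamS θ) r ⊆ Λ θ)
    {D : 𝒳 → ℝ} (hD : Integrable D μ)
    (hDle : ∀ᵐ a ∂μ, ∀ y ∈ tube Θ lamS r, tilt g a y.1 y.2 ≤ D a) {ε : ℝ} (hε : 0 < ε)
    (hεr : ε ≤ r) :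
    ∀ᶠ p in ℓ, ∀ θ ∈ Θ, ∀ l, ‖l - lamS θ‖ = ε →
      sampleMgf g (x p) θ (lamS θ) < sampleMgf g (x p) θ l := by
  let K : Set (E Nt × E Ng × E Ng) :=
    {y | y.1 ∈ Θ ∧ ‖y.2.1 - lamS y.1‖ = ε ∧ y.2.2 = lamS y.1}
  have hK : IsCompact K := hreg.isCompact_sphereBundle ε
  have hKΛ : ∀ y ∈ K, y.2.1 ∈ Λ y.1 := fun y hy =>
    hball _ hy.1 (mem_closedBall_iff_norm.2 (hy.2.1.trans_le hεr))
  have hint : ∀ y ∈ K, Integrable (fun a => tilt g a y.1 y.2.1) μ ∧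
      Integrable (fun a => tilt g a y.1 y.2.2) μ := fun y hy =>
    ⟨hreg.integrable_tilt hy.1 (hKΛ y hy), hreg.integrable_tilt hy.1
      (hy.2.2 ▸ hreg.lamS_mem hy.1)⟩
  have hlt : ∀ᶠ p in ℓ, ∀ y ∈ K,
      0 < avg (x p) fun a => tilt g a y.1 y.2.1 - tilt g a y.1 y.2.2 := by
    refine hs.eventually_forall_lt_avg (Y := E Nt × E Ng × E Ng)
      (h := fun a y => tilt g a y.1 y.2.1 - tilt g a y.1 y.2.2) ?_ hK hD.neg ?_ ?_
      (fun y hy => (hint y hy).1.sub (hint y hy).2) ?_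
    · exact (hreg.measurable_tilt.comp
        (measurable_fst.prodMk (measurable_snd.fst.prodMk measurable_snd.snd.fst))).sub
        (hreg.measurable_tilt.comp
        (measurable_fst.prodMk (measurable_snd.fst.prodMk measurable_snd.snd.snd)))
    · filter_upwards [hDle] with a ha y hy
      have hle := ha (y.1, y.2.2)
        ⟨hy.1, by simpa [hy.2.2] using hε.le.trans hεr⟩
      linarith [tilt_pos (g := g) a y.1 y.2.1, show (-D) a = -D a from rfl]
    · intro y hy
      filter_upwards [hreg.continuous_g _ hy.1] with a ha
      have hg : ContinuousWithinAt (fun y : E Nt × E Ng × E Ng => g a y.1) K y :=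
        ha.comp continuousWithinAt_fst fun y hy => hy.1
      exact (continuous_snd.fst.continuousWithinAt.inner hg).rexp.sub
        (continuous_snd.snd.continuousWithinAt.inner hg).rexp
    · intro y hy
      rw [integral_sub (hint y hy).1 (hint y hy).2, sub_pos, hy.2.2]
      refine hreg.integral_tilt_lamS_lt hy.1 (hKΛ y hy) fun heq => hε.ne ?_
      rw [← hy.2.1, heq, sub_self, norm_zero]
  filter_upwards [hlt] with p hp θ hθ l hl
  have hpl := hp (θ, l, lamS θ) ⟨hθ, hl, rfl⟩
  rwa [avg_sub, sub_pos] at hpl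

theorem eventually_isSampleTiltSolution_near {ε : ℝ} (hε : 0 < ε) :
    ∀ᶠ p in ℓ, ∀ θ ∈ Θ, (∀ l, IsSampleTiltSolution g (x p) θ l → ‖l - lamS θ‖ < ε) ∧
      ∃ l, IsSampleTiltSolution g (x p) θ l := by
  obtain ⟨r, hr, hball, D, hD, hDle⟩ := hreg.exists_tube_envelope
  filter_upwards [hreg.eventually_sampleMgf_lt hs hball hD hDle (lt_min hε hr) (min_le_right _ _)]
    with p hp θ hθ
  refine ⟨fun l hl => ?_, ?_⟩
  · by_contra! hfar
    obtain ⟨l', hl', hle⟩ :=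
      hl.exists_norm_sub_eq_sampleMgf_le (lt_min hε hr) ((min_le_left _ _).trans hfar)
    exact (hp θ hθ l' hl').not_ge hle
  · obtain ⟨l, -, hl⟩ := exists_isSampleTiltSolution_of_sphere (lt_min hε hr) (hp θ hθ)
    exact ⟨l, hl⟩

lemma eventually_mem_of_isSampleTiltSolution {θ : E Nt} (hθ : θ ∈ Θ) {r : ℝ} (hr : 0 < r)
    {V : Set (E Nt × E Ng)} (hV : V ∈ 𝓝[tube Θ lamS r] (θ, lamS θ)) :
    ∀ᶠ q in ℓ ×ˢ 𝓝[Θ] θ, ∀ l, IsSampleTiltSolution g (x q.1) q.2 l → (q.2, l) ∈ V := by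
  obtain ⟨δ, hδ, hVδ⟩ := Metric.mem_nhdsWithin_iff.1 hV
  have hlamS := (hreg.continuousOn_lamS θ hθ).eventually (Metric.ball_mem_nhds _ (half_pos hδ))
  have hball : ∀ᶠ θ' in 𝓝[Θ] θ, θ' ∈ Metric.ball θ δ :=
    mem_nhdsWithin_of_mem_nhds (Metric.ball_mem_nhds θ hδ)
  filter_upwards [(hreg.eventually_isSampleTiltSolution_near hs
    (lt_min (half_pos hδ) hr)).prod_mk (eventually_mem_nhdsWithin.and (hlamS.and hball))]
    with q ⟨hsol, hqΘ, hq, hqθ⟩ l hl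
  have hlq := (hsol q.2 hqΘ).1 l hl
  refine hVδ ⟨?_, hqΘ, (hlq.trans_le (min_le_right _ _)).le⟩
  rw [Metric.mem_ball, Prod.dist_eq, max_lt_iff]
  have hdist := dist_triangle l (lamS q.2) (lamS θ)
  rw [dist_eq_norm l (lamS q.2)] at hdist
  exact ⟨hqθ, by linarith [hlq.trans_le (min_le_left _ _), Metric.mem_ball.1 hq]⟩

lemma eventually_lt_avg_tilt {θ : E Nt} (hθ : θ ∈ Θ) {r : ℝ} (hr : 0 ≤ r) {c : ℝ}
    (hc : c < ∫ a, tilt g a θ (lamS θ) ∂μ) :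
    ∀ᶠ q in ℓ ×ˢ 𝓝[tube Θ lamS r] (θ, lamS θ),
      c < avg (x q.1) fun a => tilt g a q.2.1 q.2.2 := by
  refine hs.eventually_lt_avg (Y := E Nt × E Ng) (h := fun a y => tilt g a y.1 y.2)
    hreg.measurable_tilt (hreg.isCompact_tube r).measurableSet (integrable_zero _ _ _)
    (ae_of_all _ fun a y _ => (tilt_pos a y.1 y.2).le) (mem_tube_lamS hθ hr) ?_
    (hreg.integrable_tilt hθ (hreg.lamS_mem hθ)) hc
  filter_upwards [hreg.continuousWithinAt_g_fst hθ] with a ha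
  exact (continuous_snd.continuousWithinAt.inner ha).rexp

lemma eventually_lt_neg_inner_avg {θ : E Nt} (hθ : θ ∈ Θ) {r : ℝ} (hr : 0 ≤ r)
    {D : 𝒳 → ℝ} (hD : Integrable D μ)
    (hDle : ∀ᵐ a ∂μ, ∀ y ∈ tube Θ lamS r, tilt g a y.1 y.2 ≤ D a) {c : ℝ}
    (hc : c < -inner ℝ (lamS θ) (∫ a, g a θ ∂μ)) :
    ∀ᶠ q in ℓ ×ˢ 𝓝[tube Θ lamS r] (θ, lamS θ),
      c < -inner ℝ q.2.2 (avg (x q.1) fun a => g a q.2.1) := by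
  have hint := hreg.integrable_g θ hθ
  suffices h : ∀ᶠ q in ℓ ×ˢ 𝓝[tube Θ lamS r] (θ, lamS θ),
      c < avg (x q.1) fun a => -inner ℝ q.2.2 (g a q.2.1) by
    filter_upwards [h] with q hq
    rwa [avg_neg, avg_inner] at hq
  refine hs.eventually_lt_avg (Y := E Nt × E Ng) (h := fun a y => -inner ℝ y.2 (g a y.1))
    (measurable_snd.snd.inner hreg.measurable_g_fst).neg
    (hreg.isCompact_tube r).measurableSet hD.neg ?_ (mem_tube_lamS hθ hr) ?_
    (hint.const_inner _).neg (by rwa [integral_neg, integral_inner hint])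
  · filter_upwards [hDle] with a ha y hy
    have hle := (Real.add_one_le_exp (inner ℝ y.2 (g a y.1))).trans (ha y hy)
    exact neg_le_neg (by linarith)
  · filter_upwards [hreg.continuousWithinAt_g_fst hθ] with a ha
    exact (continuous_snd.continuousWithinAt.inner ha).neg

lemma eventually_lt_tiltDiscrepancy_tube [NeZero μ] {θ : E Nt} (hθ : θ ∈ Θ) {r : ℝ}
    (hr : 0 ≤ r) {D : 𝒳 → ℝ} (hD : Integrable D μ)
    (hDle : ∀ᵐ a ∂μ, ∀ y ∈ tube Θ lamS r, tilt g a y.1 y.2 ≤ D a) {c : ℝ}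
    (hc : c < -logL μ g lamS θ) :
    ∀ᶠ q in ℓ ×ˢ 𝓝[tube Θ lamS r] (θ, lamS θ),
      c < tiltDiscrepancy g (x q.1) q.2.1 q.2.2 := by
  have hpos := hreg.integral_tilt_pos hθ
  rw [neg_logL_eq hpos, sub_eq_add_neg] at hc
  obtain ⟨c₁, hc₂, hc₁⟩ := exists_between (sub_lt_iff_lt_add.2 hc)
  filter_upwards [hreg.eventually_lt_avg_tilt hs hθ hr ((Real.lt_log_iff_exp_lt hpos).1 hc₁),
    hreg.eventually_lt_neg_inner_avg hs hθ hr hD hDle (sub_lt_comm.1 hc₂)] with q hmgf hinner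
  rw [← add_sub_cancel c₁ c, tiltDiscrepancy, sub_eq_add_neg (Real.log _)]
  exact add_lt_add ((Real.lt_log_iff_exp_lt ((Real.exp_pos _).trans hmgf)).2 hmgf) hinner

lemma eventually_lt_tiltDiscrepancy [NeZero μ] {θ : E Nt} (hθ : θ ∈ Θ) {c : ℝ}
    (hc : c < -logL μ g lamS θ) :
    ∀ᶠ q in ℓ ×ˢ 𝓝[Θ] θ, ∀ l, IsSampleTiltSolution g (x q.1) q.2 l →
      c < tiltDiscrepancy g (x q.1) q.2 l := by
  obtain ⟨r, hr, -, D, hD, hDle⟩ := hreg.exists_tube_envelope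
  have htube := hreg.eventually_lt_tiltDiscrepancy_tube hs hθ hr.le hD hDle hc
  obtain ⟨pa, hpa, pb, hpb, hQ⟩ := eventually_prod_iff.1 htube
  have hmem : ∀ᶠ q in ℓ ×ˢ 𝓝[Θ] θ, ∀ l, IsSampleTiltSolution g (x q.1) q.2 l → pb (q.2, l) :=
    hreg.eventually_mem_of_isSampleTiltSolution hs hθ hr hpb
  filter_upwards [hmem, hpa.prod_inl _] with q hqb hqa l hl
  exact hQ (x := q.1) (y := (q.2, l)) hqa (hqb l hl)

lemma eventually_tiltDiscrepancy_lt [NeZero μ] {θ : E Nt} (hθ : θ ∈ Θ) {c : ℝ}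
    (hc : -logL μ g lamS θ < c) :
    ∀ᶠ p in ℓ, ∀ l, IsSampleTiltSolution g (x p) θ l → tiltDiscrepancy g (x p) θ l < c := by
  have hpos := hreg.integral_tilt_pos hθ
  have hmgf := hs.lln _ (hreg.integrable_tilt hθ (hreg.lamS_mem hθ))
  have hmean := hs.lln_finiteDimensional (hreg.integrable_g θ hθ)
  have hlim : Tendsto (fun q : I × E Ng => Real.log (sampleMgf g (x q.1) θ (lamS θ)) -
      inner ℝ q.2 (avg (x q.1) fun a => g a θ)) (ℓ ×ˢ 𝓝 (lamS θ))
      (𝓝 (-logL μ g lamS θ)) := by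
    rw [neg_logL_eq hpos]
    exact ((hmgf.log hpos.ne').comp tendsto_fst).sub
      (tendsto_snd.inner (hmean.comp tendsto_fst))
  obtain ⟨pa, hpa, pb, hpb, hQ⟩ := eventually_prod_iff.1 (hlim.eventually_lt_const hc)
  obtain ⟨ε, hε, hball⟩ := Metric.eventually_nhds_iff.1 hpb
  filter_upwards [hpa, hreg.eventually_isSampleTiltSolution_near hs hε, hs.size_pos]
    with p hp hnear hn l hl
  refine lt_of_le_of_lt ?_ (hQ hp (hball ((dist_eq_norm _ _).trans_lt ((hnear θ hθ).1 l hl))))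
  exact sub_le_sub_right (Real.log_le_log (sampleMgf_pos hn) (hl.sampleMgf_le _)) _

theorem eventually_isETEL_near [NeZero μ] {ε : ℝ} (hε : 0 < ε) :
    ∀ᶠ p in ℓ, ∀ θ, IsETEL g Θ (x p) θ → ‖θ - θs‖ < ε := by
  have hK : IsCompact (Θ \ Metric.ball θs ε) := hreg.compact.diff Metric.isOpen_ball
  have hnot : ∀ᶠ p in ℓ, ∀ θ ∈ Θ \ Metric.ball θs ε, ¬ IsETEL g Θ (x p) θ := by
    refine eventually_forall_of_isCompact hK fun θ hθ => ?_
    have hne : θ ≠ θs := fun heq => hθ.2 (heq ▸ Metric.mem_ball_self hε)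
    obtain ⟨c, hc, hc'⟩ := exists_between (neg_lt_neg (hreg.maximizer θ hθ.1 hne))
    have hle : ℓ ×ˢ 𝓝[Θ \ Metric.ball θs ε] θ ≤ ℓ ×ˢ 𝓝[Θ] θ :=
      prod_mono_right _ (nhdsWithin_mono _ Set.sdiff_subset)
    have hfar := (hreg.eventually_lt_tiltDiscrepancy hs hθ.1 hc').filter_mono hle
    have hsolution := hreg.eventually_isSampleTiltSolution_near hs one_pos
    filter_upwards [hfar, ((hs.size_pos.and hsolution).and
      (hreg.eventually_tiltDiscrepancy_lt hs hreg.theta_mem hc)).prod_inl _]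
      with q hq ⟨⟨hn, hexists⟩, hqs⟩ hETEL
    obtain ⟨l, hl⟩ := hETEL.exists_isSampleTiltSolution hn
    obtain ⟨ls, hls⟩ := (hexists θs hreg.theta_mem).2
    exact ((hqs ls hls).trans (hq l hl)).not_ge
      (hETEL.tiltDiscrepancy_le hn hl hreg.theta_mem hls)
  filter_upwards [hnot] with p hp θ hθ
  by_contra hfar
  exact hp θ ⟨hθ.1, by rwa [mem_ball_iff_norm]⟩ hθ

theorem eventually_isAugmentedETEL_near [NeZero μ] {ε : ℝ} (hε : 0 < ε) :
    ∀ᶠ p in ℓ, ∀ β, IsAugmentedETEL g Θ (x p) β →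
      ‖thOf β - θs‖ < ε ∧ ‖lamOf β - lamS θs‖ < ε := by
  obtain ⟨δ, hδ, hcont⟩ := Metric.continuousWithinAt_iff.1
    (hreg.continuousOn_lamS θs hreg.theta_mem) (ε / 2) (half_pos hε)
  filter_upwards [hreg.eventually_isETEL_near hs (lt_min hε hδ),
    hreg.eventually_isSampleTiltSolution_near hs (half_pos hε)] with p hp hsol β hβ
  have hθ := hp _ hβ.theta
  refine ⟨hθ.trans_le (min_le_left _ _), ?_⟩
  have hl := (hsol _ hβ.theta.1).1 _ hβ.isSampleTiltSolution
  have hlamS := hcont hβ.theta.1 ((dist_eq_norm _ _).trans_lt (hθ.trans_le (min_le_right _ _)))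
  rw [dist_eq_norm] at hlamS
  linarith [norm_sub_le_norm_sub_add_norm_sub (lamOf β) (lamS (thOf β)) (lamS θs)]

end Regularity

end Consistency

/-! ### Lipschitz moments and linearization -/

section Lipschitz

variable {𝒳 Y F G H : Type*} [NormedAddCommGroup Y] [NormedAddCommGroup F] [NormedAddCommGroup G]
  [NormedAddCommGroup H]

/-- The random functions `f a`, `a ∈ S`, are graded of degree `(i, j)` on `R` in the random weights
`1 + |v|` and `1 + |b|`: `f a` is bounded there by a multiple of `(1 + |v a|)^i (1 + |b a|)^j`, and
it is Lipschitz at the cost of one more factor `1 + |b a|`. Degrees add up under products, so the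
moments needed for a polynomial expression can be read off its factors. -/
def LipGraded (S : Set 𝒳) (R : Set Y) (v b : 𝒳 → ℝ) (i j : ℕ) (f : 𝒳 → Y → F) : Prop :=
  ∃ C, 0 ≤ C ∧ ∀ a ∈ S, (∀ y ∈ R, ‖f a y‖ ≤ C * ((1 + |v a|) ^ i * (1 + |b a|) ^ j)) ∧
    ∀ y ∈ R, ∀ y' ∈ R,
      ‖f a y - f a y'‖ ≤ C * ((1 + |v a|) ^ i * (1 + |b a|) ^ (j + 1)) * ‖y - y'‖

namespace LipGraded

variable {S : Set 𝒳} {R : Set Y} {v b : 𝒳 → ℝ} {i i' j j' : ℕ}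

lemma mono {f : 𝒳 → Y → F} (h : LipGraded S R v b i j f) (hi : i ≤ i') (hj : j ≤ j') :
    LipGraded S R v b i' j' f := by
  obtain ⟨C, hC, h⟩ := h
  have hv (a : 𝒳) : 1 ≤ 1 + |v a| := le_add_of_nonneg_right (abs_nonneg _)
  have hb (a : 𝒳) : 1 ≤ 1 + |b a| := le_add_of_nonneg_right (abs_nonneg _)
  refine ⟨C, hC, fun a ha => ⟨fun y hy => ((h a ha).1 y hy).trans ?_, fun y hy y' hy' =>
    ((h a ha).2 y hy y' hy').trans ?_⟩⟩ <;> gcongr <;> solve_by_elim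

lemma add {f f' : 𝒳 → Y → F} (h : LipGraded S R v b i j f) (h' : LipGraded S R v b i j f') :
    LipGraded S R v b i j fun a y => f a y + f' a y := by
  obtain ⟨C, hC, h⟩ := h
  obtain ⟨C', hC', h'⟩ := h'
  refine ⟨C + C', by positivity, fun a ha => ⟨fun y hy => ?_, fun y hy y' hy' => ?_⟩⟩
  · rw [add_mul]
    exact norm_add_le_of_le ((h a ha).1 y hy) ((h' a ha).1 y hy)
  · rw [add_mul, add_mul, add_sub_add_comm]
    exact norm_add_le_of_le ((h a ha).2 y hy y' hy') ((h' a ha).2 y hy y' hy')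

variable [NormedSpace ℝ F] [NormedSpace ℝ G] [NormedSpace ℝ H]

lemma clm {f : 𝒳 → Y → F} (h : LipGraded S R v b i j f) (L : F →L[ℝ] G) :
    LipGraded S R v b i j fun a y => L (f a y) := by
  obtain ⟨C, hC, h⟩ := h
  refine ⟨‖L‖ * C, by positivity, fun a ha => ⟨fun y hy => ?_, fun y hy y' hy' => ?_⟩⟩
  · rw [mul_assoc]
    exact L.le_opNorm_of_le ((h a ha).1 y hy)
  · rw [← map_sub, mul_assoc, mul_assoc, ← mul_assoc C]
    exact L.le_opNorm_of_le ((h a ha).2 y hy y' hy')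

lemma neg {f : 𝒳 → Y → F} (h : LipGraded S R v b i j f) :
    LipGraded S R v b i j fun a y => -f a y :=
  h.clm (-ContinuousLinearMap.id ℝ F)

lemma sub {f f' : 𝒳 → Y → F} (h : LipGraded S R v b i j f) (h' : LipGraded S R v b i j f') :
    LipGraded S R v b i j fun a y => f a y - f' a y := by
  simpa only [sub_eq_add_neg] using h.add h'.neg

lemma bilin {f : 𝒳 → Y → F} {f' : 𝒳 → Y → G} (h : LipGraded S R v b i j f)
    (h' : LipGraded S R v b i' j' f') (L : F →L[ℝ] G →L[ℝ] H) :
    LipGraded S R v b (i + i') (j + j') fun a y => L (f a y) (f' a y) := by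
  obtain ⟨C, hC, h⟩ := h
  obtain ⟨C', hC', h'⟩ := h'
  refine ⟨2 * (‖L‖ * C * C'), by positivity, fun a ha => ?_⟩
  obtain ⟨hf, hfL⟩ := h a ha
  obtain ⟨hf', hfL'⟩ := h' a ha
  refine ⟨fun y hy => ?_, fun y hy y' hy' => ?_⟩
  · calc
      _ ≤ ‖L‖ * ‖f a y‖ * ‖f' a y‖ := L.le_opNorm₂ _ _
      _ ≤ ‖L‖ * (C * ((1 + |v a|) ^ i * (1 + |b a|) ^ j)) *
          (C' * ((1 + |v a|) ^ i' * (1 + |b a|) ^ j')) := by gcongr <;> solve_by_elim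
      _ = 1 * (‖L‖ * C * C') * ((1 + |v a|) ^ (i + i') * (1 + |b a|) ^ (j + j')) := by ring
      _ ≤ 2 * (‖L‖ * C * C') * ((1 + |v a|) ^ (i + i') * (1 + |b a|) ^ (j + j')) := by
        gcongr
        exact one_le_two
  · have hsplit : L (f a y) (f' a y) - L (f a y') (f' a y') =
        L (f a y - f a y') (f' a y) + L (f a y') (f' a y - f' a y') := by simp
    rw [hsplit]
    calc
      _ ≤ ‖L‖ * ‖f a y - f a y'‖ * ‖f' a y‖ + ‖L‖ * ‖f a y'‖ * ‖f' a y - f' a y'‖ :=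
        norm_add_le_of_le (L.le_opNorm₂ _ _) (L.le_opNorm₂ _ _)
      _ ≤ ‖L‖ * (C * ((1 + |v a|) ^ i * (1 + |b a|) ^ (j + 1)) * ‖y - y'‖) *
            (C' * ((1 + |v a|) ^ i' * (1 + |b a|) ^ j')) +
          ‖L‖ * (C * ((1 + |v a|) ^ i * (1 + |b a|) ^ j)) *
            (C' * ((1 + |v a|) ^ i' * (1 + |b a|) ^ (j' + 1)) * ‖y - y'‖) := by
        gcongr <;> solve_by_elim
      _ = _ := by ring

lemma mul {f f' : 𝒳 → Y → ℝ} (h : LipGraded S R v b i j f) (h' : LipGraded S R v b i' j' f') :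
    LipGraded S R v b (i + i') (j + j') fun a y => f a y * f' a y :=
  h.bilin h' (ContinuousLinearMap.mul ℝ ℝ)

lemma smul {f : 𝒳 → Y → ℝ} {f' : 𝒳 → Y → F} (h : LipGraded S R v b i j f)
    (h' : LipGraded S R v b i' j' f') :
    LipGraded S R v b (i + i') (j + j') fun a y => f a y • f' a y :=
  h.bilin h' (ContinuousLinearMap.lsmul ℝ ℝ)

lemma inner {F : Type*} [NormedAddCommGroup F] [InnerProductSpace ℝ F] {f f' : 𝒳 → Y → F}
    (h : LipGraded S R v b i j f) (h' : LipGraded S R v b i' j' f') :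
    LipGraded S R v b (i + i') (j + j') fun a y => inner ℝ (f a y) (f' a y) :=
  h.bilin h' (innerSL ℝ)

lemma of_clm [NormedSpace ℝ Y] (hR : Bornology.IsBounded R) (L : Y →L[ℝ] F) :
    LipGraded S R v b 0 0 fun _ y => L y := by
  obtain ⟨M, hM, hRM⟩ := hR.exists_pos_norm_le
  refine ⟨‖L‖ * (M + 1), by positivity, fun a _ => ⟨fun y hy => ?_, fun y _ y' _ => ?_⟩⟩
  · rw [pow_zero, pow_zero, mul_one, mul_one]
    exact L.le_opNorm_of_le ((hRM y hy).trans (le_add_of_nonneg_right zero_le_one))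
  · rw [← map_sub]
    calc
      _ ≤ ‖L‖ * 1 * 1 * ‖y - y'‖ := by simpa using L.le_opNorm (y - y')
      _ ≤ _ := by
        gcongr
        · exact le_add_of_nonneg_left hM.le
        · simp

lemma euclidean {ι : Type*} [Fintype ι] {f : 𝒳 → Y → EuclideanSpace ℝ ι}
    (h : ∀ k, LipGraded S R v b i j fun a y => f a y k) : LipGraded S R v b i j f := by
  choose C hC h using h
  have hle (v : EuclideanSpace ℝ ι) : ‖v‖ ≤ ∑ i, ‖v i‖ := by
    rw [EuclideanSpace.norm_eq, Real.sqrt_le_left (by positivity)]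
    exact Finset.sum_sq_le_sq_sum_of_nonneg fun i _ => norm_nonneg _
  refine ⟨∑ i, C i, Finset.sum_nonneg fun i _ => hC i, fun a ha => ⟨fun y hy => ?_,
    fun y hy y' hy' => ?_⟩⟩
  · rw [Finset.sum_mul]
    exact (hle _).trans (Finset.sum_le_sum fun i _ => (h i a ha).1 y hy)
  · rw [Finset.sum_mul, Finset.sum_mul]
    exact (hle _).trans (Finset.sum_le_sum fun i _ => (h i a ha).2 y hy y' hy')

end LipGraded

end Lipschitz

section Linearization

variable {𝒳 F : Type*} [NormedAddCommGroup F]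

section Slope

variable {Y : Type*} [NormedAddCommGroup Y] [TopologicalSpace.SeparableSpace Y]

/-- The supremum of the slopes `‖h a y‖ / ‖y - y₀‖` over the punctured ball of radius `t` around
`y₀`, taken over a countable dense set so that it is measurable in `a`. -/
noncomputable def slopeSup (h : 𝒳 → Y → F) (y₀ : Y) (t : ℝ) (a : 𝒳) : ℝ≥0∞ :=
  ⨆ k, ⨆ (_ : TopologicalSpace.denseSeq Y k ∈ Metric.ball y₀ t \ {y₀}),
    ENNReal.ofReal (‖h a (TopologicalSpace.denseSeq Y k)‖ /
      ‖TopologicalSpace.denseSeq Y k - y₀‖)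

variable {h : 𝒳 → Y → F} {y₀ : Y} {t δ₀ : ℝ} {a : 𝒳}

lemma slopeSup_le {C : ℝ} (hC : ∀ y ∈ Metric.ball y₀ t, ‖h a y‖ ≤ C * ‖y - y₀‖) :
    slopeSup h y₀ t a ≤ ENNReal.ofReal C :=
  iSup₂_le fun _ hk => ENNReal.ofReal_le_ofReal
    ((div_le_iff₀ (norm_pos_iff.2 (sub_ne_zero.2 hk.2))).2 (hC _ hk.1))

lemma norm_le_slopeSup_mul (hcont : ContinuousOn (h a) (Metric.ball y₀ t)) (hzero : h a y₀ = 0)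
    (hfin : slopeSup h y₀ t a ≠ ∞) {y : Y} (hy : y ∈ Metric.ball y₀ t) :
    ‖h a y‖ ≤ (slopeSup h y₀ t a).toReal * ‖y - y₀‖ := by
  rcases eq_or_ne y y₀ with rfl | hne
  · simp [hzero]
  let U : Set Y := Metric.ball y₀ t \ {y₀}
  let s := TopologicalSpace.denseSeq Y
  have hclosure : y ∈ closure (U ∩ Set.range s) :=
    (TopologicalSpace.denseRange_denseSeq Y).open_subset_closure_inter
      (Metric.isOpen_ball.sdiff isClosed_singleton) ⟨hy, hne⟩
  refine ContinuousWithinAt.closure_le hclosure (f := fun y => ‖h a y‖)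
    (g := fun y => (slopeSup h y₀ t a).toReal * ‖y - y₀‖)
    ((hcont y hy).mono fun z hz => hz.1.1).norm (by fun_prop) ?_
  rintro _ ⟨hk, k, rfl⟩
  rw [← div_le_iff₀ (norm_pos_iff.2 (sub_ne_zero.2 hk.2)),
    ← ENNReal.ofReal_le_iff_le_toReal hfin]
  exact le_iSup₂ (f := fun k (_ : s k ∈ U) => ENNReal.ofReal (‖h a (s k)‖ / ‖s k - y₀‖)) k hk

lemma tendsto_toReal_slopeSup_zero (ho : h a =o[𝓝 y₀] fun y => y - y₀) {t : ℕ → ℝ}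
    (ht : Tendsto t atTop (𝓝 0)) :
    Tendsto (fun m => (slopeSup h y₀ (t m) a).toReal) atTop (𝓝 0) := by
  rw [Metric.tendsto_nhds]
  intro ε hε
  obtain ⟨δ, hδ, hball⟩ := Metric.eventually_nhds_iff_ball.1 (ho.def (half_pos hε))
  filter_upwards [ht.eventually_lt_const hδ] with m hm
  have hle : (slopeSup h y₀ (t m) a).toReal ≤ ε / 2 :=
    ENNReal.toReal_le_of_le_ofReal (half_pos hε).le
      (slopeSup_le fun y hy => hball y (Metric.ball_subset_ball hm.le hy))
  rw [dist_zero_right, Real.norm_of_nonneg ENNReal.toReal_nonneg]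
  exact hle.trans_lt (half_lt_self hε)

variable [MeasurableSpace 𝒳] {μ : Measure 𝒳}

lemma aemeasurable_slopeSup
    (hmeas : ∀ y ∈ Metric.ball y₀ t, AEStronglyMeasurable (fun a => h a y) μ) :
    AEMeasurable (slopeSup h y₀ t) μ :=
  AEMeasurable.iSup fun _ => AEMeasurable.iSup fun hk =>
    ((hmeas _ hk.1).norm.aemeasurable.div_const _).ennreal_ofReal

theorem exists_integrable_slope_lt (hδ₀ : 0 < δ₀) {L : 𝒳 → ℝ} (hL : Integrable L μ)
    (hL0 : ∀ᵐ a ∂μ, 0 ≤ L a)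
    (hmeas : ∀ y ∈ Metric.ball y₀ δ₀, AEStronglyMeasurable (fun a => h a y) μ)
    (hcont : ∀ᵐ a ∂μ, ContinuousOn (h a) (Metric.ball y₀ δ₀))
    (hbound : ∀ᵐ a ∂μ, ∀ y ∈ Metric.ball y₀ δ₀, ‖h a y‖ ≤ L a * ‖y - y₀‖)
    (ho : ∀ᵐ a ∂μ, h a =o[𝓝 y₀] fun y => y - y₀) {ε : ℝ} (hε : 0 < ε) :
    ∃ t > 0, ∃ ρ : 𝒳 → ℝ, Integrable ρ μ ∧ ∫ a, ρ a ∂μ < ε ∧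
      ∀ᵐ a ∂μ, ∀ y ∈ Metric.ball y₀ t, ‖h a y‖ ≤ ρ a * ‖y - y₀‖ := by
  let t : ℕ → ℝ := fun m => δ₀ / ((m : ℝ) + 1)
  have htle (m : ℕ) : t m ≤ δ₀ := div_le_self hδ₀.le (by simp)
  have hball (m : ℕ) : Metric.ball y₀ (t m) ⊆ Metric.ball y₀ δ₀ := Metric.ball_subset_ball (htle m)
  let ρ : ℕ → 𝒳 → ℝ := fun m a => (slopeSup h y₀ (t m) a).toReal
  have hρm (m : ℕ) : AEStronglyMeasurable (ρ m) μ :=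
    (aemeasurable_slopeSup fun y hy => hmeas y (hball m hy)).ennreal_toReal.aestronglyMeasurable
  have hle : ∀ᵐ a ∂μ, ∀ m, slopeSup h y₀ (t m) a ≤ ENNReal.ofReal (L a) := by
    filter_upwards [hbound] with a ha m using slopeSup_le fun y hy => ha y (hball m hy)
  have hρL (m : ℕ) : ∀ᵐ a ∂μ, ‖ρ m a‖ ≤ L a := by
    filter_upwards [hle, hL0] with a ha ha0
    rw [Real.norm_of_nonneg ENNReal.toReal_nonneg]
    exact ENNReal.toReal_le_of_le_ofReal ha0 (ha m)
  have ht : Tendsto t atTop (𝓝 0) := tendsto_const_div_atTop_nhds_zero_nat δ₀ |>.comp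
    (tendsto_add_atTop_nat 1) |>.congr fun m => by simp [t]
  have hlim : Tendsto (fun m => ∫ a, ρ m a ∂μ) atTop (𝓝 (∫ _, (0 : ℝ) ∂μ)) := by
    refine tendsto_integral_of_dominated_convergence L hρm hL hρL ?_
    filter_upwards [ho] with a ha using tendsto_toReal_slopeSup_zero ha ht
  rw [integral_zero] at hlim
  obtain ⟨m, hm⟩ := (hlim.eventually_lt_const hε).exists
  refine ⟨t m, by positivity, ρ m, hL.mono' (hρm m) (hρL m), hm, ?_⟩
  filter_upwards [hle, hcont, hbound] with a hla hca hba y hy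
  have hzero : h a y₀ = 0 := norm_le_zero_iff.1 (by
    simpa using hba y₀ (Metric.mem_ball_self hδ₀))
  exact norm_le_slopeSup_mul (hca.mono (hball m)) hzero
    (ne_top_of_le_ne_top ENNReal.ofReal_ne_top (hla m)) hy

end Slope

variable [MeasurableSpace 𝒳] {μ : Measure 𝒳} {I : Type*} {ℓ : Filter I} {n : I → ℕ}
  {x : ∀ p, Fin (n p) → 𝒳}

lemma SampleLLN.eventually_forall_ball_norm_avg_sub_integral_lt [NormedSpace ℝ F]
    [FiniteDimensional ℝ F] {Y : Type*} [NormedAddCommGroup Y] (hs : SampleLLN μ ℓ x)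
    {f : 𝒳 → Y → F} {y₀ : Y} {δ₀ : ℝ} (hδ₀ : 0 < δ₀) {L : 𝒳 → ℝ} (hL : Integrable L μ)
    (hlip : ∀ᵐ a ∂μ, ∀ y ∈ Metric.ball y₀ δ₀, ‖f a y - f a y₀‖ ≤ L a * ‖y - y₀‖)
    (hint : Integrable (fun a => f a y₀) μ) {ε : ℝ} (hε : 0 < ε) :
    ∃ δ > 0, ∀ᶠ p in ℓ, ∀ y ∈ Metric.ball y₀ δ,
      ‖avg (x p) (fun a => f a y) - ∫ a, f a y₀ ∂μ‖ < ε := by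
  obtain ⟨M, hM, hLM⟩ : ∃ M > 0, ∫ a, L a ∂μ < M :=
    ⟨max (∫ a, L a ∂μ) 0 + 1, by positivity, by linarith [le_max_left (∫ a, L a ∂μ) 0]⟩
  refine ⟨min δ₀ (ε / 2 / M), lt_min hδ₀ (by positivity), ?_⟩
  have hlln := tendsto_iff_norm_sub_tendsto_zero.1 (hs.lln_finiteDimensional hint)
  filter_upwards [(hs.lln _ hL).eventually_lt_const hLM,
    hlln.eventually_lt_const (half_pos hε), hs.ae _ hlip] with p hpL hpf hplip y hy
  rw [Metric.mem_ball, lt_min_iff, dist_eq_norm] at hy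
  have hnear : ‖avg (x p) (fun a => f a y) - avg (x p) (fun a => f a y₀)‖ ≤ ε / 2 := by
    rw [← avg_sub]
    calc
      _ ≤ avg (x p) (fun a => ‖f a y - f a y₀‖) := norm_avg_le _ _
      _ ≤ avg (x p) (fun a => ‖y - y₀‖ * L a) := avg_mono _ fun i =>
        (hplip i y (mem_ball_iff_norm.2 hy.1)).trans_eq (mul_comm _ _)
      _ = ‖y - y₀‖ * avg (x p) L := avg_mul _ _ _
      _ ≤ ‖y - y₀‖ * M := by gcongr
      _ ≤ ε / 2 / M * M := by gcongr; exact hy.2.le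
      _ = ε / 2 := div_mul_cancel₀ _ hM.ne'
  linarith [norm_sub_le_norm_sub_add_norm_sub (avg (x p) fun a => f a y)
    (avg (x p) fun a => f a y₀) (∫ a, f a y₀ ∂μ)]

variable [NormedSpace ℝ F] {ι : Type*} {f : 𝒳 → EuclideanSpace ℝ ι → F}
  {y₀ : EuclideanSpace ℝ ι}

lemma clm_eq_sum_smulRight [Fintype ι] [DecidableEq ι] (T : EuclideanSpace ℝ ι →L[ℝ] F) :
    T = ∑ j, (EuclideanSpace.proj (𝕜 := ℝ) j : EuclideanSpace ℝ ι →L[ℝ] ℝ).smulRight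
      (T (EuclideanSpace.single j 1)) := by
  ext v
  simp only [sum_apply, ContinuousLinearMap.smulRight_apply]
  conv_lhs => rw [← (EuclideanSpace.basisFun ι ℝ).sum_repr v, map_sum]
  simp

lemma aestronglyMeasurable_fderiv_apply {Y : Type*} [NormedAddCommGroup Y] [NormedSpace ℝ Y]
    {f : 𝒳 → Y → F} {y₀ : Y} (hmeas : ∀ᶠ y in 𝓝 y₀, AEStronglyMeasurable (fun a => f a y) μ)
    (hdiff : ∀ᵐ a ∂μ, DifferentiableAt ℝ (f a) y₀) (v : Y) :
    AEStronglyMeasurable (fun a => fderiv ℝ (f a) y₀ v) μ := by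
  have hline : Tendsto (fun s : ℝ => y₀ + s • v) (𝓝[>] 0) (𝓝 y₀) := by
    refine Tendsto.mono_left ?_ nhdsWithin_le_nhds
    simpa using (Continuous.tendsto (by fun_prop : Continuous fun s : ℝ => y₀ + s • v) 0)
  obtain ⟨t, ht, htmeas⟩ := exists_seq_forall_of_frequently (hline.eventually hmeas).frequently
  refine aestronglyMeasurable_of_tendsto_ae atTop
    (f := fun m a => (t m)⁻¹ • (f a (y₀ + t m • v) - f a y₀))
    (fun m => ((htmeas m).sub hmeas.self_of_nhds).const_smul _) ?_
  filter_upwards [hdiff] with a ha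
  have hderiv : HasDerivAt (fun s : ℝ => f a (y₀ + s • v)) (fderiv ℝ (f a) y₀ v) 0 :=
    ha.hasFDerivAt.hasLineDerivAt v
  simpa [Function.comp_def] using hderiv.tendsto_slope_zero_right.comp ht

lemma aestronglyMeasurable_fderiv [Finite ι]
    (hmeas : ∀ᶠ y in 𝓝 y₀, AEStronglyMeasurable (fun a => f a y) μ)
    (hdiff : ∀ᵐ a ∂μ, DifferentiableAt ℝ (f a) y₀) :
    AEStronglyMeasurable (fun a => fderiv ℝ (f a) y₀) μ := by
  classical
  cases nonempty_fintype ι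
  rw [funext fun a => clm_eq_sum_smulRight (fderiv ℝ (f a) y₀)]
  exact Finset.aestronglyMeasurable_fun_sum _ fun j _ =>
    (ContinuousLinearMap.smulRightL ℝ _ F (EuclideanSpace.proj j)).continuous
      |>.comp_aestronglyMeasurable (aestronglyMeasurable_fderiv_apply hmeas hdiff _)

variable [Fintype ι] {δ₀ : ℝ} {L : 𝒳 → ℝ}

lemma ae_norm_fderiv_le (hδ₀ : 0 < δ₀) (hL0 : ∀ᵐ a ∂μ, 0 ≤ L a)
    (hdiff : ∀ᵐ a ∂μ, DifferentiableAt ℝ (f a) y₀)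
    (hlip : ∀ᵐ a ∂μ, ∀ y ∈ Metric.ball y₀ δ₀, ‖f a y - f a y₀‖ ≤ L a * ‖y - y₀‖) :
    ∀ᵐ a ∂μ, ‖fderiv ℝ (f a) y₀‖ ≤ L a := by
  filter_upwards [hL0, hdiff, hlip] with a ha0 had hal
  exact had.hasFDerivAt.le_of_lip' ha0 (mem_of_superset (Metric.ball_mem_nhds y₀ hδ₀) hal)

lemma integrable_fderiv (hδ₀ : 0 < δ₀) (hL : Integrable L μ) (hL0 : ∀ᵐ a ∂μ, 0 ≤ L a)
    (hmeas : ∀ y ∈ Metric.ball y₀ δ₀, AEStronglyMeasurable (fun a => f a y) μ)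
    (hdiff : ∀ᵐ a ∂μ, DifferentiableAt ℝ (f a) y₀)
    (hlip : ∀ᵐ a ∂μ, ∀ y ∈ Metric.ball y₀ δ₀, ‖f a y - f a y₀‖ ≤ L a * ‖y - y₀‖) :
    Integrable (fun a => fderiv ℝ (f a) y₀) μ :=
  hL.mono' (aestronglyMeasurable_fderiv
    (mem_of_superset (Metric.ball_mem_nhds y₀ hδ₀) hmeas) hdiff)
    (ae_norm_fderiv_le hδ₀ hL0 hdiff hlip)

-- The averaged remainder is controlled by the mean of the slope modulus, the rest by the law of
-- large numbers for the derivative.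
theorem SampleLLN.eventually_norm_avg_sub_fderiv_le [FiniteDimensional ℝ F] (hs : SampleLLN μ ℓ x)
    (hδ₀ : 0 < δ₀) (hL : Integrable L μ) (hL0 : ∀ᵐ a ∂μ, 0 ≤ L a)
    (hmeas : ∀ y ∈ Metric.ball y₀ δ₀, AEStronglyMeasurable (fun a => f a y) μ)
    (hdiff : ∀ᵐ a ∂μ, DifferentiableAt ℝ (f a) y₀)
    (hcont : ∀ᵐ a ∂μ, ContinuousOn (f a) (Metric.ball y₀ δ₀))
    (hlip : ∀ᵐ a ∂μ, ∀ y ∈ Metric.ball y₀ δ₀, ‖f a y - f a y₀‖ ≤ L a * ‖y - y₀‖)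
    {ε : ℝ} (hε : 0 < ε) :
    ∃ δ > 0, ∀ᶠ p in ℓ, ∀ y ∈ Metric.ball y₀ δ,
      ‖avg (x p) (fun a => f a y) - avg (x p) (fun a => f a y₀) -
        (∫ a, fderiv ℝ (f a) y₀ ∂μ) (y - y₀)‖ ≤ ε * ‖y - y₀‖ := by
  let T : 𝒳 → EuclideanSpace ℝ ι →L[ℝ] F := fun a => fderiv ℝ (f a) y₀
  have hT : Integrable T μ := integrable_fderiv hδ₀ hL hL0 hmeas hdiff hlip
  let rem : 𝒳 → EuclideanSpace ℝ ι → F := fun a y => f a y - f a y₀ - T a (y - y₀)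
  have hrem : ∀ᵐ a ∂μ, ∀ y ∈ Metric.ball y₀ δ₀, ‖rem a y‖ ≤ (L a + L a) * ‖y - y₀‖ := by
    filter_upwards [hlip, ae_norm_fderiv_le hδ₀ hL0 hdiff hlip] with a hal haT y hy
    rw [add_mul]
    exact norm_sub_le_of_le (hal y hy) ((T a).le_of_opNorm_le haT _)
  obtain ⟨t, ht, ρ, hρ, hρε, hremρ⟩ := exists_integrable_slope_lt (h := rem) hδ₀ (hL.add hL)
    (hL0.mono fun a ha => add_nonneg ha ha)
    (fun y hy => ((hmeas y hy).sub (hmeas _ (Metric.mem_ball_self hδ₀))).sub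
      (hT.1.apply_continuousLinearMap _))
    (hcont.mono fun a ha => (ha.sub continuousOn_const).sub (by fun_prop)) hrem
    (hdiff.mono fun a ha => ha.hasFDerivAt.isLittleO) (half_pos hε)
  have hlln := tendsto_iff_norm_sub_tendsto_zero.1 (hs.lln_finiteDimensional hT)
  refine ⟨t, ht, ?_⟩
  filter_upwards [hs.ae _ hremρ, (hs.lln _ hρ).eventually_lt_const hρε,
    hlln.eventually_lt_const (half_pos hε)] with p hprem hpρ hpT y hy
  have hsplit : avg (x p) (fun a => f a y) - avg (x p) (fun a => f a y₀) -
      (∫ a, T a ∂μ) (y - y₀) =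
      avg (x p) (fun a => rem a y) + (avg (x p) T - ∫ a, T a ∂μ) (y - y₀) := by
    rw [avg_sub, avg_sub, ← avg_clm_apply (x p) T, sub_apply]
    abel
  have havg : ‖avg (x p) fun a => rem a y‖ ≤ ε / 2 * ‖y - y₀‖ := calc
    _ ≤ avg (x p) (fun a => ‖rem a y‖) := norm_avg_le _ _
    _ ≤ avg (x p) (fun a => ‖y - y₀‖ * ρ a) :=
      avg_mono _ fun i => (hprem i y hy).trans_eq (mul_comm _ _)
    _ = ‖y - y₀‖ * avg (x p) ρ := avg_mul _ _ _
    _ ≤ ‖y - y₀‖ * (ε / 2) := by gcongr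
    _ = _ := mul_comm _ _
  rw [hsplit, ← add_halves ε, add_mul]
  exact norm_add_le_of_le havg (ContinuousLinearMap.le_of_opNorm_le _ hpT.le _)

end Linearization

/-! ### The moment function near the pseudo-true parameter -/

section Blocks

variable {Ng Nt : ℕ}

/-- The block `τ` as a continuous linear map. -/
noncomputable def tauL : B Ng Nt →L[ℝ] ℝ := EuclideanSpace.proj (Sum.inl ())

/-- The block `κ` as a continuous linear map. -/
noncomputable def kapL : B Ng Nt →L[ℝ] E Ng := LinearMap.toContinuousLinearMap
  { toFun := kapOf, map_add' := fun _ _ => rfl, map_smul' := fun _ _ => rfl }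

/-- The block `λ` as a continuous linear map. -/
noncomputable def lamL : B Ng Nt →L[ℝ] E Ng := LinearMap.toContinuousLinearMap
  { toFun := lamOf, map_add' := fun _ _ => rfl, map_smul' := fun _ _ => rfl }

/-- The block `θ` as a continuous linear map. -/
noncomputable def thL : B Ng Nt →L[ℝ] E Nt := LinearMap.toContinuousLinearMap
  { toFun := thOf, map_add' := fun _ _ => rfl, map_smul' := fun _ _ => rfl }

lemma norm_sq_eq_blocks (β : B Ng Nt) :
    ‖β‖ ^ 2 = tauOf β ^ 2 + ‖kapOf β‖ ^ 2 + ‖lamOf β‖ ^ 2 + ‖thOf β‖ ^ 2 := by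
  simp only [EuclideanSpace.norm_sq_eq, Fintype.sum_sum_type, Real.norm_eq_abs, sq_abs, kapOf,
    lamOf, thOf, tauOf, Finset.univ_unique, Finset.sum_singleton]
  simp [add_assoc]

lemma norm_lamOf_le (β : B Ng Nt) : ‖lamOf β‖ ≤ ‖β‖ := by
  refine le_of_sq_le_sq ?_ (norm_nonneg _)
  linarith [norm_sq_eq_blocks β, sq_nonneg (tauOf β), sq_nonneg ‖kapOf β‖, sq_nonneg ‖thOf β‖]

lemma norm_thOf_le (β : B Ng Nt) : ‖thOf β‖ ≤ ‖β‖ := by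
  refine le_of_sq_le_sq ?_ (norm_nonneg _)
  linarith [norm_sq_eq_blocks β, sq_nonneg (tauOf β), sq_nonneg ‖kapOf β‖, sq_nonneg ‖lamOf β‖]

lemma norm_lamOf_sub_le (β β' : B Ng Nt) : ‖lamOf β - lamOf β'‖ ≤ ‖β - β'‖ :=
  norm_lamOf_le (β - β')

lemma norm_thOf_sub_le (β β' : B Ng Nt) : ‖thOf β - thOf β'‖ ≤ ‖β - β'‖ :=
  norm_thOf_le (β - β')

lemma lamOf_mem_ball {β β₀ : B Ng Nt} {δ : ℝ} (h : β ∈ Metric.ball β₀ δ) :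
    lamOf β ∈ Metric.ball (lamOf β₀) δ :=
  mem_ball_iff_norm.2 ((norm_lamOf_sub_le _ _).trans_lt (mem_ball_iff_norm.1 h))

lemma thOf_mem_ball {β β₀ : B Ng Nt} {δ : ℝ} (h : β ∈ Metric.ball β₀ δ) :
    thOf β ∈ Metric.ball (thOf β₀) δ :=
  mem_ball_iff_norm.2 ((norm_thOf_sub_le _ _).trans_lt (mem_ball_iff_norm.1 h))

end Blocks

lemma abs_exp_sub_exp_le {p q M : ℝ} (hp : Real.exp p ≤ M) (hq : Real.exp q ≤ M) :
    |Real.exp p - Real.exp q| ≤ M * |p - q| := by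
  refine (convex_Iic (max p q)).norm_image_sub_le_of_norm_deriv_le (f := Real.exp)
    (fun _ _ => Real.differentiableAt_exp) (fun y hy => ?_) (le_max_right p q) (le_max_left p q)
  rw [Real.deriv_exp, Real.norm_of_nonneg (Real.exp_pos y).le]
  exact (Real.exp_le_exp.2 hy).trans (by rw [Real.exp_monotone.map_max]; exact max_le hp hq)

lemma opNorm_le_card_mul_of_single {ι F : Type*} [Fintype ι] [DecidableEq ι]
    [NormedAddCommGroup F] [NormedSpace ℝ F] {T : EuclideanSpace ℝ ι →L[ℝ] F} {C : ℝ}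
    (h : ∀ j, ‖T (EuclideanSpace.single j 1)‖ ≤ C) : ‖T‖ ≤ Fintype.card ι * C := by
  have hproj (j : ι) : ‖(EuclideanSpace.proj (𝕜 := ℝ) j : EuclideanSpace ℝ ι →L[ℝ] ℝ)‖ ≤ 1 :=
    ContinuousLinearMap.opNorm_le_bound _ zero_le_one fun v => by
      simpa using PiLp.norm_apply_le v j
  rw [clm_eq_sum_smulRight T, ← nsmul_eq_mul]
  refine (norm_sum_le _ _).trans (Finset.sum_le_card_nsmul _ _ _ fun j _ => ?_)
  rw [ContinuousLinearMap.norm_smulRight_apply]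
  exact (mul_le_of_le_one_left (norm_nonneg _) (hproj j)).trans (h j)

section Local

variable {𝒳 : Type*} {Ng Nt : ℕ} {g : 𝒳 → E Nt → E Ng} {v b : 𝒳 → ℝ}
  {β₀ : B Ng Nt} {δ : ℝ} {a : 𝒳}

/-- The observation `a` is regular near `(l₀, θ₀)`: on the balls of radius `δ`, the tilting factor
is bounded by `v a`, and `g` is `C²` and bounded, together with its derivatives, by `b a`. -/
structure RegularPoint (g : 𝒳 → E Nt → E Ng) (v b : 𝒳 → ℝ) (l₀ : E Ng) (θ₀ : E Nt) (δ : ℝ)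
    (a : 𝒳) : Prop where
  tilt_le : ∀ θ ∈ Metric.ball θ₀ δ, ∀ l ∈ Metric.ball l₀ δ, tilt g a θ l ≤ v a
  contDiff : ContDiffOn ℝ 2 (g a) (Metric.ball θ₀ δ)
  bound_g : ∀ θ ∈ Metric.ball θ₀ δ, ‖g a θ‖ ≤ b a
  bound_G : ∀ θ ∈ Metric.ball θ₀ δ, ‖fderiv ℝ (g a) θ‖ ≤ b a
  bound_S : ∀ θ ∈ Metric.ball θ₀ δ, ∀ j l : Fin Nt, ‖Spart g a θ j l‖ ≤ b a

namespace RegularPoint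

variable {l₀ : E Ng} {θ₀ θ θ' : E Nt} (h : RegularPoint g v b l₀ θ₀ δ a)
include h

lemma contDiffAt (hθ : θ ∈ Metric.ball θ₀ δ) : ContDiffAt ℝ 2 (g a) θ :=
  h.contDiff.contDiffAt (Metric.isOpen_ball.mem_nhds hθ)

lemma differentiableAt_g (hθ : θ ∈ Metric.ball θ₀ δ) : DifferentiableAt ℝ (g a) θ :=
  (h.contDiffAt hθ).differentiableAt two_ne_zero

lemma differentiableAt_Gcol (hθ : θ ∈ Metric.ball θ₀ δ) (j : Fin Nt) :
    DifferentiableAt ℝ (fun θ => Gcol g a θ j) θ :=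
  (((h.contDiffAt hθ).fderiv_right (m := 1) le_rfl).differentiableAt one_ne_zero).clm_apply
    (differentiableAt_const _)

lemma norm_g_sub_le (hθ : θ ∈ Metric.ball θ₀ δ) (hθ' : θ' ∈ Metric.ball θ₀ δ) :
    ‖g a θ - g a θ'‖ ≤ b a * ‖θ - θ'‖ :=
  (convex_ball θ₀ δ).norm_image_sub_le_of_norm_fderiv_le
    (fun _ hz => h.differentiableAt_g hz) h.bound_G hθ' hθ

lemma norm_Gcol_le (hθ : θ ∈ Metric.ball θ₀ δ) (j : Fin Nt) : ‖Gcol g a θ j‖ ≤ b a := by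
  simpa [Gcol] using (fderiv ℝ (g a) θ).le_of_opNorm_le (h.bound_G θ hθ) (EuclideanSpace.single j 1)

lemma norm_Gcol_sub_le (hθ : θ ∈ Metric.ball θ₀ δ) (hθ' : θ' ∈ Metric.ball θ₀ δ) (j : Fin Nt) :
    ‖Gcol g a θ j - Gcol g a θ' j‖ ≤ Nt * b a * ‖θ - θ'‖ := by
  refine (convex_ball θ₀ δ).norm_image_sub_le_of_norm_fderiv_le (f := fun θ => Gcol g a θ j)
    (fun _ hz => h.differentiableAt_Gcol hz j) (fun z hz => ?_) hθ' hθ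
  simpa only [Fintype.card_fin] using opNorm_le_card_mul_of_single fun i => h.bound_S z hz i j

lemma abs_tilt_sub_le {l l' : E Ng} (hθ : θ ∈ Metric.ball θ₀ δ) (hθ' : θ' ∈ Metric.ball θ₀ δ)
    (hl : l ∈ Metric.ball l₀ δ) (hl' : l' ∈ Metric.ball l₀ δ) :
    |tilt g a θ l - tilt g a θ' l'| ≤
      v a * (‖l - l'‖ * b a + (‖l₀‖ + δ) * (b a * ‖θ - θ'‖)) := by
  have hv : 0 ≤ v a := (tilt_pos a θ l).le.trans (h.tilt_le θ hθ l hl)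
  have hl'_norm : ‖l'‖ ≤ ‖l₀‖ + δ :=
    (norm_le_norm_add_norm_sub l₀ l').trans
      (add_le_add_right (mem_ball_iff_norm'.1 hl').le _)
  have hinner : |inner ℝ l (g a θ) - inner ℝ l' (g a θ')| ≤
      ‖l - l'‖ * b a + (‖l₀‖ + δ) * (b a * ‖θ - θ'‖) := by
    have hsplit : inner ℝ l (g a θ) - inner ℝ l' (g a θ') =
        inner ℝ (l - l') (g a θ) + inner ℝ l' (g a θ - g a θ') := by
      rw [inner_sub_left, inner_sub_right, sub_add_sub_cancel]
    rw [hsplit]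
    refine (abs_add_le _ _).trans (add_le_add ?_ ?_)
    · exact (abs_real_inner_le_norm _ _).trans (by gcongr; exact h.bound_g θ hθ)
    · exact (abs_real_inner_le_norm _ _).trans
        (mul_le_mul hl'_norm (h.norm_g_sub_le hθ hθ') (norm_nonneg _)
          ((norm_nonneg _).trans hl'_norm))
  exact (abs_exp_sub_exp_le (h.tilt_le θ hθ l hl) (h.tilt_le θ' hθ' l' hl')).trans
    (mul_le_mul_of_nonneg_left hinner hv)

end RegularPoint

variable (g v b β₀ δ) in
/-- The observations that are regular near the blocks `λ` and `θ` of `β₀`. -/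
def regularPoints : Set 𝒳 := {a | RegularPoint g v b (lamOf β₀) (thOf β₀) δ a}

lemma le_one_add_abs (t : ℝ) : t ≤ 1 + |t| :=
  (le_abs_self t).trans (le_add_of_nonneg_left zero_le_one)

lemma lipGraded_tilt (hδ : 0 < δ) :
    LipGraded (regularPoints g v b β₀ δ) (Metric.ball β₀ δ) v b 1 0
      fun a β => tilt g a (thOf β) (lamOf β) := by
  refine ⟨1 + (‖lamOf β₀‖ + δ), by positivity, fun a ha => ⟨fun β hβ => ?_, fun β hβ β' hβ' => ?_⟩⟩
  · have htilt := ha.tilt_le _ (thOf_mem_ball hβ) _ (lamOf_mem_ball hβ)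
    rw [Real.norm_of_nonneg (tilt_pos _ _ _).le, pow_one, pow_zero, mul_one]
    exact (htilt.trans (le_one_add_abs _)).trans
      (le_mul_of_one_le_left (by positivity) (le_add_of_nonneg_right (by positivity)))
  · have : 0 ≤ v a := (tilt_pos _ _ _).le.trans
      (ha.tilt_le _ (thOf_mem_ball hβ) _ (lamOf_mem_ball hβ))
    have hb : 0 ≤ b a := (norm_nonneg _).trans (ha.bound_g _ (thOf_mem_ball hβ))
    calc
      _ ≤ v a * (‖lamOf β - lamOf β'‖ * b a +
          (‖lamOf β₀‖ + δ) * (b a * ‖thOf β - thOf β'‖)) :=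
        ha.abs_tilt_sub_le (thOf_mem_ball hβ) (thOf_mem_ball hβ') (lamOf_mem_ball hβ)
          (lamOf_mem_ball hβ')
      _ ≤ (1 + |v a|) * (‖β - β'‖ * (1 + |b a|) +
          (‖lamOf β₀‖ + δ) * ((1 + |b a|) * ‖β - β'‖)) := by
        gcongr <;> first | exact le_one_add_abs _ | exact norm_thOf_sub_le β β' |
          exact norm_lamOf_sub_le β β'
      _ = _ := by ring

lemma lipGraded_g :
    LipGraded (regularPoints g v b β₀ δ) (Metric.ball β₀ δ) v b 0 1 fun a β => g a (thOf β) := by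
  refine ⟨1, zero_le_one, fun a ha => ⟨fun β hβ => ?_, fun β hβ β' hβ' => ?_⟩⟩
  · simpa using (ha.bound_g _ (thOf_mem_ball hβ)).trans (le_one_add_abs _)
  · calc
      _ ≤ b a * ‖thOf β - thOf β'‖ := ha.norm_g_sub_le (thOf_mem_ball hβ) (thOf_mem_ball hβ')
      _ ≤ (1 + |b a|) ^ 2 * ‖β - β'‖ := by
        gcongr
        · nlinarith [le_abs_self (b a), abs_nonneg (b a)]
        · exact norm_thOf_sub_le β β'
      _ = _ := by ring

lemma lipGraded_Gcol (j : Fin Nt) :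
    LipGraded (regularPoints g v b β₀ δ) (Metric.ball β₀ δ) v b 0 1
      fun a β => Gcol g a (thOf β) j := by
  refine ⟨1 + Nt, by positivity, fun a ha => ⟨fun β hβ => ?_, fun β hβ β' hβ' => ?_⟩⟩
  · rw [pow_zero, pow_one, one_mul]
    exact ((ha.norm_Gcol_le (thOf_mem_ball hβ) j).trans (le_one_add_abs _)).trans
      (le_mul_of_one_le_left (by positivity) (le_add_of_nonneg_right (by positivity)))
  · have hb : 0 ≤ b a := (norm_nonneg _).trans (ha.bound_g _ (thOf_mem_ball hβ))
    calc
      _ ≤ Nt * b a * ‖thOf β - thOf β'‖ :=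
        ha.norm_Gcol_sub_le (thOf_mem_ball hβ) (thOf_mem_ball hβ') j
      _ ≤ (1 + Nt) * (1 + |b a|) ^ 2 * ‖β - β'‖ := by
        have hNt : (Nt : ℝ) ≤ 1 + Nt := le_add_of_nonneg_left zero_le_one
        gcongr ?_ * ?_
        · refine mul_le_mul hNt ?_ hb (by positivity)
          nlinarith [le_abs_self (b a), abs_nonneg (b a)]
        · exact norm_thOf_sub_le β β'
      _ = _ := by ring

/-- The tilted second moment `exp(λ' g) g g'` as an operator. -/
noncomputable def tiltedGram (g : 𝒳 → E Nt → E Ng) (a : 𝒳) (θ : E Nt) (l : E Ng) :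
    E Ng →L[ℝ] E Ng :=
  tilt g a θ l • (innerSL ℝ (g a θ)).smulRight (g a θ)

lemma tiltedGram_apply (a : 𝒳) (θ : E Nt) (l k : E Ng) :
    tiltedGram g a θ l k = (tilt g a θ l * inner ℝ (g a θ) k) • g a θ := by
  simp [tiltedGram, smul_smul]

lemma lipGraded_tiltedGram (hδ : 0 < δ) :
    LipGraded (regularPoints g v b β₀ δ) (Metric.ball β₀ δ) v b 1 2
      fun a β => tiltedGram g a (thOf β) (lamOf β) :=
  (lipGraded_tilt hδ).smul <| (lipGraded_g.clm (innerSL ℝ)).bilin lipGraded_g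
    (ContinuousLinearMap.smulRightL ℝ (E Ng) (E Ng))

lemma lipGraded_phi (hδ : 0 < δ) :
    LipGraded (regularPoints g v b β₀ δ) (Metric.ball β₀ δ) v b 1 2 (phi g) := by
  have clm {F : Type} [NormedAddCommGroup F] [NormedSpace ℝ F] (L : B Ng Nt →L[ℝ] F) :
      LipGraded (regularPoints g v b β₀ δ) (Metric.ball β₀ δ) v b 0 0 fun _ β => L β :=
    .of_clm Metric.isBounded_ball L
  have ht := (clm tauL).mono zero_le_one le_rfl
  have hx := lipGraded_tilt (g := g) (v := v) (b := b) (β₀ := β₀) hδ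
  have hg := lipGraded_g (g := g) (v := v) (b := b) (β₀ := β₀) (δ := δ)
  have hgk := hg.inner (clm kapL)
  have hG := lipGraded_Gcol (g := g) (v := v) (b := b) (β₀ := β₀) (δ := δ)
  have hGk (j : Fin Nt) := (hG j).inner (clm kapL)
  have hGl (j : Fin Nt) := (hG j).inner (clm lamL)
  refine LipGraded.euclidean ?_
  rintro (- | i | i | j)
  · exact (hx.sub ht).mono le_rfl zero_le_two
  · exact ((hx.smul hg).clm (EuclideanSpace.proj i)).mono le_rfl one_le_two
  · exact ((((ht.sub hx).smul hg).mono le_rfl one_le_two).add ((hx.mul hgk).smul hg)).clm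
      (EuclideanSpace.proj i)
  · exact (((((hx.mul (hGk j)).mono le_rfl one_le_two).add ((hx.mul (hGl j)).mul hgk)).sub
      ((hx.mul (hGl j)).mono le_rfl one_le_two))).add
      ((ht.mul (hGl j)).mono le_rfl one_le_two)

lemma differentiableAt_phi (ha : a ∈ regularPoints g v b β₀ δ) {β : B Ng Nt}
    (hβ : β ∈ Metric.ball β₀ δ) : DifferentiableAt ℝ (phi g a) β := by
  have ht : DifferentiableAt ℝ (fun β : B Ng Nt => tauOf β) β := tauL.differentiableAt
  have hk : DifferentiableAt ℝ (fun β : B Ng Nt => kapOf β) β := kapL.differentiableAt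
  have hl : DifferentiableAt ℝ (fun β : B Ng Nt => lamOf β) β := lamL.differentiableAt
  have hth : DifferentiableAt ℝ (fun β : B Ng Nt => thOf β) β := thL.differentiableAt
  have hg : DifferentiableAt ℝ (fun β : B Ng Nt => g a (thOf β)) β :=
    (ha.differentiableAt_g (thOf_mem_ball hβ)).comp β hth
  have hG (j : Fin Nt) : DifferentiableAt ℝ (fun β : B Ng Nt => Gcol g a (thOf β) j) β :=
    (ha.differentiableAt_Gcol (thOf_mem_ball hβ) j).comp (g := fun θ => Gcol g a θ j) β hth
  have hx : DifferentiableAt ℝ (fun β : B Ng Nt => tilt g a (thOf β) (lamOf β)) β :=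
    (hl.inner ℝ hg).exp
  have hgi := differentiableAt_euclidean.1 hg
  rw [differentiableAt_euclidean]
  rintro (- | i | i | j)
  · exact hx.sub ht
  · exact hx.mul (hgi i)
  · exact ((ht.sub hx).mul (hgi i)).add ((hx.mul (hg.inner ℝ hk)).mul (hgi i))
  · exact (((hx.mul ((hG j).inner ℝ hk)).add ((hx.mul ((hG j).inner ℝ hl)).mul
      (hg.inner ℝ hk))).sub (hx.mul ((hG j).inner ℝ hl))).add (ht.mul ((hG j).inner ℝ hl))

variable [MeasurableSpace 𝒳] {μ : Measure 𝒳}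

/-- Almost every observation is regular near `β₀`, and the monomials in the bounds `v` of the
tilting factor and `b` of `g` and its derivatives are integrable, up to degrees `2` and `4`. -/
structure LocalEnvelope (μ : Measure 𝒳) (g : 𝒳 → E Nt → E Ng) (v b : 𝒳 → ℝ) (β₀ : B Ng Nt)
    (δ : ℝ) : Prop where
  pos : 0 < δ
  measurable_g : Measurable (Function.uncurry g)
  ae_mem : ∀ᵐ a ∂μ, a ∈ regularPoints g v b β₀ δ
  integrable : ∀ i ≤ 2, ∀ j ≤ 4, Integrable (fun a => (1 + |v a|) ^ i * (1 + |b a|) ^ j) μ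

namespace LocalEnvelope

variable (h : LocalEnvelope μ g v b β₀ δ)
include h

lemma measurable_g_left (θ : E Nt) : Measurable fun a => g a θ :=
  h.measurable_g.of_uncurry_right

lemma measurable_tilt_left (θ : E Nt) (l : E Ng) : Measurable fun a => tilt g a θ l :=
  Real.measurable_exp.comp (measurable_const.inner (h.measurable_g_left θ))

lemma aemeasurable_Gcol {β : B Ng Nt} (hβ : β ∈ Metric.ball β₀ δ) (j : Fin Nt) :
    AEMeasurable (fun a => Gcol g a (thOf β) j) μ :=
  (aestronglyMeasurable_fderiv_apply
    (Eventually.of_forall fun θ => (h.measurable_g_left θ).aestronglyMeasurable)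
    (h.ae_mem.mono fun _ ha => ha.differentiableAt_g (thOf_mem_ball hβ)) _).aemeasurable

lemma aestronglyMeasurable_phi {β : B Ng Nt} (hβ : β ∈ Metric.ball β₀ δ) :
    AEStronglyMeasurable (fun a => phi g a β) μ := by
  have hg := (h.measurable_g_left (thOf β)).aemeasurable (μ := μ)
  have hgi (i : Fin Ng) : AEMeasurable (fun a => g a (thOf β) i) μ :=
    (EuclideanSpace.proj (𝕜 := ℝ) i).measurable.comp_aemeasurable hg
  have hgk : AEMeasurable (fun a => inner ℝ (g a (thOf β)) (kapOf β)) μ :=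
    hg.inner aemeasurable_const
  have hG (k : E Ng) (j : Fin Nt) : AEMeasurable (fun a => inner ℝ (Gcol g a (thOf β) j) k) μ :=
    (h.aemeasurable_Gcol hβ j).inner aemeasurable_const
  have hx := (h.measurable_tilt_left (thOf β) (lamOf β)).aemeasurable (μ := μ)
  have ht : AEMeasurable (fun _ : 𝒳 => tauOf β) μ := aemeasurable_const
  refine ((WithLp.measurable_toLp 2 _).comp_aemeasurable
    (aemeasurable_pi_iff.2 ?_)).aestronglyMeasurable
  rintro (- | i | i | j)
  · exact hx.sub ht
  · exact hx.mul (hgi i)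
  · exact ((ht.sub hx).mul (hgi i)).add ((hx.mul hgk).mul (hgi i))
  · exact (((hx.mul (hG _ j)).add ((hx.mul (hG _ j)).mul hgk)).sub (hx.mul (hG _ j))).add
      (ht.mul (hG _ j))

variable {F : Type*} [NormedAddCommGroup F] {f : 𝒳 → B Ng Nt → F} {i j : ℕ}

lemma exists_integrable (hi : i ≤ 2) (hj : j + 1 ≤ 4)
    (hf : LipGraded (regularPoints g v b β₀ δ) (Metric.ball β₀ δ) v b i j f) :
    ∃ L : 𝒳 → ℝ, Integrable L μ ∧ (∀ᵐ a ∂μ, 0 ≤ L a) ∧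
      ∀ᵐ a ∂μ, ∀ β ∈ Metric.ball β₀ δ, ∀ β' ∈ Metric.ball β₀ δ,
        ‖f a β - f a β'‖ ≤ L a * ‖β - β'‖ := by
  obtain ⟨C, hC, hf⟩ := hf
  exact ⟨_, (h.integrable i hi (j + 1) hj).const_mul C, .of_forall fun a => by positivity,
    h.ae_mem.mono fun a ha => (hf a ha).2⟩

lemma integrable_norm_pow (k : ℕ) (hi : i * k ≤ 2) (hj : j * k ≤ 4)
    (hf : LipGraded (regularPoints g v b β₀ δ) (Metric.ball β₀ δ) v b i j f)
    (hfm : AEStronglyMeasurable (fun a => f a β₀) μ) :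
    Integrable (fun a => ‖f a β₀‖ ^ k) μ := by
  obtain ⟨C, -, hf⟩ := hf
  refine ((h.integrable (i * k) hi (j * k) hj).const_mul (C ^ k)).mono' (hfm.norm.pow k) ?_
  filter_upwards [h.ae_mem] with a ha
  rw [norm_pow, norm_norm, pow_mul, pow_mul, ← mul_pow, ← mul_pow]
  exact pow_le_pow_left₀ (norm_nonneg _) ((hf a ha).1 β₀ (Metric.mem_ball_self h.pos)) k

lemma integrable_apply (hi : i ≤ 2) (hj : j ≤ 4)
    (hf : LipGraded (regularPoints g v b β₀ δ) (Metric.ball β₀ δ) v b i j f)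
    (hfm : AEStronglyMeasurable (fun a => f a β₀) μ) : Integrable (fun a => f a β₀) μ :=
  (integrable_norm_iff hfm).1 (by
    simpa using h.integrable_norm_pow 1 (by simpa using hi) (by simpa using hj) hf hfm)

lemma tendsto_avg [NormedSpace ℝ F] [FiniteDimensional ℝ F] (hi : i ≤ 2) (hj : j + 1 ≤ 4)
    (hf : LipGraded (regularPoints g v b β₀ δ) (Metric.ball β₀ δ) v b i j f)
    (hfm : AEStronglyMeasurable (fun a => f a β₀) μ) {I : Type*} {ℓ : Filter I} {n : I → ℕ}
    {x : ∀ p, Fin (n p) → 𝒳} (hs : SampleLLN μ ℓ x) {β : I → B Ng Nt}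
    (hβ : Tendsto β ℓ (𝓝 β₀)) :
    Tendsto (fun p => avg (x p) fun a => f a (β p)) ℓ (𝓝 (∫ a, f a β₀ ∂μ)) := by
  obtain ⟨L, hL, -, hlip⟩ := h.exists_integrable hi hj hf
  refine Metric.tendsto_nhds.2 fun ε hε => ?_
  obtain ⟨δ', hδ', hev⟩ := hs.eventually_forall_ball_norm_avg_sub_integral_lt h.pos hL
    (hlip.mono fun a ha β hβ => ha β hβ β₀ (Metric.mem_ball_self h.pos))
    (h.integrable_apply hi (Nat.le_of_succ_le hj) hf hfm) hε
  filter_upwards [hev, hβ.eventually (Metric.ball_mem_nhds β₀ hδ')] with p hp hpβ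
  rw [dist_eq_norm]
  exact hp _ hpβ

lemma memLp_phi : MemLp (fun a => phi g a β₀) 2 μ :=
  have hm := h.aestronglyMeasurable_phi (Metric.mem_ball_self h.pos)
  (memLp_two_iff_integrable_sq_norm hm).2
    (h.integrable_norm_pow 2 le_rfl le_rfl (lipGraded_phi h.pos) hm)

end LocalEnvelope

end Local

lemma integrable_one_add_pow_mul_one_add_pow {𝒳 : Type*} [MeasurableSpace 𝒳] {μ : Measure 𝒳}
    {u w : 𝒳 → ℝ} {m n : ℕ}
    (h : ∀ i ≤ m, ∀ j ≤ n, Integrable (fun a => u a ^ i * w a ^ j) μ) :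
    Integrable (fun a => (1 + u a) ^ m * (1 + w a) ^ n) μ := by
  simp_rw [add_comm (1 : ℝ), add_pow, one_pow, mul_one, Finset.sum_mul_sum, mul_mul_mul_comm]
  exact integrable_finsetSum _ fun i hi => integrable_finsetSum _ fun j hj =>
    (h i (Finset.mem_range_succ_iff.1 hi) j (Finset.mem_range_succ_iff.1 hj)).mul_const _

section Envelope

variable {𝒳 : Type*} {Ng Nt : ℕ} {g : 𝒳 → E Nt → E Ng}

/-- The supremum of the tilting factor over the balls of radius `δ` about `θ₀` and `l₀`. -/
noncomputable def tiltSup (g : 𝒳 → E Nt → E Ng) (θ₀ : E Nt) (l₀ : E Ng) (δ : ℝ) (a : 𝒳) : ℝ≥0∞ :=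
  ⨆ y ∈ Metric.ball θ₀ δ ×ˢ Metric.ball l₀ δ, ENNReal.ofReal (tilt g a y.1 y.2)

lemma ofReal_tilt_le_tiltSup {θ₀ θ : E Nt} {l₀ l : E Ng} {δ : ℝ} (hθ : θ ∈ Metric.ball θ₀ δ)
    (hl : l ∈ Metric.ball l₀ δ) (a : 𝒳) :
    ENNReal.ofReal (tilt g a θ l) ≤ tiltSup g θ₀ l₀ δ a :=
  le_iSup₂_of_le (θ, l) ⟨hθ, hl⟩ le_rfl

variable [MeasurableSpace 𝒳] {μ : Measure 𝒳} {Θ : Set (E Nt)} {lamS : E Nt → E Ng} {θs : E Nt}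
  {Λ : E Nt → Set (E Ng)} {N : Set (E Nt)} {b : 𝒳 → ℝ} {δ : ℝ}

namespace Regularity

variable (hreg : Regularity μ g Θ lamS θs Λ N b)
include hreg

lemma exists_ball_subset : ∃ δ > 0, Metric.ball θs δ ⊆ N ∧
    ∀ θ ∈ Metric.ball θs δ, Metric.ball (lamS θs) δ ⊆ Λ θ := by
  obtain ⟨r, hr, hΛ⟩ := hreg.interior_lam
  obtain ⟨δ₁, hδ₁, hcont⟩ := Metric.continuousWithinAt_iff.1
    (hreg.continuousOn_lamS θs hreg.theta_mem) (r / 2) (half_pos hr)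
  obtain ⟨δ₂, hδ₂, hN⟩ := Metric.isOpen_iff.1 hreg.isOpen_N θs hreg.mem_N
  have hsub : Metric.ball θs (min (min δ₁ δ₂) (r / 2)) ⊆ N :=
    (Metric.ball_subset_ball ((min_le_left _ _).trans (min_le_right _ _))).trans hN
  refine ⟨_, by positivity, hsub, fun θ hθ l hl => ?_⟩
  have hθΘ := hreg.N_subset (hsub hθ)
  simp only [Metric.mem_ball, lt_min_iff] at hθ hl
  have hlamS := hcont hθΘ hθ.1.1
  rw [dist_comm] at hlamS
  exact hΛ θ hθΘ (Metric.mem_closedBall.2 (by linarith [dist_triangle l (lamS θs) (lamS θ)]))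

lemma ae_nonneg_b : ∀ᵐ a ∂μ, 0 ≤ b a :=
  hreg.bound_g.mono fun _ ha => (norm_nonneg _).trans (ha θs hreg.mem_N)

lemma aemeasurable_tiltSup [StandardBorelSpace 𝒳] [IsFiniteMeasure μ] :
    AEMeasurable (tiltSup g θs (lamS θs) δ) μ :=
  aemeasurable_biSup_of_measurable_uncurry μ
    (h := fun a (y : E Nt × E Ng) => ENNReal.ofReal (tilt g a y.1 y.2))
    (ENNReal.measurable_ofReal.comp hreg.measurable_tilt)
    (measurableSet_ball.prod measurableSet_ball)

lemma lintegral_tiltSup_pow_mul_lt_top (hδ : 0 < δ) (hN : Metric.ball θs δ ⊆ N)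
    (hΛ : ∀ θ ∈ Metric.ball θs δ, Metric.ball (lamS θs) δ ⊆ Λ θ) {i j : ℕ} (hi : i ≤ 2)
    (hj : j ≤ 4) :
    ∫⁻ a, tiltSup g θs (lamS θs) δ a ^ i * ENNReal.ofReal (b a ^ j) ∂μ < ∞ := by
  refine (lintegral_mono fun a => ?_).trans_lt (hreg.bound_moment i hi j hj)
  have : Nonempty ↑(Metric.ball θs δ ×ˢ Metric.ball (lamS θs) δ) :=
    ⟨(θs, lamS θs), Metric.mem_ball_self hδ, Metric.mem_ball_self hδ⟩
  rw [tiltSup, iSup_subtype', ENNReal.iSup_pow, ENNReal.iSup_mul]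
  refine iSup_le fun ⟨y, hy⟩ =>
    le_iSup₂_of_le y.1 (hN hy.1) (le_iSup₂_of_le y.2 (hΛ _ hy.1 hy.2) ?_)
  rw [← ENNReal.ofReal_pow (tilt_pos _ _ _).le, ← ENNReal.ofReal_mul (pow_nonneg
    (tilt_pos _ _ _).le _), tilt, Real.exp_nat_mul]

theorem exists_localEnvelope [StandardBorelSpace 𝒳] [IsFiniteMeasure μ] {β₀ : B Ng Nt}
    (hl : lamOf β₀ = lamS θs) (hθ : thOf β₀ = θs) :
    ∃ δ, Metric.ball θs δ ⊆ N ∧ ∃ v, LocalEnvelope μ g v b β₀ δ := by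
  obtain ⟨δ, hδ, hN, hΛ⟩ := hreg.exists_ball_subset
  have hm : AEMeasurable (tiltSup g θs (lamS θs) δ) μ := hreg.aemeasurable_tiltSup
  have hfin : ∀ᵐ a ∂μ, tiltSup g θs (lamS θs) δ a < ∞ := ae_lt_top' hm (by
    simpa using (hreg.lintegral_tiltSup_pow_mul_lt_top hδ hN hΛ one_le_two (Nat.zero_le 4)).ne)
  refine ⟨δ, hN, fun a => (tiltSup g θs (lamS θs) δ a).toReal, hδ, hreg.measurable_g, ?_,
    fun i hi j hj => integrable_one_add_pow_mul_one_add_pow fun i' hi' j' hj' => ?_⟩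
  · filter_upwards [hfin, hreg.contDiff_g, hreg.bound_g, hreg.bound_G, hreg.bound_S]
      with a hfin hcont hg hG hS
    refine ⟨?_, ?_, ?_, ?_, ?_⟩ <;> rw [hθ]
    · intro θ hθ l hl'
      rw [hl] at hl'
      exact (ENNReal.ofReal_le_iff_le_toReal hfin.ne).1 (ofReal_tilt_le_tiltSup hθ hl' a)
    exacts [hcont.mono hN, fun θ hθ => hg θ (hN hθ), fun θ hθ => hG θ (hN hθ),
      fun θ hθ => hS θ (hN hθ)]
  · refine (integrable_toReal_of_lintegral_ne_top ((hm.pow_const i').mul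
      (hreg.measurable_b.pow_const j').ennreal_ofReal.aemeasurable)
      (hreg.lintegral_tiltSup_pow_mul_lt_top hδ hN hΛ (hi'.trans hi) (hj'.trans hj)).ne).congr ?_
    filter_upwards [hreg.ae_nonneg_b] with a hb
    rw [Pi.mul_apply, ENNReal.toReal_mul, ENNReal.toReal_pow, ENNReal.toReal_ofReal (by positivity),
      abs_of_nonneg ENNReal.toReal_nonneg, abs_of_nonneg hb]

end Regularity

end Envelope

/-! ### Consistency of the augmented estimate -/

lemma tendsto_of_apply_eq {I V : Type*} {ℓ : Filter I} [NormedAddCommGroup V] [NormedSpace ℝ V]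
    [CompleteSpace V] {T : V →L[ℝ] V} (hT : IsUnit T) {A : I → V →L[ℝ] V} {w u : I → V} {u₀ : V}
    (hA : Tendsto A ℓ (𝓝 T)) (hw : Tendsto w ℓ (𝓝 (T u₀))) (h : ∀ᶠ p in ℓ, A p (u p) = w p) :
    Tendsto u ℓ (𝓝 u₀) := by
  obtain ⟨U, rfl⟩ := hT
  have hcancel {S : V →L[ℝ] V} (hS : IsUnit S) (y : V) : Ring.inverse S (S y) = y := by
    rw [← mul_apply_eq_comp, Ring.inverse_mul_cancel _ hS, one_apply_eq_self]
  have hinv : Tendsto (fun p => Ring.inverse (A p)) ℓ (𝓝 (Ring.inverse (U : V →L[ℝ] V))) :=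
    (NormedRing.inverse_continuousAt U).tendsto.comp hA
  have hlim := (isBoundedBilinearMap_apply.continuous.tendsto _).comp (hinv.prodMk_nhds hw)
  rw [hcancel U.isUnit] at hlim
  refine hlim.congr' ?_
  filter_upwards [h, hA.eventually (Units.nhds U)] with p hp hAp
  simp only [Function.comp_apply, ← hp, hcancel hAp]

section Blocks

variable {Ng Nt : ℕ}

lemma mkB_blocks (β : B Ng Nt) : mkB (tauOf β) (kapOf β) (lamOf β) (thOf β) = β := by
  ext i
  rcases i with - | i | i | j <;> rfl

lemma tendsto_mkB {I : Type*} {ℓ : Filter I} {t : I → ℝ} {k l : I → E Ng} {θ : I → E Nt} {t₀ : ℝ}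
    {k₀ l₀ : E Ng} {θ₀ : E Nt} (ht : Tendsto t ℓ (𝓝 t₀)) (hk : Tendsto k ℓ (𝓝 k₀))
    (hl : Tendsto l ℓ (𝓝 l₀)) (hθ : Tendsto θ ℓ (𝓝 θ₀)) :
    Tendsto (fun p => mkB (t p) (k p) (l p) (θ p)) ℓ (𝓝 (mkB t₀ k₀ l₀ θ₀)) := by
  refine ((PiLp.continuous_toLp 2 _).tendsto _).comp (tendsto_pi_nhds.2 ?_)
  rintro (- | i | i | j)
  exacts [ht, ((PiLp.continuous_apply 2 _ i).tendsto _).comp hk,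
    ((PiLp.continuous_apply 2 _ i).tendsto _).comp hl,
    ((PiLp.continuous_apply 2 _ j).tendsto _).comp hθ]

end Blocks

section Gram

variable {𝒳 : Type*} {Ng Nt : ℕ} {g : 𝒳 → E Nt → E Ng}

lemma avg_tiltedGram_apply {n : ℕ} (x : Fin n → 𝒳) (θ : E Nt) (l k : E Ng) :
    avg x (fun a => tiltedGram g a θ l) k =
      avg x fun a => (tilt g a θ l * inner ℝ (g a θ) k) • g a θ := by
  rw [avg_clm_apply]
  exact congrArg (avg x) (funext fun a => tiltedGram_apply a θ l k)

variable [MeasurableSpace 𝒳] {μ : Measure 𝒳} {Θ : Set (E Nt)} {lamS : E Nt → E Ng} {θs : E Nt}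
  {Λ : E Nt → Set (E Ng)} {N : Set (E Nt)} {b : 𝒳 → ℝ}

/-- The operator of the matrix `E[exp(λ*' g) g g']` of `omegaStar`. -/
noncomputable def gramStar (μ : Measure 𝒳) (g : 𝒳 → E Nt → E Ng) (lamS : E Nt → E Ng)
    (θs : E Nt) : E Ng →L[ℝ] E Ng := ∫ a, tiltedGram g a θs (lamS θs) ∂μ

section Integrable

variable (hint : Integrable (fun a => tiltedGram g a θs (lamS θs)) μ)
include hint

lemma integrable_tilt_mul_inner_smul (k : E Ng) :
    Integrable (fun a => (tilt g a θs (lamS θs) * inner ℝ (g a θs) k) • g a θs) μ := by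
  simpa only [tiltedGram_apply] using hint.apply_continuousLinearMap k

lemma gramStar_apply (k : E Ng) :
    gramStar μ g lamS θs k =
      ∫ a, (tilt g a θs (lamS θs) * inner ℝ (g a θs) k) • g a θs ∂μ := by
  simp_rw [gramStar, ContinuousLinearMap.integral_apply hint, tiltedGram_apply]

lemma ae_inner_eq_zero_of_gramStar_apply_eq_zero {k : E Ng} (hk : gramStar μ g lamS θs k = 0) :
    ∀ᵐ a ∂μ, inner ℝ k (g a θs) = 0 := by
  have heq (a : 𝒳) : inner ℝ k ((tilt g a θs (lamS θs) * inner ℝ (g a θs) k) • g a θs) =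
      tilt g a θs (lamS θs) * inner ℝ k (g a θs) ^ 2 := by
    rw [inner_smul_right, real_inner_comm k]
    ring
  have hsq := (integrable_tilt_mul_inner_smul hint k).const_inner (𝕜 := ℝ) k
  have hzero := integral_inner (𝕜 := ℝ) (integrable_tilt_mul_inner_smul hint k) k
  rw [← gramStar_apply hint, hk, inner_zero_right] at hzero
  simp_rw [heq] at hsq hzero
  filter_upwards [(integral_eq_zero_iff_of_nonneg
    (fun a => mul_nonneg (tilt_pos a _ _).le (sq_nonneg _)) hsq).1 hzero] with a ha
  exact pow_eq_zero_iff two_ne_zero |>.1 ((mul_eq_zero.1 ha).resolve_left (tilt_pos _ _ _).ne')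

lemma omegaStar_mulVec (k : E Ng) :
    WithLp.toLp 2 ((omegaStar μ g lamS θs).mulVec k) = gramStar μ g lamS θs k := by
  have hentry (i j : Fin Ng) :
      gramStar μ g lamS θs (EuclideanSpace.single j 1) i = omegaStar μ g lamS θs i j := by
    rw [gramStar_apply hint, omegaStar, Matrix.of_apply]
    have hint' := integrable_tilt_mul_inner_smul hint (EuclideanSpace.single j 1)
    refine ((EuclideanSpace.proj (𝕜 := ℝ) i).integral_comp_comm hint').symm.trans
      (integral_congr_ae (ae_of_all _ fun a => ?_))
    simp [EuclideanSpace.inner_single_right, mul_assoc, mul_comm (g a θs j)]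
  ext i
  conv_rhs => rw [clm_eq_sum_smulRight (gramStar μ g lamS θs)]
  simp [Matrix.mulVec, dotProduct, hentry, mul_comm]

end Integrable

namespace Regularity

variable (hreg : Regularity μ g Θ lamS θs Λ N b)
include hreg

-- Adding `k` to `lamS θ` does not change the tilting factor, so uniqueness of `lamS θ` applies.
lemma eq_zero_of_ae_inner_eq_zero {θ : E Nt} (hθ : θ ∈ Θ) {k : E Ng}
    (hk : ∀ᵐ a ∂μ, inner ℝ k (g a θ) = 0) : k = 0 := by
  have heq : (fun a => tilt g a θ (lamS θ + k) • g a θ) =ᵐ[μ]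
      fun a => tilt g a θ (lamS θ) • g a θ := by
    filter_upwards [hk] with a ha
    rw [tilt, inner_add_left, ha, add_zero, tilt]
  obtain ⟨hint, hzero⟩ := hreg.lamS_solution θ hθ
  simpa using hreg.lamS_unique θ hθ (lamS θ + k)
    ⟨hint.congr heq.symm, (integral_congr_ae heq).trans hzero⟩

variable (hint : Integrable (fun a => tiltedGram g a θs (lamS θs)) μ)
include hint

lemma injective_gramStar : Function.Injective (gramStar μ g lamS θs) :=
  (injective_iff_map_eq_zero _).2 fun _ hk => hreg.eq_zero_of_ae_inner_eq_zero hreg.theta_mem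
    (ae_inner_eq_zero_of_gramStar_apply_eq_zero hint hk)

theorem isUnit_gramStar : IsUnit (gramStar μ g lamS θs) :=
  have hinj := hreg.injective_gramStar hint
  ContinuousLinearMap.isUnit_iff_bijective.2
    ⟨hinj, (LinearMap.injective_iff_surjective (f := (gramStar μ g lamS θs).toLinearMap)).1 hinj⟩

lemma isUnit_omegaStar : IsUnit (omegaStar μ g lamS θs) := by
  refine Matrix.mulVec_injective_iff_isUnit.1 fun k k' hk => ?_
  have heq : gramStar μ g lamS θs (WithLp.toLp 2 k) = gramStar μ g lamS θs (WithLp.toLp 2 k') := by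
    rw [← omegaStar_mulVec hint, ← omegaStar_mulVec hint]
    exact congrArg (WithLp.toLp 2) hk
  exact WithLp.toLp_injective 2 (hreg.injective_gramStar hint heq)

lemma gramStar_kapStar :
    gramStar μ g lamS θs (kapStar μ g lamS θs) = -(tauStar μ g lamS θs • ∫ a, g a θs ∂μ) := by
  have hdet := (Matrix.isUnit_iff_isUnit_det _).1 (hreg.isUnit_omegaStar hint)
  rw [← omegaStar_mulVec hint, kapStar, Matrix.mulVec_neg, Matrix.mulVec_mulVec,
    Matrix.mul_nonsing_inv _ hdet, Matrix.one_mulVec]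
  rfl

end Regularity

end Gram

section Consistency

variable {𝒳 : Type*} [MeasurableSpace 𝒳] {Ng Nt : ℕ} {g : 𝒳 → E Nt → E Ng} {μ : Measure 𝒳}
  {Θ : Set (E Nt)} {lamS : E Nt → E Ng} {θs : E Nt} {Λ : E Nt → Set (E Ng)} {N : Set (E Nt)}
  {b v : 𝒳 → ℝ} {δ : ℝ} {I : Type*} {ℓ : Filter I} {n : I → ℕ} {x : ∀ p, Fin (n p) → 𝒳}
  {β : I → B Ng Nt}

namespace LocalEnvelope

variable {β₀ : B Ng Nt} (h : LocalEnvelope μ g v b β₀ δ)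
include h

lemma aestronglyMeasurable_tiltedGram :
    AEStronglyMeasurable (fun a => tiltedGram g a (thOf β₀) (lamOf β₀)) μ :=
  (h.measurable_tilt_left _ _).aestronglyMeasurable.smul
    ((by fun_prop : Continuous fun u : E Ng => (innerSL ℝ u).smulRight u).comp_aestronglyMeasurable
      (h.measurable_g_left _).aestronglyMeasurable)

lemma integrable_tiltedGram : Integrable (fun a => tiltedGram g a (thOf β₀) (lamOf β₀)) μ :=
  h.integrable_apply one_le_two (by norm_num) (lipGraded_tiltedGram h.pos)
    h.aestronglyMeasurable_tiltedGram

variable (hs : SampleLLN μ ℓ x) (hl : Tendsto (fun p => lamOf (β p)) ℓ (𝓝 (lamOf β₀)))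
  (hθ : Tendsto (fun p => thOf (β p)) ℓ (𝓝 (thOf β₀)))
include hs hl hθ

-- A moment that depends on `β` only through `λ` and `θ` may be evaluated at the parameters with
-- the blocks `τ` and `κ` of `β₀`, which converge to `β₀`.
lemma tendsto_avg_of_lam_theta {F : Type*} [NormedAddCommGroup F] [NormedSpace ℝ F]
    [FiniteDimensional ℝ F] {f : 𝒳 → E Nt → E Ng → F} {i j : ℕ} (hi : i ≤ 2) (hj : j + 1 ≤ 4)
    (hf : LipGraded (regularPoints g v b β₀ δ) (Metric.ball β₀ δ) v b i j
      fun a β => f a (thOf β) (lamOf β))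
    (hfm : AEStronglyMeasurable (fun a => f a (thOf β₀) (lamOf β₀)) μ) :
    Tendsto (fun p => avg (x p) fun a => f a (thOf (β p)) (lamOf (β p))) ℓ
      (𝓝 (∫ a, f a (thOf β₀) (lamOf β₀) ∂μ)) := by
  have hγ := tendsto_mkB (tendsto_const_nhds (x := tauOf β₀)) (tendsto_const_nhds (x := kapOf β₀))
    hl hθ
  rw [mkB_blocks] at hγ
  have hlim := h.tendsto_avg (f := fun a β => f a (thOf β) (lamOf β)) hi hj hf hfm hs hγ
  exact hlim

lemma tendsto_avg_tilt :
    Tendsto (fun p => avg (x p) fun a => tilt g a (thOf (β p)) (lamOf (β p))) ℓ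
      (𝓝 (∫ a, tilt g a (thOf β₀) (lamOf β₀) ∂μ)) :=
  h.tendsto_avg_of_lam_theta hs hl hθ one_le_two (by norm_num) (lipGraded_tilt h.pos)
    (h.measurable_tilt_left _ _).aestronglyMeasurable

lemma tendsto_avg_g :
    Tendsto (fun p => avg (x p) fun a => g a (thOf (β p))) ℓ (𝓝 (∫ a, g a (thOf β₀) ∂μ)) :=
  h.tendsto_avg_of_lam_theta hs hl hθ (f := fun a θ _ => g a θ) zero_le_two (by norm_num)
    lipGraded_g (h.measurable_g_left _).aestronglyMeasurable

lemma tendsto_avg_tiltedGram :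
    Tendsto (fun p => avg (x p) fun a => tiltedGram g a (thOf (β p)) (lamOf (β p))) ℓ
      (𝓝 (∫ a, tiltedGram g a (thOf β₀) (lamOf β₀) ∂μ)) :=
  h.tendsto_avg_of_lam_theta hs hl hθ one_le_two (by norm_num) (lipGraded_tiltedGram h.pos)
    h.aestronglyMeasurable_tiltedGram

end LocalEnvelope

namespace Regularity

variable [StandardBorelSpace 𝒳] [IsFiniteMeasure μ] [NeZero μ]
  (hreg : Regularity μ g Θ lamS θs Λ N b) (hs : SampleLLN μ ℓ x)
  (hβ : ∀ᶠ p in ℓ, IsAugmentedETEL g Θ (x p) (β p))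
include hreg hs hβ

lemma tendsto_thOf : Tendsto (fun p => thOf (β p)) ℓ (𝓝 θs) :=
  Metric.tendsto_nhds.2 fun ε hε => by
    filter_upwards [hreg.eventually_isAugmentedETEL_near hs hε, hβ] with p hp hpβ
    exact mem_ball_iff_norm.2 (hp _ hpβ).1

lemma tendsto_lamOf : Tendsto (fun p => lamOf (β p)) ℓ (𝓝 (lamS θs)) :=
  Metric.tendsto_nhds.2 fun ε hε => by
    filter_upwards [hreg.eventually_isAugmentedETEL_near hs hε, hβ] with p hp hpβ
    exact mem_ball_iff_norm.2 (hp _ hpβ).2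

variable (henv : LocalEnvelope μ g v b (betaStar μ g lamS θs) δ)
include henv

lemma eventually_isUnit_avg_tiltedGram :
    ∀ᶠ p in ℓ, IsUnit (avg (x p) fun a => tiltedGram g a (thOf (β p)) (lamOf (β p))) := by
  obtain ⟨U, hU⟩ := hreg.isUnit_gramStar henv.integrable_tiltedGram
  exact henv.tendsto_avg_tiltedGram hs (hreg.tendsto_lamOf hs hβ) (hreg.tendsto_thOf hs hβ)
    (hU ▸ Units.nhds U)

theorem tendsto_betaStar : Tendsto β ℓ (𝓝 (betaStar μ g lamS θs)) := by
  have hl := hreg.tendsto_lamOf hs hβ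
  have hθ := hreg.tendsto_thOf hs hβ
  have hτ : Tendsto (fun p => tauOf (β p)) ℓ (𝓝 (tauStar μ g lamS θs)) :=
    (henv.tendsto_avg_tilt hs hl hθ).congr' (hβ.mono fun p hp => hp.tau.symm)
  have hκ : Tendsto (fun p => kapOf (β p)) ℓ (𝓝 (kapStar μ g lamS θs)) := by
    refine tendsto_of_apply_eq (hreg.isUnit_gramStar henv.integrable_tiltedGram)
      (w := fun p => -(tauOf (β p) • avg (x p) fun a => g a (thOf (β p))))
      (henv.tendsto_avg_tiltedGram hs hl hθ) ?_ (hβ.mono fun p hp => ?_)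
    · rw [hreg.gramStar_kapStar henv.integrable_tiltedGram]
      exact (hτ.smul (henv.tendsto_avg_g hs hl hθ)).neg
    · rw [avg_tiltedGram_apply]
      exact eq_neg_of_add_eq_zero_left hp.kap
  have hlim := tendsto_mkB hτ hκ hl hθ
  simp only [mkB_blocks] at hlim
  exact hlim

end Regularity

end Consistency

/-! ### First order conditions -/

lemma exists_inner_lagrange_multiplier {V H : Type*} [NormedAddCommGroup V] [NormedSpace ℝ V]
    [CompleteSpace V] [NormedAddCommGroup H] [InnerProductSpace ℝ H] [FiniteDimensional ℝ H]
    {f : V → H} {φ : V → ℝ} {f' : V →L[ℝ] H} {φ' : V →L[ℝ] ℝ} {y : V}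
    (hf : HasStrictFDerivAt f f' y) (hφ : HasStrictFDerivAt φ φ' y)
    (hextr : IsLocalExtrOn φ {z | f z = f y} y) :
    ∃ (m : H) (c : ℝ), (m, c) ≠ 0 ∧ ∀ z, inner ℝ m (f' z) + c * φ' z = 0 := by
  have : CompleteSpace H := FiniteDimensional.complete ℝ H
  obtain ⟨Λ, c, hne, hΛ⟩ := hextr.exists_linear_map_of_hasStrictFDerivAt hf hφ
  have hm (u : H) : inner ℝ ((InnerProductSpace.toDual ℝ H).symm
      (LinearMap.toContinuousLinearMap Λ)) u = Λ u := InnerProductSpace.toDual_symm_apply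
  refine ⟨_, c, fun h0 => hne ?_, fun z => by rw [hm]; exact hΛ z⟩
  rw [Prod.mk_eq_zero] at h0
  refine Prod.mk_eq_zero.2 ⟨LinearMap.ext fun u => ?_, h0.2⟩
  rw [← hm u, h0.1, inner_zero_left, LinearMap.zero_apply]

section FirstOrder

variable {𝒳 : Type*} {Ng Nt n : ℕ} {g : 𝒳 → E Nt → E Ng} {x : Fin n → 𝒳}

section Avg

variable {Y F : Type*} [NormedAddCommGroup Y] [NormedSpace ℝ Y] [NormedAddCommGroup F]
  [NormedSpace ℝ F] {f : 𝒳 → Y → F} {y : Y}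

lemma hasFDerivAt_avg {f' : 𝒳 → Y →L[ℝ] F} (h : ∀ i, HasFDerivAt (f (x i)) (f' (x i)) y) :
    HasFDerivAt (fun y => avg x fun a => f a y) (avg x f') y :=
  (HasFDerivAt.fun_sum fun i _ => h i).const_smul _

lemma contDiffAt_avg {m : WithTop ℕ∞} (h : ∀ i, ContDiffAt ℝ m (f (x i)) y) :
    ContDiffAt ℝ m (fun y => avg x fun a => f a y) y :=
  (ContDiffAt.sum fun i _ => h i).const_smul _

lemma hasStrictFDerivAt_avg {f' : 𝒳 → Y →L[ℝ] F} (hf : ∀ i, ContDiffAt ℝ 1 (f (x i)) y)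
    (h : ∀ i, HasFDerivAt (f (x i)) (f' (x i)) y) :
    HasStrictFDerivAt (fun y => avg x fun a => f a y) (avg x f') y :=
  (contDiffAt_avg hf).hasStrictFDerivAt' (hasFDerivAt_avg h) one_ne_zero

end Avg

section Derivatives

variable {a : 𝒳} {θ : E Nt} {l : E Ng}

/-- The derivative of `(λ, θ) ↦ g(x, θ)`. -/
noncomputable def gDeriv (g : 𝒳 → E Nt → E Ng) (θ : E Nt) (a : 𝒳) : E Ng × E Nt →L[ℝ] E Ng :=
  (fderiv ℝ (g a) θ).comp (ContinuousLinearMap.snd ℝ (E Ng) (E Nt))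

/-- The derivative of `(λ, θ) ↦ exp(λ' g(x, θ))`. -/
noncomputable def tiltDeriv (g : 𝒳 → E Nt → E Ng) (θ : E Nt) (l : E Ng) (a : 𝒳) :
    E Ng × E Nt →L[ℝ] ℝ :=
  tilt g a θ l • ((innerSL ℝ l).comp (gDeriv g θ a) +
    (innerSL ℝ (g a θ)).comp (ContinuousLinearMap.fst ℝ (E Ng) (E Nt)))

/-- The derivative of `(λ, θ) ↦ exp(λ' g(x, θ)) g(x, θ)`. -/
noncomputable def tiltSmulDeriv (g : 𝒳 → E Nt → E Ng) (θ : E Nt) (l : E Ng) (a : 𝒳) :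
    E Ng × E Nt →L[ℝ] E Ng :=
  tilt g a θ l • gDeriv g θ a + (tiltDeriv g θ l a).smulRight (g a θ)

/-- The derivative of `(λ, θ) ↦ tiltDiscrepancy g x θ λ`. -/
noncomputable def tiltDiscrepancyDeriv (g : 𝒳 → E Nt → E Ng) (x : Fin n → 𝒳) (θ : E Nt)
    (l : E Ng) : E Ng × E Nt →L[ℝ] ℝ :=
  (sampleMgf g x θ l)⁻¹ • avg x (tiltDeriv g θ l) -
    (fderivInnerCLM ℝ (l, avg x fun a => g a θ)).comp
      ((ContinuousLinearMap.fst ℝ (E Ng) (E Nt)).prod (avg x (gDeriv g θ)))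

lemma contDiffAt_g_snd (h : ContDiffAt ℝ 1 (g a) θ) :
    ContDiffAt ℝ 1 (fun q : E Ng × E Nt => g a q.2) (l, θ) :=
  ContDiffAt.comp (g := g a) (l, θ) h contDiffAt_snd

lemma contDiffAt_tilt (h : ContDiffAt ℝ 1 (g a) θ) :
    ContDiffAt ℝ 1 (fun q : E Ng × E Nt => tilt g a q.2 q.1) (l, θ) :=
  (contDiffAt_fst.inner ℝ (contDiffAt_g_snd h)).exp

lemma hasFDerivAt_gDeriv (h : DifferentiableAt ℝ (g a) θ) :
    HasFDerivAt (fun q : E Ng × E Nt => g a q.2) (gDeriv g θ a) (l, θ) :=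
  HasFDerivAt.comp (g := g a) (l, θ) h.hasFDerivAt hasFDerivAt_snd

lemma hasFDerivAt_tiltDeriv (h : DifferentiableAt ℝ (g a) θ) :
    HasFDerivAt (fun q : E Ng × E Nt => tilt g a q.2 q.1) (tiltDeriv g θ l a) (l, θ) := by
  have hexp := (HasFDerivAt.inner ℝ (hasFDerivAt_fst (𝕜 := ℝ) (p := (l, θ)))
    (hasFDerivAt_gDeriv h (l := l))).exp
  refine hexp.congr_fderiv (ContinuousLinearMap.ext fun q => ?_)
  simp [tilt, tiltDeriv, gDeriv, fderivInnerCLM_apply, real_inner_comm, mul_add]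

lemma hasFDerivAt_tiltSmulDeriv (h : DifferentiableAt ℝ (g a) θ) :
    HasFDerivAt (fun q : E Ng × E Nt => tilt g a q.2 q.1 • g a q.2)
      (tiltSmulDeriv g θ l a) (l, θ) :=
  (hasFDerivAt_tiltDeriv h).smul (hasFDerivAt_gDeriv h)

lemma hasStrictFDerivAt_avg_tilt_smul (hg : ∀ i, ContDiffAt ℝ 1 (g (x i)) θ) :
    HasStrictFDerivAt (fun q : E Ng × E Nt => avg x fun a => tilt g a q.2 q.1 • g a q.2)
      (avg x (tiltSmulDeriv g θ l)) (l, θ) :=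
  hasStrictFDerivAt_avg (f := fun a (q : E Ng × E Nt) => tilt g a q.2 q.1 • g a q.2)
    (fun i => (contDiffAt_tilt (hg i)).smul (contDiffAt_g_snd (hg i)))
    fun i => hasFDerivAt_tiltSmulDeriv ((hg i).differentiableAt one_ne_zero)

lemma hasStrictFDerivAt_tiltDiscrepancy (hn : 0 < n) (hg : ∀ i, ContDiffAt ℝ 1 (g (x i)) θ) :
    HasStrictFDerivAt (fun q : E Ng × E Nt => tiltDiscrepancy g x q.2 q.1)
      (tiltDiscrepancyDeriv g x θ l) (l, θ) := by
  have hgd (i : Fin n) : DifferentiableAt ℝ (g (x i)) θ := (hg i).differentiableAt one_ne_zero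
  have hmgf : HasStrictFDerivAt (fun q : E Ng × E Nt => sampleMgf g x q.2 q.1)
      (avg x (tiltDeriv g θ l)) (l, θ) :=
    hasStrictFDerivAt_avg (f' := tiltDeriv g θ l) (f := fun a (q : E Ng × E Nt) => tilt g a q.2 q.1)
      (fun i => contDiffAt_tilt (hg i)) fun i => hasFDerivAt_tiltDeriv (hgd i)
  have hmean : HasStrictFDerivAt (fun q : E Ng × E Nt => avg x fun a => g a q.2)
      (avg x (gDeriv g θ)) (l, θ) :=
    hasStrictFDerivAt_avg (f := fun a (q : E Ng × E Nt) => g a q.2)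
      (fun i => contDiffAt_g_snd (hg i)) fun i => hasFDerivAt_gDeriv (hgd i)
  have hinner := HasStrictFDerivAt.inner ℝ (hasStrictFDerivAt_fst (𝕜 := ℝ) (p := (l, θ))) hmean
  exact (hmgf.log (sampleMgf_pos hn).ne').sub hinner

end Derivatives

section Multiplier

variable {θ : E Nt} {l : E Ng}

lemma inner_avg_tiltSmulDeriv_apply (m u : E Ng) (w : E Nt) :
    inner ℝ m (avg x (tiltSmulDeriv g θ l) (u, w)) = avg x fun a =>
      tilt g a θ l * inner ℝ (fderiv ℝ (g a) θ w) m +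
        tilt g a θ l * inner ℝ (fderiv ℝ (g a) θ w) l * inner ℝ (g a θ) m +
        tilt g a θ l * inner ℝ (g a θ) u * inner ℝ (g a θ) m := by
  rw [avg_clm_apply, ← avg_inner]
  refine avg_congr x fun i => ?_
  simp only [tiltSmulDeriv, tiltDeriv, gDeriv, add_apply, smul_apply,
    ContinuousLinearMap.smulRight_apply, ContinuousLinearMap.comp_apply,
    ContinuousLinearMap.coe_fst', ContinuousLinearMap.coe_snd', innerSL_apply_apply,
    inner_add_right, inner_smul_right, smul_eq_mul, real_inner_comm m, real_inner_comm l]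
  ring

lemma tiltDiscrepancyDeriv_apply (u : E Ng) (w : E Nt) :
    tiltDiscrepancyDeriv g x θ l (u, w) = (sampleMgf g x θ l)⁻¹ * avg x (fun a =>
        tilt g a θ l * inner ℝ (fderiv ℝ (g a) θ w) l + tilt g a θ l * inner ℝ (g a θ) u) -
      (avg x (fun a => inner ℝ (fderiv ℝ (g a) θ w) l) + inner ℝ u (avg x fun a => g a θ)) := by
  have hderiv : avg x (tiltDeriv g θ l) (u, w) = avg x fun a =>
      tilt g a θ l * inner ℝ (fderiv ℝ (g a) θ w) l + tilt g a θ l * inner ℝ (g a θ) u := by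
    rw [avg_clm_apply]
    refine avg_congr x fun i => ?_
    simp only [tiltDeriv, gDeriv, add_apply, smul_apply, ContinuousLinearMap.comp_apply,
      ContinuousLinearMap.coe_fst', ContinuousLinearMap.coe_snd', innerSL_apply_apply,
      smul_eq_mul, mul_add, real_inner_comm l]
  have hmean : inner ℝ l (avg x (gDeriv g θ) (u, w)) =
      avg x fun a => inner ℝ (fderiv ℝ (g a) θ w) l := by
    rw [avg_clm_apply, ← avg_inner]
    exact avg_congr x fun i => real_inner_comm _ _
  rw [← hderiv, ← hmean]
  rfl

lemma IsSampleTiltSolution.avg_tilt_mul_inner (h : IsSampleTiltSolution g x θ l) (u : E Ng) :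
    avg x (fun a => tilt g a θ l * inner ℝ (g a θ) u) = 0 := by
  have hu := avg_inner x u fun a => tilt g a θ l • g a θ
  rw [h, inner_zero_right] at hu
  rw [← hu]
  exact avg_congr x fun i => by rw [inner_smul_right, real_inner_comm]

lemma inner_avg_tiltedGram_apply (u k : E Ng) :
    inner ℝ u (avg x (fun a => tiltedGram g a θ l) k) =
      avg x fun a => tilt g a θ l * inner ℝ (g a θ) u * inner ℝ (g a θ) k := by
  rw [avg_tiltedGram_apply, ← avg_inner]
  refine avg_congr x fun i => ?_
  rw [inner_smul_right, real_inner_comm u]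
  ring

lemma avg_tiltedGram_multiplier (hn : 0 < n) (h : IsSampleTiltSolution g x θ l) {m : E Ng} {c : ℝ}
    (hm : ∀ q, inner ℝ m (avg x (tiltSmulDeriv g θ l) q) + c * tiltDiscrepancyDeriv g x θ l q = 0) :
    avg x (fun a => tiltedGram g a θ l) m = c • avg x fun a => g a θ := by
  refine ext_inner_left ℝ fun u => ?_
  have hu := hm (u, 0)
  simp only [inner_avg_tiltSmulDeriv_apply, tiltDiscrepancyDeriv_apply, map_zero, inner_zero_left,
    mul_zero, zero_mul, zero_add, h.avg_tilt_mul_inner, avg_const x hn, zero_sub] at hu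
  rw [inner_avg_tiltedGram_apply, inner_smul_right]
  linarith

end Multiplier

namespace IsAugmentedETEL

variable {Θ : Set (E Nt)} {β : B Ng Nt}

section

variable (h : IsAugmentedETEL g Θ x β) (hn : 0 < n)
include h hn

lemma isLocalExtrOn_tiltDiscrepancy (hΘ : Θ ∈ 𝓝 (thOf β)) :
    IsLocalExtrOn (fun q : E Ng × E Nt => tiltDiscrepancy g x q.2 q.1)
      {q | (avg x fun a => tilt g a q.2 q.1 • g a q.2) =
        avg x fun a => tilt g a (thOf β) (lamOf β) • g a (thOf β)} (lamOf β, thOf β) := by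
  left
  have hmem : ∀ᶠ q in 𝓝 (lamOf β, thOf β), q.2 ∈ Θ := (continuous_snd.tendsto _).eventually hΘ
  filter_upwards [nhdsWithin_le_nhds hmem, self_mem_nhdsWithin] with q hqΘ hq
  exact h.theta.tiltDiscrepancy_le hn h.isSampleTiltSolution hqΘ (hq.trans h.isSampleTiltSolution)

-- `κ` is, up to the factor `τ`, the Lagrange multiplier of the minimization of the discrepancy
-- under the tilting equation.
lemma inner_kapOf_avg_tiltSmulDeriv (hΘ : Θ ∈ 𝓝 (thOf β))
    (hg : ∀ i, ContDiffAt ℝ 1 (g (x i)) (thOf β))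
    (hU : IsUnit (avg x fun a => tiltedGram g a (thOf β) (lamOf β))) (q : E Ng × E Nt) :
    inner ℝ (kapOf β) (avg x (tiltSmulDeriv g (thOf β) (lamOf β)) q) =
      tauOf β * tiltDiscrepancyDeriv g x (thOf β) (lamOf β) q := by
  have hinj := (ContinuousLinearMap.isUnit_iff_bijective.1 hU).1
  obtain ⟨m, c, hne, hm⟩ := exists_inner_lagrange_multiplier
    (hasStrictFDerivAt_avg_tilt_smul (l := lamOf β) hg) (hasStrictFDerivAt_tiltDiscrepancy hn hg)
    (h.isLocalExtrOn_tiltDiscrepancy hn hΘ)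
  have hAm := avg_tiltedGram_multiplier hn h.isSampleTiltSolution hm
  have hAk : avg x (fun a => tiltedGram g a (thOf β) (lamOf β)) (kapOf β) =
      -(tauOf β • avg x fun a => g a (thOf β)) := by
    rw [avg_tiltedGram_apply]
    exact eq_neg_of_add_eq_zero_left h.kap
  have hc : c ≠ 0 := by
    rintro rfl
    exact hne (Prod.mk_eq_zero.2 ⟨hinj (by rw [hAm, zero_smul, map_zero]), rfl⟩)
  have hmk : c • kapOf β = -(tauOf β • m) := hinj (by
    rw [map_neg, map_smul, map_smul, hAm, hAk]
    module)
  refine mul_left_cancel₀ hc ?_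
  rw [← real_inner_smul_left, hmk, inner_neg_left, real_inner_smul_left,
    eq_neg_of_add_eq_zero_left (hm q)]
  ring

lemma avg_theta_block_eq_zero (hΘ : Θ ∈ 𝓝 (thOf β))
    (hg : ∀ i, ContDiffAt ℝ 1 (g (x i)) (thOf β))
    (hU : IsUnit (avg x fun a => tiltedGram g a (thOf β) (lamOf β))) (w : E Nt) :
    avg x (fun a => tilt g a (thOf β) (lamOf β) * inner ℝ (fderiv ℝ (g a) (thOf β) w) (kapOf β)
      + tilt g a (thOf β) (lamOf β) * inner ℝ (fderiv ℝ (g a) (thOf β) w) (lamOf β) *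
        inner ℝ (g a (thOf β)) (kapOf β)
      - tilt g a (thOf β) (lamOf β) * inner ℝ (fderiv ℝ (g a) (thOf β) w) (lamOf β)
      + tauOf β * inner ℝ (fderiv ℝ (g a) (thOf β) w) (lamOf β)) = 0 := by
  have hτ : tauOf β = sampleMgf g x (thOf β) (lamOf β) := h.tau
  have hτ0 : tauOf β ≠ 0 := hτ.trans_ne (sampleMgf_pos hn).ne'
  have hw := h.inner_kapOf_avg_tiltSmulDeriv hn hΘ hg hU (0, w)
  simp only [inner_avg_tiltSmulDeriv_apply, tiltDiscrepancyDeriv_apply, inner_zero_left,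
    inner_zero_right, mul_zero, zero_mul, add_zero, ← hτ] at hw
  rw [avg_add, avg_sub, avg_mul, hw]
  field_simp
  ring

end

theorem avg_phi_eq_zero (h : IsAugmentedETEL g Θ x β) (hn : 0 < n)
    (hΘ : Θ ∈ 𝓝 (thOf β)) (hg : ∀ i, ContDiffAt ℝ 1 (g (x i)) (thOf β))
    (hU : IsUnit (avg x fun a => tiltedGram g a (thOf β) (lamOf β))) :
    avg x (fun a => phi g a β) = 0 := by
  have hτ : tauOf β = sampleMgf g x (thOf β) (lamOf β) := h.tau
  have hcrit : avg x (fun a => tilt g a (thOf β) (lamOf β) • g a (thOf β)) = 0 :=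
    h.isSampleTiltSolution
  have hkap : avg x (fun a => (tilt g a (thOf β) (lamOf β) * inner ℝ (g a (thOf β)) (kapOf β)) •
      g a (thOf β)) + tauOf β • avg x (fun a => g a (thOf β)) = 0 := h.kap
  ext i
  refine (avg_clm x (EuclideanSpace.proj (𝕜 := ℝ) i) fun a => phi g a β).symm.trans ?_
  rcases i with u | i | i | j
  · change avg x (fun a => tilt g a (thOf β) (lamOf β) - tauOf β) = 0
    rw [avg_sub, avg_const x hn, hτ]
    exact sub_self _
  · change avg x (fun a => EuclideanSpace.proj (𝕜 := ℝ) i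
      (tilt g a (thOf β) (lamOf β) • g a (thOf β))) = 0
    rw [avg_clm, hcrit, map_zero]
  · change avg x (fun a => EuclideanSpace.proj (𝕜 := ℝ) i
      ((tauOf β - tilt g a (thOf β) (lamOf β)) • g a (thOf β) +
        (tilt g a (thOf β) (lamOf β) * inner ℝ (g a (thOf β)) (kapOf β)) • g a (thOf β))) = 0
    simp_rw [sub_smul]
    rw [avg_clm, avg_add, avg_sub, avg_smul, hcrit, sub_zero, add_comm, hkap, map_zero]
  · exact h.avg_theta_block_eq_zero hn hΘ hg hU (EuclideanSpace.single j 1)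

end IsAugmentedETEL

end FirstOrder

/-! ### Asymptotic normality -/

section SecondMoment

variable {𝒳 ι : Type*} [MeasurableSpace 𝒳] {μ : Measure 𝒳} {f : 𝒳 → EuclideanSpace ℝ ι}

/-- The second moment matrix `E[f f']` of a random vector. -/
noncomputable def secondMoment (μ : Measure 𝒳) (f : 𝒳 → EuclideanSpace ℝ ι) : Matrix ι ι ℝ :=
  Matrix.of fun i j => ∫ a, f a i * f a j ∂μ

variable [Fintype ι]

lemma dotProduct_secondMoment_mulVec (hf : MemLp f 2 μ) (u v : ι → ℝ) :
    u ⬝ᵥ (secondMoment μ f).mulVec v = ∫ a, (u ⬝ᵥ (f a).ofLp) * (v ⬝ᵥ (f a).ofLp) ∂μ := by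
  have hfi (i : ι) : MemLp (fun a => f a i) 2 μ :=
    (EuclideanSpace.proj (𝕜 := ℝ) i).comp_memLp' hf
  have hint (i j : ι) : Integrable (fun a => u i * f a i * (v j * f a j)) μ :=
    ((hfi i).const_mul (u i)).integrable_mul ((hfi j).const_mul (v j))
  simp only [dotProduct, Finset.sum_mul_sum]
  rw [integral_finsetSum _ fun i _ => integrable_finsetSum _ fun j _ => hint i j]
  refine Finset.sum_congr rfl fun i _ => ?_
  rw [integral_finsetSum _ fun j _ => hint i j, Matrix.mulVec, dotProduct, Finset.mul_sum]
  refine Finset.sum_congr rfl fun j _ => ?_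
  simp_rw [mul_mul_mul_comm (u i)]
  rw [integral_const_mul, secondMoment, Matrix.of_apply]
  ring

lemma posSemidef_secondMoment (hf : MemLp f 2 μ) : (secondMoment μ f).PosSemidef := by
  refine .of_dotProduct_mulVec_nonneg ?_ fun u => ?_
  · ext i j
    simp [secondMoment, mul_comm]
  · rw [star_trivial, dotProduct_secondMoment_mulVec hf]
    exact integral_nonneg fun a => mul_self_nonneg _

lemma secondMoment_toEuclideanCLM [DecidableEq ι] (hf : MemLp f 2 μ) (R : Matrix ι ι ℝ) :
    secondMoment μ (fun a => Matrix.toEuclideanCLM (𝕜 := ℝ) R (f a)) =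
      R * secondMoment μ f * R.transpose := by
  ext i j
  rw [Matrix.mul_assoc, Matrix.mul_apply_eq_vecMul]
  exact (dotProduct_secondMoment_mulVec hf (R i) (R j)).symm

end SecondMoment

section CentralLimit

variable {Ω 𝒳 : Type*} [MeasurableSpace Ω] [MeasurableSpace 𝒳] {P : Measure Ω}
  [IsProbabilityMeasure P] {μ : Measure 𝒳} {X : ℕ → Ω → 𝒳}

lemma tendsto_charFun_inv_sqrt_mul_sum (hlaw : ∀ i, HasLaw (X i) μ P) (hindep : iIndepFun X P)
    {h : 𝒳 → ℝ} (hh : MemLp h 2 μ) (hh0 : ∫ a, h a ∂μ = 0) :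
    Tendsto (fun n : ℕ => charFun (P.map fun ω => (√n)⁻¹ * ∑ k ∈ Finset.range n, h (X k ω)) 1)
      atTop (𝓝 (Complex.exp (-((∫ a, h a ^ 2 ∂μ : ℝ) / 2)))) := by
  have hX (i : ℕ) : AEMeasurable (X i) P := (hlaw i).aemeasurable
  have hhm (i : ℕ) : AEMeasurable h (P.map (X i)) := (hlaw i).map_eq ▸ hh.1.aemeasurable
  have hmean : ∫ ω, h (X 0 ω) ∂P = 0 := ((hlaw 0).integral_comp hh.1).trans hh0
  have hvar : variance (fun ω => h (X 0 ω)) P = ∫ a, h a ^ 2 ∂μ := by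
    rw [variance_of_integral_eq_zero (X := fun ω => h (X 0 ω))
      ((hhm 0).comp_aemeasurable (hX 0)) hmean]
    exact (hlaw 0).integral_comp (f := fun a => h a ^ 2) (hh.1.pow 2)
  have hnonneg : 0 ≤ ∫ a, h a ^ 2 ∂μ := integral_nonneg fun a => sq_nonneg (h a)
  have hclt := tendstoInDistribution_inv_sqrt_mul_sum_sub (X := fun i ω => h (X i ω)) HasLaw.id
    (((hlaw 0).map_eq ▸ hh).comp_of_map (hX 0)) (hindep.comp₀ (fun _ => h) hX hhm)
    fun i => IdentDistrib.comp_of_aemeasurable (u := h)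
      ⟨hX i, hX 0, (hlaw i).map_eq.trans (hlaw 0).map_eq.symm⟩ (hhm i)
  have hlim := ProbabilityMeasure.tendsto_iff_tendsto_charFun.1 hclt.tendsto 1
  simpa [charFun_gaussianReal, hvar, hmean, hnonneg] using hlim

variable {ι : Type*} [Fintype ι] {f : 𝒳 → EuclideanSpace ℝ ι}

-- Cramér–Wold: the characteristic function at `t` is that of the projection onto `t`, at `1`.
theorem tendstoInDistribution_inv_sqrt_smul_sum [DecidableEq ι] (hlaw : ∀ i, HasLaw (X i) μ P)
    (hindep : iIndepFun X P) (hf : MemLp f 2 μ) (hf0 : ∫ a, f a ∂μ = 0) :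
    TendstoInDistribution (fun (n : ℕ) ω => (√n)⁻¹ • ∑ i ∈ Finset.range n, f (X i ω)) atTop
      (id : EuclideanSpace ℝ ι → EuclideanSpace ℝ ι) (fun _ => P)
      (multivariateGaussian 0 (secondMoment μ f)) := by
  have : IsProbabilityMeasure μ := (hlaw 0).isProbabilityMeasure_iff.1 ‹_›
  have hfX (i : ℕ) : AEMeasurable (fun ω => f (X i ω)) P :=
    ((hlaw i).map_eq ▸ hf.1.aemeasurable).comp_aemeasurable (hlaw i).aemeasurable
  have hZ (n : ℕ) : AEMeasurable (fun ω => (√n)⁻¹ • ∑ i ∈ Finset.range n, f (X i ω)) P :=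
    (measurable_const_smul _).comp_aemeasurable (Finset.aemeasurable_fun_sum _ fun i _ => hfX i)
  refine ⟨hZ, aemeasurable_id, ProbabilityMeasure.tendsto_iff_tendsto_charFun.2 fun t => ?_⟩
  have hlim := tendsto_charFun_inv_sqrt_mul_sum hlaw hindep (hf.const_inner t) (by
    rw [integral_inner (𝕜 := ℝ) (hf.integrable one_le_two), hf0, inner_zero_right])
  have hquad : ∫ a, inner ℝ t (f a) ^ 2 ∂μ = t.ofLp ⬝ᵥ (secondMoment μ f).mulVec t.ofLp := by
    rw [dotProduct_secondMoment_mulVec hf]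
    simp [pow_two, EuclideanSpace.inner_eq_star_dotProduct, dotProduct_comm]
  have hgauss : charFun ((multivariateGaussian 0 (secondMoment μ f)).map id) t =
      Complex.exp (-((∫ a, inner ℝ t (f a) ^ 2 ∂μ : ℝ) / 2)) := by
    rw [Measure.map_id, charFun_multivariateGaussian (posSemidef_secondMoment hf), hquad]
    simp
  refine (hgauss ▸ hlim).congr fun n => ?_
  have hproj : charFun (P.map fun ω => (√n)⁻¹ • ∑ i ∈ Finset.range n, f (X i ω)) t =
      charFun (P.map fun ω => (√n)⁻¹ * ∑ i ∈ Finset.range n, inner ℝ t (f (X i ω))) 1 := by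
    rw [charFun_eq_charFunDual_toDualMap, charFunDual_eq_charFun_map_one,
      AEMeasurable.map_map_of_aemeasurable (by fun_prop) (hZ n)]
    congr with ω
    simp
  exact hproj.symm

end CentralLimit

section Estimation

lemma sqrt_smul_avg {𝒳 E : Type*} [AddCommGroup E] [Module ℝ E] (n : ℕ) (x : ℕ → 𝒳) (f : 𝒳 → E) :
    √(n : ℝ) • avg (fun i : Fin n => x i) f = (√n)⁻¹ • ∑ i ∈ Finset.range n, f (x i) := by
  rw [avg, Fin.sum_univ_eq_sum_range (fun i => f (x i)), smul_smul, ← div_eq_mul_inv,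
    Real.sqrt_div_self]

variable {Ω : Type*} [MeasurableSpace Ω] {P : Measure Ω}

lemma isTightMeasureSet_range_map {ι : Type*} [Finite ι] [IsProbabilityMeasure P]
    {Z : ℕ → Ω → EuclideanSpace ℝ ι} {ν : Measure (EuclideanSpace ℝ ι)} [IsProbabilityMeasure ν]
    (h : TendstoInDistribution Z atTop (id : EuclideanSpace ℝ ι → EuclideanSpace ℝ ι)
      (fun _ => P) ν) :
    IsTightMeasureSet (Set.range fun n => P.map (Z n)) := by
  cases nonempty_fintype ι
  have hp (n : ℕ) : IsProbabilityMeasure (P.map (Z n)) :=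
    Measure.isProbabilityMeasure_map (h.forall_aemeasurable n)
  have hlim := ProbabilityMeasure.tendsto_iff_tendsto_charFun.1 h.tendsto
  simp only [ProbabilityMeasure.coe_mk, Measure.map_id] at hlim
  exact isTightMeasureSet_of_tendsto_charFun continuous_charFun.continuousAt hlim

-- Tightness bounds `Z` by a constant `K` up to a small probability, so that an error relative to
-- `Z` becomes an absolute one.
lemma tendstoInMeasure_sub_of_isLittleO {F : Type*} [NormedAddCommGroup F] [MeasurableSpace F]
    [BorelSpace F] {D Z : ℕ → Ω → F} (hZm : ∀ n, AEMeasurable (Z n) P)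
    (hZ : IsTightMeasureSet (Set.range fun n => P.map (Z n)))
    (h : (fun p : ℕ × Ω => D p.1 p.2 - Z p.1 p.2) =o[inProbability P] fun p => Z p.1 p.2) :
    TendstoInMeasure P (D - Z) atTop 0 := by
  rw [tendstoInMeasure_iff_norm]
  refine fun ε hε => ENNReal.tendsto_atTop_zero.2 fun c hc => ?_
  have hc2 : 0 < c / 2 := ENNReal.half_pos hc.ne'
  obtain ⟨K, hK, hK0⟩ := (((tendsto_measure_norm_gt_of_isTightMeasureSet hZ).eventually
    (ge_mem_nhds hc2)).and (eventually_gt_atTop 0)).exists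
  have hlarge (n : ℕ) : P {ω | K < ‖Z n ω‖} ≤ c / 2 := by
    have hle := (le_iSup₂ (f := fun (ν : Measure F) (_ : ν ∈ Set.range fun n => P.map (Z n)) =>
      ν {x | K < ‖x‖}) (P.map (Z n)) ⟨n, rfl⟩).trans hK
    rwa [Measure.map_apply_of_aemeasurable (hZm n)
      (measurableSet_lt measurable_const measurable_norm)] at hle
  have hη : 0 < ε / (2 * K) := by positivity
  obtain ⟨n₀, hn₀⟩ := eventually_atTop.1
    ((eventually_inProbability.1 (h.def hη)).eventually (ge_mem_nhds hc2))
  refine ⟨n₀, fun n hn => ?_⟩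
  calc P {ω | ε ≤ ‖(D - Z) n ω - (0 : ℕ → Ω → F) n ω‖}
      ≤ P ({ω | ¬ ‖D n ω - Z n ω‖ ≤ ε / (2 * K) * ‖Z n ω‖} ∪ {ω | K < ‖Z n ω‖}) := by
        refine measure_mono fun ω hω => ?_
        by_contra! hcon
        simp only [Set.mem_union, Set.mem_ofPred_eq, not_or, not_lt] at hcon hω
        have hω : ε ≤ ‖D n ω - Z n ω‖ := by simpa using hω
        have hsmall : ‖D n ω - Z n ω‖ ≤ ε / 2 := calc
          _ ≤ ε / (2 * K) * ‖Z n ω‖ := hcon.1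
          _ ≤ ε / (2 * K) * K := by gcongr; exact hcon.2
          _ = ε / 2 := by field_simp
        linarith
    _ ≤ c / 2 + c / 2 := (measure_union_le _ _).trans (add_le_add (hn₀ n hn) (hlarge n))
    _ = c := ENNReal.add_halves c

variable [IsProbabilityMeasure P] {𝒳 ι : Type*} [MeasurableSpace 𝒳] [Fintype ι] [DecidableEq ι]
  {μ : Measure 𝒳} {X : ℕ → Ω → 𝒳} {f : 𝒳 → EuclideanSpace ℝ ι}

theorem tendstoInDistribution_sqrt_smul (hlaw : ∀ i, HasLaw (X i) μ P) (hindep : iIndepFun X P)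
    (hf : MemLp f 2 μ) (hf0 : ∫ a, f a ∂μ = 0) {A : Matrix ι ι ℝ} (hA : IsUnit A.det)
    {d : ℕ → Ω → EuclideanSpace ℝ ι} (hd : ∀ n, AEMeasurable (d n) P)
    (hlin : (fun p : ℕ × Ω => avg (fun i : Fin p.1 => X i p.2) f +
      Matrix.toEuclideanCLM (𝕜 := ℝ) A (d p.1 p.2)) =o[inProbability P] fun p => d p.1 p.2) :
    TendstoInDistribution (fun (n : ℕ) ω => √n • d n ω) atTop
      (id : EuclideanSpace ℝ ι → EuclideanSpace ℝ ι) (fun _ => P)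
      (multivariateGaussian 0 (A⁻¹ * secondMoment μ f * A.transpose⁻¹)) := by
  have : IsProbabilityMeasure μ := (hlaw 0).isProbabilityMeasure_iff.1 ‹_›
  let R : EuclideanSpace ℝ ι →L[ℝ] EuclideanSpace ℝ ι := Matrix.toEuclideanCLM (𝕜 := ℝ) (-A⁻¹)
  have hRA (v : EuclideanSpace ℝ ι) : R (Matrix.toEuclideanCLM (𝕜 := ℝ) A v) = -v := by
    rw [← mul_apply_eq_comp, ← map_mul, neg_mul, Matrix.nonsing_inv_mul _ hA, map_neg, map_one,
      neg_apply, one_apply_eq_self]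
  have hR0 : ∫ a, R (f a) ∂μ = 0 := by
    rw [R.integral_comp_comm (hf.integrable one_le_two), hf0, map_zero]
  have hclt := tendstoInDistribution_inv_sqrt_smul_sum hlaw hindep (R.comp_memLp' hf) hR0
  have hcov : secondMoment μ (R ∘ f) = A⁻¹ * secondMoment μ f * A.transpose⁻¹ :=
    (secondMoment_toEuclideanCLM hf (-A⁻¹)).trans (by simp [Matrix.transpose_nonsing_inv])
  let D : ℕ × Ω → EuclideanSpace ℝ ι := fun p => √(p.1 : ℝ) • d p.1 p.2
  let Z : ℕ × Ω → EuclideanSpace ℝ ι := fun p =>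
    (√(p.1 : ℝ))⁻¹ • ∑ i ∈ Finset.range p.1, R (f (X i p.2))
  have hZD : (fun p => Z p - D p) =o[inProbability P] D := by
    refine ((Asymptotics.isBigO_refl (fun p : ℕ × Ω => √(p.1 : ℝ)) _).smul_isLittleO
      ((R.isBigO_comp _ _).trans_isLittleO hlin)).congr_left fun p => ?_
    rw [map_add, hRA, ← avg_clm, smul_add, sqrt_smul_avg p.1 (fun i => X i p.2), smul_neg,
      ← sub_eq_add_neg]
  have hDZ : (fun p => D p - Z p) =o[inProbability P] Z :=
    (show Asymptotics.IsEquivalent (inProbability P) Z D from hZD).symm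
  rw [← hcov]
  exact tendstoInDistribution_of_tendstoInMeasure_sub _ _ hclt
    (tendstoInMeasure_sub_of_isLittleO hclt.forall_aemeasurable (isTightMeasureSet_range_map hclt)
      hDZ) fun n => (measurable_const_smul (√(n : ℝ))).comp_aemeasurable (hd n)

end Estimation

section MomentEquations

variable {𝒳 : Type*} [MeasurableSpace 𝒳] {μ : Measure 𝒳} {Ng Nt : ℕ} {g : 𝒳 → E Nt → E Ng}
  {v b : 𝒳 → ℝ} {β₀ : B Ng Nt} {δ : ℝ}

lemma toEuclideanCLM_Gam (hint : Integrable (fun a => fderiv ℝ (phi g a) β₀) μ) :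
    Matrix.toEuclideanCLM (𝕜 := ℝ) (Gam μ g β₀) = ∫ a, fderiv ℝ (phi g a) β₀ ∂μ := by
  have hentry (i j : Idx Ng Nt) :
      ((∫ a, fderiv ℝ (phi g a) β₀ ∂μ) (EuclideanSpace.single j 1)) i = Gam μ g β₀ i j := by
    rw [ContinuousLinearMap.integral_apply hint]
    exact ((EuclideanSpace.proj (𝕜 := ℝ) i : B Ng Nt →L[ℝ] ℝ).integral_comp_comm
      (hint.apply_continuousLinearMap (EuclideanSpace.single j 1))).symm
  ext w i
  rw [Matrix.ofLp_toEuclideanCLM]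
  conv_rhs => rw [clm_eq_sum_smulRight (∫ a, fderiv ℝ (phi g a) β₀ ∂μ)]
  simp [Matrix.mulVec, dotProduct, hentry, mul_comm]

variable {I : Type*} {ℓ : Filter I} {n : I → ℕ} {x : ∀ p, Fin (n p) → 𝒳} {β : I → B Ng Nt}

theorem LocalEnvelope.isLittleO_avg_phi (h : LocalEnvelope μ g v b β₀ δ) (hs : SampleLLN μ ℓ x)
    (hβ : Tendsto β ℓ (𝓝 β₀)) :
    (fun p => avg (x p) (fun a => phi g a (β p)) - avg (x p) (fun a => phi g a β₀) -
      Matrix.toEuclideanCLM (𝕜 := ℝ) (Gam μ g β₀) (β p - β₀)) =o[ℓ] fun p => β p - β₀ := by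
  have hmem : β₀ ∈ Metric.ball β₀ δ := Metric.mem_ball_self h.pos
  obtain ⟨L, hL, hL0, hlip⟩ := h.exists_integrable one_le_two (by norm_num) (lipGraded_phi h.pos)
  have hmeas (β) (hβ : β ∈ Metric.ball β₀ δ) := h.aestronglyMeasurable_phi hβ
  have hdiff : ∀ᵐ a ∂μ, ∀ β ∈ Metric.ball β₀ δ, DifferentiableAt ℝ (phi g a) β :=
    h.ae_mem.mono fun a ha β hβ => differentiableAt_phi ha hβ
  have hdiff₀ := hdiff.mono fun a ha => ha β₀ hmem
  have hcont : ∀ᵐ a ∂μ, ContinuousOn (phi g a) (Metric.ball β₀ δ) :=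
    hdiff.mono fun a ha β hβ => (ha β hβ).continuousAt.continuousWithinAt
  have hlip₀ := hlip.mono fun a ha β hβ => ha β hβ β₀ hmem
  rw [toEuclideanCLM_Gam (integrable_fderiv h.pos hL hL0 hmeas hdiff₀ hlip₀)]
  refine Asymptotics.isLittleO_iff.2 fun ε hε => ?_
  obtain ⟨δ', hδ', hev⟩ :=
    hs.eventually_norm_avg_sub_fderiv_le h.pos hL hL0 hmeas hdiff₀ hcont hlip₀ hε
  filter_upwards [hev, hβ (Metric.ball_mem_nhds β₀ hδ')] with p hp hpβ using hp _ hpβ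

variable [StandardBorelSpace 𝒳] [IsFiniteMeasure μ] [NeZero μ] {Θ : Set (E Nt)}
  {lamS : E Nt → E Ng} {θs : E Nt} {Λ : E Nt → Set (E Ng)} {N : Set (E Nt)}

namespace Regularity

variable (hreg : Regularity μ g Θ lamS θs Λ N b) (hs : SampleLLN μ ℓ x)
  (hβ : ∀ᶠ p in ℓ, IsAugmentedETEL g Θ (x p) (β p))
  (henv : LocalEnvelope μ g v b (betaStar μ g lamS θs) δ)
include hreg hs hβ henv

theorem eventually_avg_phi_eq_zero (hN : Metric.ball θs δ ⊆ N) :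
    ∀ᶠ p in ℓ, avg (x p) (fun a => phi g a (β p)) = 0 := by
  have hball : ∀ᶠ p in ℓ, β p ∈ Metric.ball (betaStar μ g lamS θs) δ :=
    hreg.tendsto_betaStar hs hβ henv (Metric.ball_mem_nhds _ henv.pos)
  filter_upwards [hβ, hreg.eventually_isUnit_avg_tiltedGram hs hβ henv, hs.size_pos,
    hs.ae _ henv.ae_mem, hball, hreg.tendsto_thOf hs hβ (Metric.ball_mem_nhds _ henv.pos)]
    with p hp hU hn hx hp₀ hθ
  have hΘ : Θ ∈ 𝓝 (thOf (β p)) :=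
    mem_of_superset (Metric.isOpen_ball.mem_nhds hθ) (hN.trans hreg.N_subset)
  have hg (i : Fin (n p)) : ContDiffAt ℝ 1 (g (x p i)) (thOf (β p)) :=
    ((hx i).contDiffAt (thOf_mem_ball hp₀)).of_le one_le_two
  exact hp.avg_phi_eq_zero hn hΘ hg hU

theorem isLittleO_avg_phi_betaStar_add (hN : Metric.ball θs δ ⊆ N) :
    (fun p => avg (x p) (fun a => phi g a (betaStar μ g lamS θs)) +
      Matrix.toEuclideanCLM (𝕜 := ℝ) (Gam μ g (betaStar μ g lamS θs))
        (β p - betaStar μ g lamS θs)) =o[ℓ] fun p => β p - betaStar μ g lamS θs := by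
  refine (henv.isLittleO_avg_phi hs (hreg.tendsto_betaStar hs hβ henv)).neg_left.congr' ?_ .rfl
  filter_upwards [hreg.eventually_avg_phi_eq_zero hs hβ henv hN] with p hp
  rw [hp, zero_sub, ← neg_add', neg_neg]

lemma integral_phi_betaStar [ℓ.NeBot] (hN : Metric.ball θs δ ⊆ N) :
    ∫ a, phi g a (betaStar μ g lamS θs) ∂μ = 0 :=
  tendsto_nhds_unique
    (henv.tendsto_avg one_le_two (by norm_num) (lipGraded_phi henv.pos)
      (henv.aestronglyMeasurable_phi (Metric.mem_ball_self henv.pos)) hs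
      (hreg.tendsto_betaStar hs hβ henv))
    (tendsto_const_nhds.congr' ((hreg.eventually_avg_phi_eq_zero hs hβ henv hN).mono
      fun _ h => h.symm))

end Regularity

end MomentEquations

end ETEL

theorem theorem10 {Ω 𝒳 : Type*} [MeasurableSpace Ω] [MeasurableSpace 𝒳] [StandardBorelSpace 𝒳]
    (P : Measure Ω) [IsProbabilityMeasure P] (μ : Measure 𝒳) {Ng Nt : ℕ}
    (X : ℕ → Ω → 𝒳) (hlaw : ∀ i, HasLaw (X i) μ P) (hindep : iIndepFun X P)
    (g : 𝒳 → ETEL.E Nt → ETEL.E Ng) (Θ : Set (ETEL.E Nt))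
    (lamS : ETEL.E Nt → ETEL.E Ng) (θs : ETEL.E Nt)
    (Λ : ETEL.E Nt → Set (ETEL.E Ng)) (N : Set (ETEL.E Nt)) (b : 𝒳 → ℝ)
    (hreg : ETEL.Regularity μ g Θ lamS θs Λ N b)
    (hΓ : IsUnit (ETEL.Gam μ g (ETEL.betaStar μ g lamS θs)).det)
    (βhat : ℕ → Ω → ETEL.B Ng Nt) (hmeas : ∀ n, AEMeasurable (βhat n) P)
    (hβ : Tendsto (fun n => P {ω | ¬ ETEL.IsAugmentedETEL g Θ (fun i : Fin n => X i ω) (βhat n ω)})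
      atTop (𝓝 0)) :
    TendstoInDistribution
      (fun (n : ℕ) ω => Real.sqrt n • (βhat n ω - ETEL.betaStar μ g lamS θs)) atTop
      (id : ETEL.B Ng Nt → ETEL.B Ng Nt) (fun _ => P)
      (multivariateGaussian 0
        ((ETEL.Gam μ g (ETEL.betaStar μ g lamS θs))⁻¹
          * ETEL.Phi μ g (ETEL.betaStar μ g lamS θs)
          * ((ETEL.Gam μ g (ETEL.betaStar μ g lamS θs)).transpose)⁻¹)) := by
  have : IsProbabilityMeasure μ := (hlaw 0).isProbabilityMeasure_iff.1 ‹_›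
  have hs := ETEL.sampleLLN_inProbability hlaw fun i j hij => hindep.indepFun hij
  have haug : ∀ᶠ p in ETEL.inProbability P,
      ETEL.IsAugmentedETEL g Θ (fun i : Fin p.1 => X i p.2) (βhat p.1 p.2) :=
    ETEL.eventually_inProbability.2 hβ
  obtain ⟨δ, hN, v, henv⟩ := hreg.exists_localEnvelope (β₀ := ETEL.betaStar μ g lamS θs) rfl rfl
  have hmean := hreg.integral_phi_betaStar hs haug henv hN
  have hlin := hreg.isLittleO_avg_phi_betaStar_add hs haug henv hN
  exact ETEL.tendstoInDistribution_sqrt_smul hlaw hindep henv.memLp_phi hmean hΓ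
    (d := fun n ω => βhat n ω - ETEL.betaStar μ g lamS θs) (fun n => (hmeas n).sub_const _) hlin
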